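/- Let $X$ and $Y$ be compact Riemann surfaces (not assumed connected), and let $\varphi\colon X\to Y$ be a holomorphic map that is not constant on any connected component of $X$ (for connected $X$: a non-constant holomorphic map). For a compact Riemann surface $Z$ let $C^\infty(Z)$ be the space of smooth complex-valued functions on $Z$, and let $L^2_1(Z)$ be the space of (classes of) functions $f\in L^2(Z)$ whose distributional derivatives $\partial f$ and $\bar\partial f$ are square integrable. For a positive continuous $2$-form $\nu$ on $Z$, the space $L^2_1(Z)$ carries the norm $$\|f\|_\nu^2=\int_Z |f|^2\,\nu+i\int_Z \partial f\wedge\overline{\partial f},$$ whose topology (independent of $\nu$) is called the $L^2_1$ topology; $C^\infty(Z)\subset L^2_1(Z)$ is given the induced topology. For $f\in C^\infty(Y)$ and $g\in C^\infty(X)$ put $$\varphi^*f=f\circ\varphi,\qquad (\varphi_*g)(y)=\sum_{x\in\varphi^{-1}(y)}e_x\,g(x),$$ where $e_x$ is the ramification index of $\varphi$ at $x$ (the fibres of $\varphi$ are finite). Then, for any positive continuous $2$-forms $\nu_X$ on $X$ and $\nu_Y$ on $Y$, $\varphi^*f\in C^\infty(X)$ for all $f\in C^\infty(Y)$, $\varphi_*g\in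 L^2_1(Y)$ for all $g\in C^\infty(X)$, and the linear maps $$\varphi^*\colon C^\infty(Y)\to C^\infty(X),\qquad \varphi_*\colon C^\infty(X)\to L^2_1(Y)$$ are continuous for the $L^2_1$ topologies (defined by $\nu_X$ and $\nu_Y$). Consequently they extend, each in exactly one way, to continuous linear maps $$\varphi^*\colon L^2_1(Y)\to L^2_1(X),\qquad \varphi_*\colon L^2_1(X)\to L^2_1(Y).$$ -/

import Mathlib

open scoped Manifold ContDiff Topology ComplexConjugate
open MeasureTheory Set Function

namespace RiemannSurfaceL21

/-! ### Calculus in an open subset of the complex plane -/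

/-- The Wirtinger derivative `∂ψ/∂z = (∂ψ/∂x - i ∂ψ/∂y) / 2`. -/
noncomputable def dz (ψ : ℂ → ℂ) (z : ℂ) : ℂ :=
  (fderiv ℝ ψ z 1 - Complex.I * fderiv ℝ ψ z Complex.I) / 2

/-- The Wirtinger derivative `∂ψ/∂z̄ = (∂ψ/∂x + i ∂ψ/∂y) / 2`. -/
noncomputable def dzbar (ψ : ℂ → ℂ) (z : ℂ) : ℂ :=
  (fderiv ℝ ψ z 1 + Complex.I * fderiv ℝ ψ z Complex.I) / 2

/-- `ψ` is a test function on `U`: smooth, with compact support contained in `U`. -/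
structure IsTestFunction (U : Set ℂ) (ψ : ℂ → ℂ) : Prop where
  contDiff : ContDiff ℝ ∞ ψ
  hasCompactSupport : HasCompactSupport ψ
  tsupport_subset : tsupport ψ ⊆ U

/-- `D u = w` on `U` in the sense of distributions, where `D` is one of `dz`, `dzbar`
and `u`, `w` are locally integrable on `U`. -/
structure IsWeakDeriv (D : (ℂ → ℂ) → ℂ → ℂ) (U : Set ℂ) (u w : ℂ → ℂ) : Prop where
  locInt_fun : LocallyIntegrableOn u U
  locInt_deriv : LocallyIntegrableOn w U
  integral_eq : ∀ ψ, IsTestFunction U ψ → ∫ z in U, u z * D ψ z = - ∫ z in U, w z * ψ z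

/-- `w` is square integrable on every compact subset of `U`. -/
def IsL2Loc (U : Set ℂ) (w : ℂ → ℂ) : Prop :=
  ∀ K ⊆ U, IsCompact K → MemLp w 2 (volume.restrict K)

/-- The distributional derivative `D u` on `U` is a locally square integrable function. -/
def HasL2Deriv (D : (ℂ → ℂ) → ℂ → ℂ) (U : Set ℂ) (u : ℂ → ℂ) : Prop :=
  ∃ w, IsWeakDeriv D U u w ∧ IsL2Loc U w

lemma IsTestFunction.integrable_mul {U : Set ℂ} {u ψ φ : ℂ → ℂ}
    (hψ : IsTestFunction U ψ) (hφ : Continuous φ) (hs : ∀ z, z ∉ tsupport ψ → φ z = 0)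
    (hu : LocallyIntegrableOn u U) : IntegrableOn (fun z => u z * φ z) U := by
  have h1 : IntegrableOn u (tsupport ψ) :=
    hu.integrableOn_compact_subset hψ.tsupport_subset hψ.hasCompactSupport
  have h2 : IntegrableOn (fun z => u z * φ z) (tsupport ψ) :=
    h1.mul_continuousOn hφ.continuousOn hψ.hasCompactSupport
  have h3 : Integrable (fun z => u z * φ z) := by
    refine (integrableOn_iff_integrable_of_support_subset ?_).1 h2
    intro z hz
    by_contra h
    exact hz (by simp [hs z h])
  exact h3.integrableOn

lemma IsTestFunction.fderiv_zero {U : Set ℂ} {ψ : ℂ → ℂ} (_hψ : IsTestFunction U ψ)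
    (z : ℂ) (hz : z ∉ tsupport ψ) : fderiv ℝ ψ z = 0 := by
  by_contra h
  exact hz (support_fderiv_subset ℝ h)

lemma IsTestFunction.continuous_fderiv {U : Set ℂ} {ψ : ℂ → ℂ} (hψ : IsTestFunction U ψ)
    (v : ℂ) : Continuous (fun z => fderiv ℝ ψ z v) :=
  (hψ.contDiff.continuous_fderiv (by simp)).clm_apply continuous_const

lemma IsTestFunction.dz_props {U : Set ℂ} {ψ : ℂ → ℂ} (hψ : IsTestFunction U ψ) :
    Continuous (dz ψ) ∧ ∀ z, z ∉ tsupport ψ → dz ψ z = 0 := by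
  refine ⟨?_, fun z hz => by simp [dz, hψ.fderiv_zero z hz]⟩
  have h1 := hψ.continuous_fderiv 1
  have h2 := hψ.continuous_fderiv Complex.I
  unfold dz
  fun_prop

lemma IsTestFunction.dzbar_props {U : Set ℂ} {ψ : ℂ → ℂ} (hψ : IsTestFunction U ψ) :
    Continuous (dzbar ψ) ∧ ∀ z, z ∉ tsupport ψ → dzbar ψ z = 0 := by
  refine ⟨?_, fun z hz => by simp [dzbar, hψ.fderiv_zero z hz]⟩
  have h1 := hψ.continuous_fderiv 1
  have h2 := hψ.continuous_fderiv Complex.I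
  unfold dzbar
  fun_prop

lemma IsWeakDeriv.congr {D : (ℂ → ℂ) → ℂ → ℂ} {U : Set ℂ} {u u' w : ℂ → ℂ}
    (h : IsWeakDeriv D U u w) (hu : u =ᵐ[volume.restrict U] u') : IsWeakDeriv D U u' w where
  locInt_fun := h.locInt_fun.congr hu
  locInt_deriv := h.locInt_deriv
  integral_eq ψ hψ := by
    rw [← h.integral_eq ψ hψ]
    refine integral_congr_ae ?_
    filter_upwards [hu] with z hz
    rw [hz]

lemma IsWeakDeriv.add {D : (ℂ → ℂ) → ℂ → ℂ} {U : Set ℂ} {u u' w w' : ℂ → ℂ}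
    (hD : ∀ ψ, IsTestFunction U ψ → Continuous (D ψ) ∧ ∀ z, z ∉ tsupport ψ → D ψ z = 0)
    (h : IsWeakDeriv D U u w) (h' : IsWeakDeriv D U u' w') :
    IsWeakDeriv D U (u + u') (w + w') where
  locInt_fun := h.locInt_fun.add h'.locInt_fun
  locInt_deriv := h.locInt_deriv.add h'.locInt_deriv
  integral_eq ψ hψ := by
    have e : ∀ z, z ∉ tsupport ψ → ψ z = 0 := fun z hz => image_eq_zero_of_notMem_tsupport hz
    have c := hψ.contDiff.continuous
    simp only [Pi.add_apply, add_mul]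
    rw [integral_add (hψ.integrable_mul (hD ψ hψ).1 (hD ψ hψ).2 h.locInt_fun)
        (hψ.integrable_mul (hD ψ hψ).1 (hD ψ hψ).2 h'.locInt_fun),
      integral_add (hψ.integrable_mul c e h.locInt_deriv)
        (hψ.integrable_mul c e h'.locInt_deriv), h.integral_eq ψ hψ, h'.integral_eq ψ hψ]
    ring

lemma IsWeakDeriv.smul {D : (ℂ → ℂ) → ℂ → ℂ} {U : Set ℂ} {u w : ℂ → ℂ}
    (h : IsWeakDeriv D U u w) (c : ℂ) : IsWeakDeriv D U (c • u) (c • w) where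
  locInt_fun := h.locInt_fun.smul c
  locInt_deriv := h.locInt_deriv.smul c
  integral_eq ψ hψ := by
    simp only [Pi.smul_apply, smul_eq_mul, mul_assoc]
    rw [integral_const_mul, integral_const_mul, h.integral_eq ψ hψ]
    ring

lemma IsWeakDeriv.unique {D : (ℂ → ℂ) → ℂ → ℂ} {U : Set ℂ} {u u' w w' : ℂ → ℂ}
    (hU : IsOpen U) (h : IsWeakDeriv D U u w) (h' : IsWeakDeriv D U u' w')
    (hu : u =ᵐ[volume.restrict U] u') : w =ᵐ[volume.restrict U] w' := by
  have h1 := h.congr hu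
  have key : ∀ᵐ z, z ∈ U → (w - w') z = 0 := by
    refine hU.ae_eq_zero_of_integral_contDiff_smul_eq_zero
      (h1.locInt_deriv.sub h'.locInt_deriv) ?_
    intro g hg hc hs
    have hts : tsupport (fun z => (g z : ℂ)) = tsupport g := by
      unfold tsupport
      congr 1
      ext z
      simp
    have hψ : IsTestFunction U (fun z => (g z : ℂ)) :=
      { contDiff := Complex.ofRealCLM.contDiff.comp hg
        hasCompactSupport := by
          unfold HasCompactSupport
          rw [hts]
          exact hc
        tsupport_subset := by rwa [hts] }
    have e : ∀ z, z ∉ tsupport (fun z => (g z : ℂ)) → (g z : ℂ) = 0 :=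
      fun z hz => image_eq_zero_of_notMem_tsupport (f := fun z => (g z : ℂ)) hz
    have a := h1.integral_eq _ hψ
    have b := h'.integral_eq _ hψ
    have i1 := hψ.integrable_mul hψ.contDiff.continuous e h1.locInt_deriv
    have i2 := hψ.integrable_mul hψ.contDiff.continuous e h'.locInt_deriv
    have hr : ∫ z, g z • (w - w') z = ∫ z in U, g z • (w - w') z := by
      refine (setIntegral_eq_integral_of_forall_compl_eq_zero fun z hz => ?_).symm
      have : g z = 0 := image_eq_zero_of_notMem_tsupport fun hz' => hz (hs hz')
      simp [this]
    rw [hr]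
    have : ∀ z, g z • (w - w') z = w z * (g z : ℂ) - w' z * (g z : ℂ) := by
      intro z
      simp
      ring
    simp only [this]
    rw [integral_sub i1 i2, sub_eq_zero]
    rw [a] at b
    exact neg_injective b
  rw [Filter.EventuallyEq, ae_restrict_iff' hU.measurableSet]
  filter_upwards [key] with z hz hzU
  exact sub_eq_zero.1 (hz hzU)

lemma IsL2Loc.add {U : Set ℂ} {w w' : ℂ → ℂ} (h : IsL2Loc U w) (h' : IsL2Loc U w') :
    IsL2Loc U (w + w') := fun K hK hc => (h K hK hc).add (h' K hK hc)

lemma IsL2Loc.smul {U : Set ℂ} {w : ℂ → ℂ} (h : IsL2Loc U w) (c : ℂ) :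
    IsL2Loc U (c • w) := fun K hK hc => (h K hK hc).const_smul c

/-- On a compact set, a function that is continuous on a larger set is square integrable. -/
lemma isL2Loc_of_continuousOn {U : Set ℂ} {w : ℂ → ℂ} (h : ContinuousOn w U) : IsL2Loc U w := by
  intro K hK hc
  obtain ⟨C, hC⟩ := hc.exists_bound_of_continuousOn (h.mono hK)
  have : IsFiniteMeasure ((volume : Measure ℂ).restrict K) :=
    ⟨by simpa using hc.measure_lt_top⟩
  refine MemLp.of_bound ((h.mono hK).aestronglyMeasurable hc.measurableSet) C ?_
  exact ae_restrict_of_forall_mem hc.measurableSet hC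

/-- Integration by parts: the classical directional derivative is the weak one. -/
lemma integral_mul_fderiv_test {U : Set ℂ} (hU : IsOpen U) {u ψ : ℂ → ℂ}
    (hu : ContDiffOn ℝ ∞ u U) (hψ : IsTestFunction U ψ) (v : ℂ) :
    IntegrableOn (fun z => u z * fderiv ℝ ψ z v) U ∧
    IntegrableOn (fun z => fderiv ℝ u z v * ψ z) U ∧
    ∫ z in U, u z * fderiv ℝ ψ z v = - ∫ z in U, fderiv ℝ u z v * ψ z := by
  have e : ∀ z, z ∉ tsupport ψ → ψ z = 0 := fun z hz => image_eq_zero_of_notMem_tsupport hz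
  have e' : ∀ z, z ∉ tsupport ψ → fderiv ℝ ψ z v = 0 := fun z hz => by
    simp [hψ.fderiv_zero z hz]
  have l1 : LocallyIntegrableOn u U := hu.continuousOn.locallyIntegrableOn hU.measurableSet
  have c2 : ContinuousOn (fun z => fderiv ℝ u z v) U :=
    (hu.continuousOn_fderiv_of_isOpen hU (by simp)).clm_apply continuousOn_const
  have l2 : LocallyIntegrableOn (fun z => fderiv ℝ u z v) U :=
    c2.locallyIntegrableOn hU.measurableSet
  have i1 := hψ.integrable_mul (hψ.continuous_fderiv v) e' l1
  have i2 := hψ.integrable_mul hψ.contDiff.continuous e l2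
  have i3 := hψ.integrable_mul hψ.contDiff.continuous e l1
  have z1 : ∀ z, z ∉ U → u z * fderiv ℝ ψ z v = 0 := fun z hz => by
    rw [e' z (fun h => hz (hψ.tsupport_subset h)), mul_zero]
  have z2 : ∀ z, z ∉ U → fderiv ℝ u z v * ψ z = 0 := fun z hz => by
    rw [e z (fun h => hz (hψ.tsupport_subset h)), mul_zero]
  have z3 : ∀ z, z ∉ U → u z * ψ z = 0 := fun z hz => by
    rw [e z (fun h => hz (hψ.tsupport_subset h)), mul_zero]
  refine ⟨i1, i2, ?_⟩
  rw [setIntegral_eq_integral_of_forall_compl_eq_zero z1,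
    setIntegral_eq_integral_of_forall_compl_eq_zero z2]
  refine integral_mul_fderiv_eq_neg_fderiv_mul_of_integrable
    (integrableOn_iff_integrable_of_support_subset ?_ |>.1 i2)
    (integrableOn_iff_integrable_of_support_subset ?_ |>.1 i1)
    (integrableOn_iff_integrable_of_support_subset ?_ |>.1 i3) ?_ ?_
  · exact fun z hz => by_contra fun h => hz (z2 z h)
  · exact fun z hz => by_contra fun h => hz (z1 z h)
  · exact fun z hz => by_contra fun h => hz (z3 z h)
  · exact fun z hz => (hu.differentiableOn (by simp)).differentiableAt
      (hU.mem_nhds (hψ.tsupport_subset hz))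
  · exact fun z _ => hψ.contDiff.differentiable (by simp) z

lemma hasL2Deriv_dz {U : Set ℂ} (hU : IsOpen U) {u : ℂ → ℂ} (hu : ContDiffOn ℝ ∞ u U) :
    HasL2Deriv dz U u := by
  have c : ∀ v, ContinuousOn (fun z => fderiv ℝ u z v) U := fun v =>
    (hu.continuousOn_fderiv_of_isOpen hU (by simp)).clm_apply continuousOn_const
  have c1 : ContinuousOn (dz u) U := by
    have h1 := c 1
    have h2 := c Complex.I
    unfold dz
    fun_prop
  refine ⟨dz u, ⟨hu.continuousOn.locallyIntegrableOn hU.measurableSet,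
    c1.locallyIntegrableOn hU.measurableSet, fun ψ hψ => ?_⟩, isL2Loc_of_continuousOn c1⟩
  obtain ⟨a1, a2, a3⟩ := integral_mul_fderiv_test hU hu hψ 1
  obtain ⟨b1, b2, b3⟩ := integral_mul_fderiv_test hU hu hψ Complex.I
  have e1 : ∀ z, u z * dz ψ z = (1 / 2) * (u z * fderiv ℝ ψ z 1) -
      (Complex.I / 2) * (u z * fderiv ℝ ψ z Complex.I) := fun z => by
    unfold dz
    ring
  have e2 : ∀ z, dz u z * ψ z = (1 / 2) * (fderiv ℝ u z 1 * ψ z) -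
      (Complex.I / 2) * (fderiv ℝ u z Complex.I * ψ z) := fun z => by
    unfold dz
    ring
  simp only [e1, e2]
  rw [integral_sub (a1.const_mul _) (b1.const_mul _), integral_sub (a2.const_mul _)
    (b2.const_mul _)]
  simp only [integral_const_mul]
  rw [a3, b3]
  ring

lemma hasL2Deriv_dzbar {U : Set ℂ} (hU : IsOpen U) {u : ℂ → ℂ} (hu : ContDiffOn ℝ ∞ u U) :
    HasL2Deriv dzbar U u := by
  have c : ∀ v, ContinuousOn (fun z => fderiv ℝ u z v) U := fun v =>
    (hu.continuousOn_fderiv_of_isOpen hU (by simp)).clm_apply continuousOn_const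
  have c1 : ContinuousOn (dzbar u) U := by
    have h1 := c 1
    have h2 := c Complex.I
    unfold dzbar
    fun_prop
  refine ⟨dzbar u, ⟨hu.continuousOn.locallyIntegrableOn hU.measurableSet,
    c1.locallyIntegrableOn hU.measurableSet, fun ψ hψ => ?_⟩, isL2Loc_of_continuousOn c1⟩
  obtain ⟨a1, a2, a3⟩ := integral_mul_fderiv_test hU hu hψ 1
  obtain ⟨b1, b2, b3⟩ := integral_mul_fderiv_test hU hu hψ Complex.I
  have e1 : ∀ z, u z * dzbar ψ z = (1 / 2) * (u z * fderiv ℝ ψ z 1) +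
      (Complex.I / 2) * (u z * fderiv ℝ ψ z Complex.I) := fun z => by
    unfold dzbar
    ring
  have e2 : ∀ z, dzbar u z * ψ z = (1 / 2) * (fderiv ℝ u z 1 * ψ z) +
      (Complex.I / 2) * (fderiv ℝ u z Complex.I * ψ z) := fun z => by
    unfold dzbar
    ring
  simp only [e1, e2]
  rw [integral_add (a1.const_mul _) (b1.const_mul _), integral_add (a2.const_mul _)
    (b2.const_mul _)]
  simp only [integral_const_mul]
  rw [a3, b3]
  ring

/-! ### Smooth functions, ramification, pull-back and push-forward -/

/-- The space `C^∞(X)` of smooth complex-valued functions (smooth in the real sense). -/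
def SmoothFun (X : Type*) [TopologicalSpace X] [ChartedSpace ℂ X] : Submodule ℂ (X → ℂ) where
  carrier := {f | ContMDiff 𝓘(ℝ, ℂ) 𝓘(ℝ, ℂ) ∞ f}
  add_mem' {f g} hf hg := by
    have hf' : ContMDiff 𝓘(ℝ, ℂ) 𝓘(ℝ, ℂ) ∞ f := hf
    have hg' : ContMDiff 𝓘(ℝ, ℂ) 𝓘(ℝ, ℂ) ∞ g := hg
    exact hf'.add hg'
  zero_mem' := contMDiff_const
  smul_mem' c f hf := by
    have hf' : ContMDiff 𝓘(ℝ, ℂ) 𝓘(ℝ, ℂ) ∞ f := hf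
    have : ContDiff ℝ ∞ (fun z : ℂ => c * z) := contDiff_const.mul contDiff_id
    exact this.contMDiff.comp hf'

/-- The ramification index of `φ` at `x`: the order of vanishing at the point `x` of
`φ - φ x`, read in local coordinates. -/
noncomputable def ramificationIndex {X Y : Type*} [TopologicalSpace X] [ChartedSpace ℂ X]
    [TopologicalSpace Y] [ChartedSpace ℂ Y] (φ : X → Y) (x : X) : ℕ :=
  analyticOrderNatAt
    (fun z => chartAt ℂ (φ x) (φ ((chartAt ℂ x).symm z)) - chartAt ℂ (φ x) (φ x)) (chartAt ℂ x x)

/-- The push-forward `(φ_* g)(y) = ∑_{x ∈ φ⁻¹(y)} e_x g(x)`. -/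
noncomputable def pushforward {X Y : Type*} [TopologicalSpace X] [ChartedSpace ℂ X]
    [TopologicalSpace Y] [ChartedSpace ℂ Y] (φ : X → Y) (g : X → ℂ) (y : Y) : ℂ :=
  ∑ᶠ x ∈ φ ⁻¹' {y}, (ramificationIndex φ x : ℂ) * g x

/-! ### Changes of charts -/

section Transition

variable {X : Type*} [TopologicalSpace X] [ChartedSpace ℂ X] [IsManifold 𝓘(ℂ) ω X]

lemma contDiffOn_transition {e e' : OpenPartialHomeomorph X ℂ} (he : e ∈ atlas ℂ X)
    (he' : e' ∈ atlas ℂ X) :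
    ContDiffOn ℂ ω (fun z => e' (e.symm z)) (e.target ∩ e.symm ⁻¹' e'.source) := by
  have h1 : ContMDiffOn 𝓘(ℂ) 𝓘(ℂ) ω e.symm e.target :=
    contMDiffOn_symm_of_mem_maximalAtlas (IsManifold.subset_maximalAtlas he)
  have h2 : ContMDiffOn 𝓘(ℂ) 𝓘(ℂ) ω e' e'.source :=
    contMDiffOn_of_mem_maximalAtlas (IsManifold.subset_maximalAtlas he')
  have h3 : ContMDiffOn 𝓘(ℂ) 𝓘(ℂ) ω (e' ∘ e.symm) (e.target ∩ e.symm ⁻¹' e'.source) :=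
    h2.comp (h1.mono inter_subset_left) (fun z hz => hz.2)
  exact contMDiffOn_iff_contDiffOn.1 h3

/-- A Riemann surface is a smooth real manifold. -/
lemma isManifold_real : IsManifold 𝓘(ℝ, ℂ) ∞ X := by
  refine isManifold_of_contDiffOn 𝓘(ℝ, ℂ) ∞ X fun e e' he he' => ?_
  have h := ((contDiffOn_transition he he').restrict_scalars ℝ).of_le (m := ∞) le_top
  refine h.mono ?_
  intro z hz
  simpa using hz

lemma smooth_chart {f : X → ℂ} (hf : f ∈ SmoothFun X) {e : OpenPartialHomeomorph X ℂ}
    (he : e ∈ atlas ℂ X) : ContDiffOn ℝ ∞ (fun z => f (e.symm z)) e.target := by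
  have := isManifold_real (X := X)
  have h1 : ContMDiffOn 𝓘(ℝ, ℂ) 𝓘(ℝ, ℂ) ∞ e.symm e.target :=
    contMDiffOn_symm_of_mem_maximalAtlas (IsManifold.subset_maximalAtlas he)
  have h2 : ContMDiff 𝓘(ℝ, ℂ) 𝓘(ℝ, ℂ) ∞ f := hf
  exact contMDiffOn_iff_contDiffOn.1 (h2.comp_contMDiffOn h1)

end Transition

/-! ### Integration of 2-forms on a compact Riemann surface -/

section Integration

variable (X : Type*) [TopologicalSpace X] [ChartedSpace ℂ X] [MeasurableSpace X]

/-- A decomposition of `X` into finitely many disjoint Borel pieces, each of which has its closure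
inside the domain of a chart. A 2-form on `X` is integrated piece by piece, in the charts; by the
change of variables formula the result does not depend on the decomposition. -/
structure ChartPartition where
  n : ℕ
  chart : Fin n → OpenPartialHomeomorph X ℂ
  chart_mem : ∀ i, chart i ∈ atlas ℂ X
  piece : Fin n → Set X
  measurableSet_piece : ∀ i, MeasurableSet (piece i)
  closure_subset : ∀ i, closure (piece i) ⊆ (chart i).source
  disjoint_piece : Pairwise (Disjoint on piece)
  iUnion_piece : ⋃ i, piece i = univ

variable {X}

/-- The image of the `i`-th piece in the complex plane. -/
def ChartPartition.image (P : ChartPartition X) (i : Fin P.n) : Set ℂ :=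
  (P.chart i).target ∩ (P.chart i).symm ⁻¹' P.piece i

/-- The integral over `X` of the 2-form given by `c e z dx ∧ dy` in the chart `e`. -/
noncomputable def ChartPartition.integral (P : ChartPartition X)
    (c : OpenPartialHomeomorph X ℂ → ℂ → ℂ) : ℂ :=
  ∑ i, ∫ z in P.image i, c (P.chart i) z

variable (X)

/-- A positive continuous 2-form on `X`, given by `coeff e z dx ∧ dy` in the chart `e`. -/
structure VolumeForm (X : Type*) [TopologicalSpace X] [ChartedSpace ℂ X] where
  coeff : OpenPartialHomeomorph X ℂ → ℂ → ℝ
  continuousOn_coeff : ∀ e ∈ atlas ℂ X, ContinuousOn (coeff e) e.target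
  coeff_pos : ∀ e ∈ atlas ℂ X, ∀ z ∈ e.target, 0 < coeff e z
  coeff_compat : ∀ e ∈ atlas ℂ X, ∀ e' ∈ atlas ℂ X, ∀ z ∈ e.target, e.symm z ∈ e'.source →
    coeff e z = ‖deriv (fun w => e' (e.symm w)) z‖ ^ 2 * coeff e' (e' (e.symm z))

variable {X}

lemma ChartPartition.measurableSet_image [BorelSpace X] (P : ChartPartition X) (i : Fin P.n) :
    MeasurableSet (P.image i) := by
  have h := ((P.chart i).continuousOn_symm.domRestrict).measurable (P.measurableSet_piece i)
  have h2 := (P.chart i).open_target.measurableSet.subtype_image h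
  convert h2 using 1
  ext z
  simp [ChartPartition.image, and_comm]

lemma ChartPartition.image_subset_target (P : ChartPartition X) (i : Fin P.n) :
    P.image i ⊆ (P.chart i).target := inter_subset_left

/-- Every piece is relatively compact in its chart. -/
lemma ChartPartition.exists_compact [CompactSpace X] (P : ChartPartition X) (i : Fin P.n) :
    ∃ K, IsCompact K ∧ K ⊆ (P.chart i).target ∧ P.image i ⊆ K := by
  refine ⟨P.chart i '' closure (P.piece i),
    isClosed_closure.isCompact.image_of_continuousOn
      ((P.chart i).continuousOn.mono (P.closure_subset i)), ?_, ?_⟩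
  · rintro _ ⟨x, hx, rfl⟩
    exact (P.chart i).map_source (P.closure_subset i hx)
  · rintro z ⟨hz, hz'⟩
    exact ⟨(P.chart i).symm z, subset_closure hz', (P.chart i).right_inv hz⟩

instance [CompactSpace X] [T2Space X] [BorelSpace X] : Nonempty (ChartPartition X) := by
  classical
  have h : ∀ x : X, ∃ K ∈ 𝓝 x, K ⊆ (chartAt ℂ x).source ∧ IsCompact K := fun x =>
    local_compact_nhds (chart_source_mem_nhds ℂ x)
  choose K hK hKs hKc using h
  obtain ⟨t, -, ht⟩ := isCompact_univ.elim_nhds_subcover K (fun x _ => hK x)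
  obtain ⟨n, p, hp⟩ : ∃ (n : ℕ) (p : Fin n → X), ⋃ i, K (p i) = univ := by
    refine ⟨t.card, fun i => (t.equivFin.symm i : X), ?_⟩
    refine eq_univ_of_univ_subset (ht.trans ?_)
    intro x hx
    simp only [mem_iUnion] at hx ⊢
    obtain ⟨y, hy, hxy⟩ := hx
    exact ⟨t.equivFin ⟨y, hy⟩, by simpa using hxy⟩
  have hcl : ∀ i, IsClosed (K (p i)) := fun i => (hKc (p i)).isClosed
  refine ⟨⟨n, fun i => chartAt ℂ (p i), fun i => chart_mem_atlas ℂ (p i),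
    fun i => K (p i) \ ⋃ j, ⋃ (_ : j < i), K (p j), fun i => ?_, fun i => ?_, ?_, ?_⟩⟩
  · exact (hcl i).measurableSet.diff
      (MeasurableSet.iUnion fun j => MeasurableSet.iUnion fun _ => (hcl j).measurableSet)
  · exact (closure_minimal sdiff_subset (hcl i)).trans (hKs (p i))
  · intro i j hij
    rw [Function.onFun, Set.disjoint_left]
    rintro x ⟨hi, hi'⟩ ⟨hj, hj'⟩
    simp only [mem_iUnion, not_exists] at hi' hj'
    rcases lt_or_gt_of_ne hij with h | h
    · exact hj' i h hi
    · exact hi' j h hj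
  · refine eq_univ_of_forall fun x => ?_
    have hx : x ∈ ⋃ i, K (p i) := hp ▸ mem_univ x
    have hne : (Finset.univ.filter fun i => x ∈ K (p i)).Nonempty := by
      obtain ⟨i, hi⟩ := mem_iUnion.1 hx
      exact ⟨i, by simpa using hi⟩
    refine mem_iUnion.2 ⟨Finset.min' _ hne, ?_, ?_⟩
    · have := Finset.min'_mem _ hne
      simpa using this
    · simp only [mem_iUnion, not_exists]
      intro j hj hxj
      exact absurd (Finset.min'_le _ j (by simpa using hxj)) (not_le.2 hj)

variable (X)

/-- A fixed decomposition of `X`. -/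
noncomputable def chartPartition [CompactSpace X] [T2Space X] [BorelSpace X] : ChartPartition X :=
  Classical.choice inferInstance

variable {X}

/-- The Borel measure on `X` defined by a positive continuous 2-form. -/
noncomputable def VolumeForm.measure [CompactSpace X] [T2Space X] [BorelSpace X]
    (ν : VolumeForm X) : Measure X :=
  ∑ i, ((volume.restrict ((chartPartition X).image i)).withDensity
    (fun z => ENNReal.ofReal (ν.coeff ((chartPartition X).chart i) z))).map
      ((chartPartition X).chart i).symm

section

variable [CompactSpace X] [T2Space X] [BorelSpace X] (ν : VolumeForm X)

lemma VolumeForm.aemeasurable_coeff (i : Fin (chartPartition X).n) :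
    AEMeasurable (fun z => ENNReal.ofReal (ν.coeff ((chartPartition X).chart i) z))
      (volume.restrict ((chartPartition X).image i)) :=
  (((ν.continuousOn_coeff _ ((chartPartition X).chart_mem i)).mono
    ((chartPartition X).image_subset_target i)).aemeasurable
      ((chartPartition X).measurableSet_image i)).ennreal_ofReal

lemma VolumeForm.aemeasurable_symm (i : Fin (chartPartition X).n) :
    AEMeasurable ((chartPartition X).chart i).symm
      ((volume.restrict ((chartPartition X).image i)).withDensity
        (fun z => ENNReal.ofReal (ν.coeff ((chartPartition X).chart i) z))) := by
  have h := (((chartPartition X).chart i).continuousOn_symm.mono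
    ((chartPartition X).image_subset_target i)).aemeasurable (μ := volume)
      ((chartPartition X).measurableSet_image i)
  exact h.mono_ac (withDensity_absolutelyContinuous _ _)

instance VolumeForm.isFiniteMeasure_measure : IsFiniteMeasure ν.measure := by
  refine ⟨?_⟩
  rw [VolumeForm.measure, Measure.finsetSum_apply]
  refine ENNReal.sum_lt_top.2 fun i _ => ?_
  rw [Measure.map_apply_of_aemeasurable (ν.aemeasurable_symm i) MeasurableSet.univ, preimage_univ,
    withDensity_apply _ MeasurableSet.univ, Measure.restrict_univ]
  obtain ⟨K, hK, hKt, hiK⟩ := (chartPartition X).exists_compact i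
  obtain ⟨C, hC⟩ := hK.exists_bound_of_continuousOn
    ((ν.continuousOn_coeff _ ((chartPartition X).chart_mem i)).mono hKt)
  calc ∫⁻ z in (chartPartition X).image i, ENNReal.ofReal (ν.coeff ((chartPartition X).chart i) z)
      ≤ ∫⁻ _ in (chartPartition X).image i, ENNReal.ofReal C := by
        refine setLIntegral_mono' ((chartPartition X).measurableSet_image i) fun z hz => ?_
        exact ENNReal.ofReal_le_ofReal ((le_abs_self _).trans (hC z (hiK hz)))
    _ < ⊤ := by
        rw [setLIntegral_const]
        exact ENNReal.mul_lt_top ENNReal.ofReal_lt_top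
          ((measure_mono hiK).trans_lt hK.measure_lt_top)

variable [IsManifold 𝓘(ℂ) ω X]

/-- A property that holds almost everywhere on `X` holds almost everywhere in every chart. -/
lemma VolumeForm.ae_chart {p : X → Prop} (hp : ∀ᵐ x ∂ν.measure, p x)
    {e : OpenPartialHomeomorph X ℂ} (he : e ∈ atlas ℂ X) :
    ∀ᵐ z ∂(volume.restrict e.target), p (e.symm z) := by
  obtain ⟨B, hB, hBm, hB0⟩ := exists_measurable_superset_of_null (ae_iff.1 hp)
  have hi : ∀ i, volume ((chartPartition X).image i ∩ ((chartPartition X).chart i).symm ⁻¹' B)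
      = 0 := by
    intro i
    rw [VolumeForm.measure, Measure.finsetSum_apply, Finset.sum_eq_zero_iff] at hB0
    have h := hB0 i (Finset.mem_univ i)
    rw [Measure.map_apply_of_aemeasurable (ν.aemeasurable_symm i) hBm,
      withDensity_apply_eq_zero' (ν.aemeasurable_coeff i),
      Measure.restrict_apply' ((chartPartition X).measurableSet_image i)] at h
    refine measure_mono_null ?_ h
    rintro z ⟨hz, hzB⟩
    refine ⟨⟨?_, hzB⟩, hz⟩
    have := ν.coeff_pos _ ((chartPartition X).chart_mem i) z
      ((chartPartition X).image_subset_target i hz)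
    simpa using this
  rw [ae_restrict_iff' e.open_target.measurableSet, ae_iff]
  have hsub : {z | ¬ (z ∈ e.target → p (e.symm z))} ⊆
      ⋃ i, (fun w => e (((chartPartition X).chart i).symm w)) ''
        ((chartPartition X).image i ∩ ((chartPartition X).chart i).symm ⁻¹' B ∩
          ((chartPartition X).chart i).symm ⁻¹' e.source) := by
    intro z hz
    simp only [Classical.not_imp, mem_ofPred_eq] at hz
    obtain ⟨hz, hpz⟩ := hz
    have hx : e.symm z ∈ ⋃ i, (chartPartition X).piece i :=
      (chartPartition X).iUnion_piece ▸ mem_univ _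
    obtain ⟨i, hxi⟩ := mem_iUnion.1 hx
    have hs := (chartPartition X).closure_subset i (subset_closure hxi)
    have hl := ((chartPartition X).chart i).left_inv hs
    refine mem_iUnion.2 ⟨i, (chartPartition X).chart i (e.symm z), ⟨⟨⟨?_, ?_⟩, ?_⟩, ?_⟩, ?_⟩
    · exact ((chartPartition X).chart i).map_source hs
    · simpa [hl] using hxi
    · simpa [hl] using hB hpz
    · simpa [hl] using e.map_target hz
    · simp [hl, e.right_inv hz]
  refine measure_mono_null hsub (measure_iUnion_null fun i => ?_)
  refine addHaar_image_eq_zero_of_differentiableOn_of_addHaar_eq_zero volume ?_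
    (measure_mono_null inter_subset_left (hi i))
  refine (((contDiffOn_transition ((chartPartition X).chart_mem i) he).differentiableOn
    (by simp)).restrictScalars ℝ).mono ?_
  exact fun z hz => ⟨(chartPartition X).image_subset_target i hz.1.1, hz.2⟩

end

end Integration

/-! ### The Sobolev space `L²₁(X)` -/

section Sobolev

variable {X : Type*} [TopologicalSpace X] [T2Space X] [CompactSpace X] [ChartedSpace ℂ X]
  [MeasurableSpace X] [BorelSpace X]

/-- `∂f` and `∂̄f`, taken in the sense of distributions, are square integrable 1-forms. As `X` is
compact, this means that in every chart their coefficients are square integrable on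
compact sets. -/
def HasL2Derivs (f : X → ℂ) : Prop :=
  ∀ e ∈ atlas ℂ X, HasL2Deriv dz e.target (fun z => f (e.symm z)) ∧
    HasL2Deriv dzbar e.target (fun z => f (e.symm z))

open Classical in
/-- The coefficient of the `(1,0)`-form `∂f` in the chart `e`, that is `∂f = weakDz f e z dz`. -/
noncomputable def weakDz (f : X → ℂ) (e : OpenPartialHomeomorph X ℂ) : ℂ → ℂ :=
  if h : HasL2Deriv dz e.target (fun z => f (e.symm z)) then h.choose else 0

/-- The hermitian pairing `(f, g)_{1,X} = i ∫_X ∂f ∧ conj (∂g)`; recall that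
`i dz ∧ dz̄ = 2 dx ∧ dy`. -/
noncomputable def dirichletPairing (f g : X → ℂ) : ℂ :=
  (chartPartition X).integral fun e z => 2 * (weakDz f e z * conj (weakDz g e z))

variable [IsManifold 𝓘(ℂ) ω X]

lemma HasL2Derivs.congr {ν : VolumeForm X} {f g : X → ℂ} (hf : HasL2Derivs f)
    (h : f =ᵐ[ν.measure] g) : HasL2Derivs g := by
  intro e he
  have h' : (fun z => f (e.symm z)) =ᵐ[volume.restrict e.target] fun z => g (e.symm z) :=
    ν.ae_chart h he
  obtain ⟨⟨w, hw, hw2⟩, ⟨w', hw', hw2'⟩⟩ := hf e he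
  exact ⟨⟨w, hw.congr h', hw2⟩, ⟨w', hw'.congr h', hw2'⟩⟩


/-- The space of classes `f ∈ L²(X)` whose distributional derivatives `∂f`, `∂̄f` are in `L²`. -/
noncomputable def l21Submodule (ν : VolumeForm X) : Submodule ℂ (Lp ℂ 2 ν.measure) where
  carrier := {f | HasL2Derivs (f : X → ℂ)}
  add_mem' {f g} hf hg := by
    have key : HasL2Derivs ((f : X → ℂ) + (g : X → ℂ)) := by
      intro e he
      obtain ⟨⟨w, hw, hw2⟩, ⟨w', hw', hw2'⟩⟩ := hf e he
      obtain ⟨⟨v, hv, hv2⟩, ⟨v', hv', hv2'⟩⟩ := hg e he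
      exact ⟨⟨w + v, hw.add (fun ψ hψ => hψ.dz_props) hv, hw2.add hv2⟩,
        ⟨w' + v', hw'.add (fun ψ hψ => hψ.dzbar_props) hv', hw2'.add hv2'⟩⟩
    exact key.congr (Lp.coeFn_add f g).symm
  zero_mem' := by
    have key : HasL2Derivs (0 : X → ℂ) := by
      intro e he
      exact ⟨hasL2Deriv_dz e.open_target contDiffOn_const,
        hasL2Deriv_dzbar e.open_target contDiffOn_const⟩
    exact key.congr (Lp.coeFn_zero ℂ 2 ν.measure).symm
  smul_mem' c f hf := by
    have key : HasL2Derivs (c • (f : X → ℂ)) := by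
      intro e he
      obtain ⟨⟨w, hw, hw2⟩, ⟨w', hw', hw2'⟩⟩ := hf e he
      exact ⟨⟨c • w, hw.smul c, hw2.smul c⟩, ⟨c • w', hw'.smul c, hw2'.smul c⟩⟩
    exact key.congr (Lp.coeFn_smul c f).symm

/-- The space `L²₁(X)`. The volume form `ν` only enters through the inner product below. -/
def L21 (ν : VolumeForm X) : Type _ := l21Submodule ν

namespace L21

variable {ν : VolumeForm X}

noncomputable instance : AddCommGroup (L21 ν) := inferInstanceAs (AddCommGroup (l21Submodule ν))

noncomputable instance : Module ℂ (L21 ν) := inferInstanceAs (Module ℂ (l21Submodule ν))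

/-- The inclusion of `L²₁(X)` in `L²(X)`. -/
noncomputable def toLp : L21 ν →ₗ[ℂ] Lp ℂ 2 ν.measure := (l21Submodule ν).subtype

lemma toLp_injective : Function.Injective (toLp : L21 ν → Lp ℂ 2 ν.measure) :=
  Subtype.val_injective

lemma hasL2Derivs (f : L21 ν) : HasL2Derivs (toLp f : X → ℂ) := Subtype.property f

lemma weakDz_spec (f : L21 ν) {e : OpenPartialHomeomorph X ℂ} (he : e ∈ atlas ℂ X) :
    IsWeakDeriv dz e.target (fun z => toLp f (e.symm z)) (weakDz (toLp f) e) ∧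
      IsL2Loc e.target (weakDz (toLp f) e) := by
  have h := (f.hasL2Derivs e he).1
  rw [weakDz, dif_pos h]
  exact h.choose_spec

lemma weakDz_add (f g : L21 ν) {e : OpenPartialHomeomorph X ℂ} (he : e ∈ atlas ℂ X) :
    weakDz (toLp (f + g)) e =ᵐ[volume.restrict e.target]
      weakDz (toLp f) e + weakDz (toLp g) e := by
  refine ((f + g).weakDz_spec he).1.unique e.open_target
    ((f.weakDz_spec he).1.add (fun ψ hψ => hψ.dz_props) (g.weakDz_spec he).1) ?_
  have h : ∀ᵐ x ∂ν.measure, toLp (f + g) x = toLp f x + toLp g x := by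
    rw [map_add]
    exact Lp.coeFn_add (toLp f) (toLp g)
  exact ν.ae_chart h he

lemma weakDz_smul (c : ℂ) (f : L21 ν) {e : OpenPartialHomeomorph X ℂ} (he : e ∈ atlas ℂ X) :
    weakDz (toLp (c • f)) e =ᵐ[volume.restrict e.target] c • weakDz (toLp f) e := by
  refine ((c • f).weakDz_spec he).1.unique e.open_target ((f.weakDz_spec he).1.smul c) ?_
  have h : ∀ᵐ x ∂ν.measure, toLp (c • f) x = c * toLp f x := by
    rw [map_smul]
    exact Lp.coeFn_smul c (toLp f)
  exact ν.ae_chart h he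

lemma integrableOn_dirichlet (f g : L21 ν) (i : Fin (chartPartition X).n) :
    IntegrableOn (fun z => 2 * (weakDz (toLp f) ((chartPartition X).chart i) z *
      conj (weakDz (toLp g) ((chartPartition X).chart i) z))) ((chartPartition X).image i) := by
  obtain ⟨K, hK, hKt, hiK⟩ := (chartPartition X).exists_compact i
  have hf := (f.weakDz_spec ((chartPartition X).chart_mem i)).2 K hKt hK
  have hg := (g.weakDz_spec ((chartPartition X).chart_mem i)).2 K hKt hK
  have h : IntegrableOn (fun z => weakDz (toLp f) ((chartPartition X).chart i) z *
      conj (weakDz (toLp g) ((chartPartition X).chart i) z)) K :=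
    MemLp.integrable_mul hf hg.star
  exact (h.mono_set hiK).const_mul 2

lemma ae_image {p : ℂ → Prop} (i : Fin (chartPartition X).n)
    (h : ∀ᵐ z ∂(volume.restrict ((chartPartition X).chart i).target), p z) :
    ∀ᵐ z ∂(volume.restrict ((chartPartition X).image i)), p z :=
  ae_restrict_of_ae_restrict_of_subset ((chartPartition X).image_subset_target i) h

lemma dirichlet_add_right (f g h : L21 ν) :
    dirichletPairing (toLp h : X → ℂ) (toLp (f + g)) =
      dirichletPairing (toLp h : X → ℂ) (toLp f) + dirichletPairing (toLp h : X → ℂ) (toLp g) := by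
  simp only [dirichletPairing, ChartPartition.integral, ← Finset.sum_add_distrib]
  refine Finset.sum_congr rfl fun i _ => ?_
  rw [← integral_add (integrableOn_dirichlet h f i) (integrableOn_dirichlet h g i)]
  refine integral_congr_ae ?_
  filter_upwards [ae_image i (weakDz_add f g ((chartPartition X).chart_mem i))] with z hz
  rw [hz, Pi.add_apply, map_add]
  ring

lemma dirichlet_smul_right (c : ℂ) (f h : L21 ν) :
    dirichletPairing (toLp h : X → ℂ) (toLp (c • f)) =
      conj c * dirichletPairing (toLp h : X → ℂ) (toLp f) := by
  simp only [dirichletPairing, ChartPartition.integral, Finset.mul_sum]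
  refine Finset.sum_congr rfl fun i _ => ?_
  rw [← integral_const_mul]
  refine integral_congr_ae ?_
  filter_upwards [ae_image i (weakDz_smul c f ((chartPartition X).chart_mem i))] with z hz
  rw [hz, Pi.smul_apply, smul_eq_mul, map_mul]
  ring

lemma dirichlet_conj (f g : L21 ν) :
    conj (dirichletPairing (toLp f : X → ℂ) (toLp g)) =
      dirichletPairing (toLp g : X → ℂ) (toLp f) := by
  simp only [dirichletPairing, ChartPartition.integral, map_sum]
  refine Finset.sum_congr rfl fun i _ => ?_
  rw [← integral_conj]
  refine integral_congr_ae (Filter.Eventually.of_forall fun z => ?_)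
  simp only [map_mul, Complex.conj_conj, map_ofNat]
  ring

lemma dirichlet_nonneg (f : L21 ν) : 0 ≤ (dirichletPairing (toLp f : X → ℂ) (toLp f)).re := by
  simp only [dirichletPairing, ChartPartition.integral, Complex.re_sum]
  refine Finset.sum_nonneg fun i _ => ?_
  have e : ∀ z, (2 * (weakDz (toLp f) ((chartPartition X).chart i) z *
      conj (weakDz (toLp f) ((chartPartition X).chart i) z)) : ℂ) =
      ((2 * ‖weakDz (toLp f) ((chartPartition X).chart i) z‖ ^ 2 : ℝ) : ℂ) := by
    intro z
    rw [Complex.mul_conj']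
    push_cast
    ring
  simp only [e]
  rw [integral_complex_ofReal, Complex.ofReal_re]
  exact integral_nonneg fun z => by positivity

/-- The inner product `∫_X f ḡ ν + i ∫_X ∂f ∧ conj (∂g)` on `L²₁(X)`; in Mathlib's convention
`inner` is conjugate linear in its first variable, so that `inner ℂ g f` is the pairing
of `f` and `g`. -/
noncomputable abbrev core : InnerProductSpace.Core ℂ (L21 ν) where
  inner g f := inner ℂ (toLp g) (toLp f) + dirichletPairing (toLp f : X → ℂ) (toLp g)
  conj_inner_symm f g := by
    rw [map_add, inner_conj_symm, dirichlet_conj]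
  re_inner_nonneg f := by
    rw [map_add]
    exact add_nonneg inner_self_nonneg (dirichlet_nonneg f)
  add_left f g h := by
    rw [dirichlet_add_right, map_add, inner_add_left]
    ring
  smul_left f g c := by
    rw [dirichlet_smul_right, map_smul, inner_smul_left]
    ring
  definite f hf := by
    have h1 : 0 ≤ RCLike.re (inner ℂ (toLp f) (toLp f)) := inner_self_nonneg
    have h2 := dirichlet_nonneg f
    have h3 : RCLike.re (inner ℂ (toLp f) (toLp f)) +
        (dirichletPairing (toLp f : X → ℂ) (toLp f)).re = 0 := by
      have := congrArg Complex.re hf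
      simpa using this
    have h4 : RCLike.re (inner ℂ (toLp f) (toLp f)) = 0 := by linarith
    have h5 : toLp f = 0 := by
      rw [inner_self_eq_norm_sq] at h4
      exact norm_eq_zero.1 (pow_eq_zero_iff (two_ne_zero) |>.1 h4)
    exact toLp_injective (by rw [h5, map_zero])

/-- The norm `‖f‖_ν` given by `‖f‖_ν² = ∫_X |f|² ν + i ∫_X ∂f ∧ conj (∂f)`. -/
noncomputable instance : NormedAddCommGroup (L21 ν) :=
  (core : InnerProductSpace.Core ℂ (L21 ν)).toNormedAddCommGroup

noncomputable instance : InnerProductSpace ℂ (L21 ν) := InnerProductSpace.ofCore core.toCore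

end L21

/-! ### Smooth functions as elements of `L²₁(X)` -/

lemma smooth_memLp {f : X → ℂ} (hf : f ∈ SmoothFun X) (ν : VolumeForm X) :
    MemLp f 2 ν.measure := by
  have hc : Continuous f := ContMDiff.continuous hf
  obtain ⟨C, hC⟩ := isCompact_univ.exists_bound_of_continuousOn hc.continuousOn
  exact MemLp.of_bound hc.aestronglyMeasurable C
    (Filter.Eventually.of_forall fun x => hC x (mem_univ x))

/-- The natural map `C^∞(X) → L²₁(X)`. -/
noncomputable def smoothToL21 (ν : VolumeForm X) : SmoothFun X →ₗ[ℂ] L21 ν where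
  toFun f := ⟨(smooth_memLp f.2 ν).toLp f.1, by
    have h : HasL2Derivs f.1 := fun e he =>
      ⟨hasL2Deriv_dz e.open_target (smooth_chart f.2 he),
        hasL2Deriv_dzbar e.open_target (smooth_chart f.2 he)⟩
    exact h.congr (MemLp.coeFn_toLp (smooth_memLp f.2 ν)).symm⟩
  map_add' f g := L21.toLp_injective (MemLp.toLp_add (smooth_memLp f.2 ν) (smooth_memLp g.2 ν))
  map_smul' c f := L21.toLp_injective (MemLp.toLp_const_smul c (smooth_memLp f.2 ν))

/-- The `L²₁` topology on `C^∞(X)`. -/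
noncomputable abbrev smoothTopology (ν : VolumeForm X) : TopologicalSpace (SmoothFun X) :=
  TopologicalSpace.induced (smoothToL21 ν) inferInstance

end Sobolev

end RiemannSurfaceL21

open RiemannSurfaceL21

namespace RiemannSurfaceL21

/-! ### Calculus of the Wirtinger derivatives -/

/-! Everything rests on the area formula for a holomorphic `F` with at most `d` points in each fibre
and a null critical set: the integral over `y` of the sum of `h` over the fibre of `y` equals the
integral of `|F'|² h` (`FiniteBranched.lintegral_fibreSum`, `FiniteBranched.integral_fibreSum`). Its
weight `|F'|²` is exactly what appears or disappears when `∂` is transported by `F`, so the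
Dirichlet part of the norm never notices the ramification.

A map that is constant on no component is of this kind (`exists_branchedMap`). The points of local
constancy would form a clopen set, hence there are none. Critical points are then isolated, and near
each point the map is the `n`-th power of a local coordinate, up to an additive constant.
Compactness gives one bound `d` for all fibres.

Pull-back. The chain rule and the area formula give `‖∂(f ∘ φ)‖² ≤ d ‖∂f‖²` on the part of a chart
considered. The `L²` norm of `f ∘ φ` is bounded directly only where `φ'` is bounded away from zero.
Around a critical point one takes a disc with no other critical point: by the Poincaré inequality
the norm on the half disc is controlled by `∂(f ∘ φ)` on the disc and by `f ∘ φ` on the outer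
annulus (`exists_eLpNorm_le_annulus`), where `φ'` does not vanish. A finite cover concludes
(`BranchedMap.exists_pull_le`).

Push-forward. A partition of unity reduces to a function `v` supported in a chart. Ramification
indices are one on almost every fibre, so the push-forward is the plain fibre sum. Testing against
`ψ` amounts to testing `v` against `conj F' · (ψ ∘ F)`; as `conj F'` is antiholomorphic, the weak
derivative of the fibre sum of `v` is the fibre sum of `∂v / F'`, across the critical values as well
(`FiniteBranched.isWeakDeriv_dz_fibreSum`). Cauchy–Schwarz on the fibres and the area formula bound
its norm (`BranchedMap.exists_push`). A change of charts is the case of the identity map, with `d =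
1`.

Extension. Mollification in charts shows that smooth functions are dense. For completeness, the norm
controls only `∂f` while membership also asks for `∂̄f`; the two have the same `L²` norm for
compactly supported functions in the plane, by two integrations by parts, so a limit keeps both
derivatives. Bounded maps on a dense image then extend uniquely (`existsUnique_extension`). -/

lemma dz_congr {f g : ℂ → ℂ} {z : ℂ} (h : f =ᶠ[𝓝 z] g) : dz f z = dz g z := by
  simp only [dz, h.fderiv_eq]

lemma dz_mul {f g : ℂ → ℂ} {z : ℂ} (hf : DifferentiableAt ℝ f z) (hg : DifferentiableAt ℝ g z) :
    dz (fun w => f w * g w) z = f z * dz g z + dz f z * g z := by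
  simp only [dz, fderiv_fun_mul hf hg, add_apply,
    smul_apply, smul_eq_mul]
  ring

/-- This symmetry is what allows the weak-derivative statements on `dzbar` to be deduced from those
on `dz`. -/
lemma dz_conj {f : ℂ → ℂ} {z : ℂ} (hf : DifferentiableAt ℝ f z) :
    dz (fun w => conj (f w)) z = conj (dzbar f z) := by
  have h : fderiv ℝ (fun w => conj (f w)) z = (Complex.conjCLE : ℂ →L[ℝ] ℂ).comp (fderiv ℝ f z) :=
    ((Complex.conjCLE : ℂ →L[ℝ] ℂ).hasFDerivAt.comp z hf.hasFDerivAt).fderiv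
  simp [dz, dzbar, h, map_ofNat (starRingEnd ℂ) 2, sub_eq_add_neg]

lemma dzbar_conj {f : ℂ → ℂ} {z : ℂ} (hf : DifferentiableAt ℝ f z) :
    dzbar (fun w => conj (f w)) z = conj (dz f z) := by
  have h : fderiv ℝ (fun w => conj (f w)) z = (Complex.conjCLE : ℂ →L[ℝ] ℂ).comp (fderiv ℝ f z) :=
    ((Complex.conjCLE : ℂ →L[ℝ] ℂ).hasFDerivAt.comp z hf.hasFDerivAt).fderiv
  simp [dz, dzbar, h, sub_eq_add_neg, map_ofNat (starRingEnd ℂ) 2]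

/-- The chain rule for a smooth function composed with a holomorphic one. -/
lemma dz_comp {f F : ℂ → ℂ} {z F' : ℂ} (hf : DifferentiableAt ℝ f (F z))
    (hF : HasDerivAt F F' z) : dz (fun w => f (F w)) z = dz f (F z) * F' := by
  have h : fderiv ℝ (fun w => f (F w)) z = (fderiv ℝ f (F z)).comp
      ((ContinuousLinearMap.toSpanSingleton ℂ F').restrictScalars ℝ) :=
    (hf.hasFDerivAt.comp z (hF.hasFDerivAt.restrictScalars ℝ)).fderiv
  have e1 : fderiv ℝ f (F z) F' =
      F'.re * fderiv ℝ f (F z) 1 + F'.im * fderiv ℝ f (F z) Complex.I := by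
    conv_lhs => rw [show F' = F'.re • (1 : ℂ) + F'.im • Complex.I by
      simp [Complex.re_add_im]]
    rw [map_add, map_smul, map_smul]
    simp
  have e2 : fderiv ℝ f (F z) (Complex.I * F') =
      F'.re * fderiv ℝ f (F z) Complex.I - F'.im * fderiv ℝ f (F z) 1 := by
    conv_lhs => rw [show Complex.I * F' = F'.re • Complex.I + (-F'.im) • (1 : ℂ) by
      apply Complex.ext <;> simp]
    rw [map_add, map_smul, map_smul]
    simp [sub_eq_add_neg]
  simp only [dz, h, ContinuousLinearMap.comp_apply, ContinuousLinearMap.coe_restrictScalars',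
    ContinuousLinearMap.toSpanSingleton_apply, smul_eq_mul, one_mul, e1, e2]
  conv_rhs => rw [← Complex.re_add_im F']
  linear_combination (F'.im * fderiv ℝ f (F z) Complex.I / 2) * Complex.I_sq

lemma dzbar_eq_zero {F : ℂ → ℂ} {z : ℂ} (hF : DifferentiableAt ℂ F z) : dzbar F z = 0 := by
  have h : fderiv ℝ F z = (ContinuousLinearMap.toSpanSingleton ℂ (deriv F z)).restrictScalars ℝ :=
    (hF.hasDerivAt.hasFDerivAt.restrictScalars ℝ).fderiv
  simp [dzbar, h, ← mul_assoc]

/-- By Cauchy–Riemann. Applied to `deriv F`, it makes `conj (deriv F)` behave like a constant under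
`dz` when weak derivatives are pushed forward. -/
lemma dz_conj_eq_zero {F : ℂ → ℂ} {z : ℂ} (hF : DifferentiableAt ℂ F z) :
    dz (fun w => conj (F w)) z = 0 := by
  rw [dz_conj (hF.restrictScalars ℝ), dzbar_eq_zero hF, map_zero]

lemma fderiv_one_eq (f : ℂ → ℂ) (z : ℂ) : fderiv ℝ f z 1 = dz f z + dzbar f z := by
  simp only [dz, dzbar]
  ring

lemma continuousOn_dz {U : Set ℂ} (hU : IsOpen U) {u : ℂ → ℂ} (hu : ContDiffOn ℝ ∞ u U) :
    ContinuousOn (dz u) U := by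
  have c : ∀ v, ContinuousOn (fun z => fderiv ℝ u z v) U := fun v =>
    (hu.continuousOn_fderiv_of_isOpen hU (by simp)).clm_apply continuousOn_const
  have h1 := c 1
  have h2 := c Complex.I
  unfold dz
  fun_prop

/-! ### Test functions -/

lemma IsTestFunction.mono {U V : Set ℂ} {ψ : ℂ → ℂ} (h : IsTestFunction U ψ) (hUV : U ⊆ V) :
    IsTestFunction V ψ := ⟨h.contDiff, h.hasCompactSupport, h.tsupport_subset.trans hUV⟩

lemma IsTestFunction.eq_zero {U : Set ℂ} {ψ : ℂ → ℂ} (h : IsTestFunction U ψ) {z : ℂ}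
    (hz : z ∉ U) : ψ z = 0 :=
  image_eq_zero_of_notMem_tsupport fun hz' => hz (h.tsupport_subset hz')

lemma IsTestFunction.dz_eq_zero {U : Set ℂ} {ψ : ℂ → ℂ} (h : IsTestFunction U ψ) {z : ℂ}
    (hz : z ∉ U) : dz ψ z = 0 :=
  h.dz_props.2 z fun hz' => hz (h.tsupport_subset hz')

lemma IsTestFunction.dzbar_eq_zero {U : Set ℂ} {ψ : ℂ → ℂ} (h : IsTestFunction U ψ) {z : ℂ}
    (hz : z ∉ U) : dzbar ψ z = 0 :=
  h.dzbar_props.2 z fun hz' => hz (h.tsupport_subset hz')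

lemma IsTestFunction.differentiableAt {U : Set ℂ} {ψ : ℂ → ℂ} (h : IsTestFunction U ψ) (z : ℂ) :
    DifferentiableAt ℝ ψ z := h.contDiff.differentiable (by simp) z

lemma tsupport_conj (ψ : ℂ → ℂ) : tsupport (fun z => conj (ψ z)) = tsupport ψ := by
  unfold tsupport
  congr 1
  ext z
  simp

lemma IsTestFunction.conj {U : Set ℂ} {ψ : ℂ → ℂ} (h : IsTestFunction U ψ) :
    IsTestFunction U (fun z => conj (ψ z)) where
  contDiff := (Complex.conjCLE : ℂ →L[ℝ] ℂ).contDiff.comp h.contDiff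
  hasCompactSupport := by
    have := h.hasCompactSupport
    unfold HasCompactSupport at this ⊢
    rwa [tsupport_conj]
  tsupport_subset := by rw [tsupport_conj]; exact h.tsupport_subset

/-- Nothing is known of `g` off `U`, but near a point outside the closed set `tsupport θ` the
product is identically zero. -/
lemma IsTestFunction.mul {U : Set ℂ} (hU : IsOpen U) {θ g : ℂ → ℂ} (h : IsTestFunction U θ)
    (hg : ContDiffOn ℝ ∞ g U) : IsTestFunction U (fun z => θ z * g z) := by
  have hs : tsupport (fun z => θ z * g z) ⊆ tsupport θ := tsupport_mul_subset_left
  refine ⟨?_, h.hasCompactSupport.mono' (subset_closure.trans hs), hs.trans h.tsupport_subset⟩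
  rw [contDiff_iff_contDiffAt]
  intro z
  by_cases hz : z ∈ tsupport θ
  · exact h.contDiff.contDiffAt.mul (hg.contDiffAt (hU.mem_nhds (h.tsupport_subset hz)))
  · have : (fun z => θ z * g z) =ᶠ[𝓝 z] fun _ => 0 := by
      filter_upwards [(isClosed_tsupport θ).isOpen_compl.mem_nhds hz] with w hw
      rw [image_eq_zero_of_notMem_tsupport hw, zero_mul]
    exact contDiffAt_const.congr_of_eventuallyEq this

/-- The value one is reached on a neighbourhood of each point of `L`, so that inserting `θ` changes
no derivative there. -/
lemma exists_cutoff {L U : Set ℂ} (hL : IsCompact L) (hU : IsOpen U) (h : L ⊆ U) :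
    ∃ θ : ℂ → ℂ, IsTestFunction U θ ∧ (∀ z ∈ L, ∀ᶠ w in 𝓝 z, θ w = 1) ∧ ∀ z, ‖θ z‖ ≤ 1 := by
  obtain ⟨K, hK, hLK, hKU⟩ := exists_compact_between hL hU h
  obtain ⟨f, h1, h0, hf⟩ := exists_contMDiffMap_one_nhds_of_subset_interior (n := ⊤) 𝓘(ℝ, ℂ)
    hL.isClosed hLK
  have hs : support (fun z => (f z : ℂ)) ⊆ K := by
    intro z hz
    by_contra hzK
    exact hz (by simp [h0 z hzK])
  refine ⟨fun z => (f z : ℂ), ⟨?_, HasCompactSupport.of_support_subset_isCompact hK hs,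
    (closure_minimal hs hK.isClosed).trans hKU⟩, ?_, ?_⟩
  · exact Complex.ofRealCLM.contDiff.comp f.contMDiff.contDiff
  · intro z hz
    filter_upwards [Filter.Eventually.filter_mono (nhds_le_nhdsSet hz) h1] with w hw
    simp [hw]
  · intro z
    have := hf z
    rw [Complex.norm_real, Real.norm_eq_abs, abs_le]
    exact ⟨by linarith [this.1], this.2⟩

/-! ### Weak derivatives -/

lemma setIntegral_eq_of_eq_zero {U V : Set ℂ} {f : ℂ → ℂ} (hU : ∀ z ∉ U, f z = 0)
    (hV : ∀ z ∉ V, f z = 0) : ∫ z in U, f z = ∫ z in V, f z := by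
  rw [setIntegral_eq_integral_of_forall_compl_eq_zero hU,
    setIntegral_eq_integral_of_forall_compl_eq_zero hV]

/-- Test functions on `V` are test functions on `U`, and both integrands vanish off `V`. -/
lemma IsWeakDeriv.mono {D : (ℂ → ℂ) → ℂ → ℂ} {U V : Set ℂ} {u w : ℂ → ℂ}
    (hD : ∀ ψ, IsTestFunction V ψ → ∀ z ∉ V, D ψ z = 0) (h : IsWeakDeriv D U u w) (hVU : V ⊆ U) :
    IsWeakDeriv D V u w where
  locInt_fun := h.locInt_fun.mono_set hVU
  locInt_deriv := h.locInt_deriv.mono_set hVU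
  integral_eq ψ hψ := by
    have := h.integral_eq ψ (hψ.mono hVU)
    rw [setIntegral_eq_of_eq_zero (V := V), setIntegral_eq_of_eq_zero (U := U) (V := V)] at this
    · exact this
    · exact fun z hz => by rw [(hψ.mono hVU).eq_zero hz, mul_zero]
    · exact fun z hz => by rw [hψ.eq_zero hz, mul_zero]
    · exact fun z hz => by rw [hD ψ hψ z fun hz' => hz (hVU hz'), mul_zero]
    · exact fun z hz => by rw [hD ψ hψ z hz, mul_zero]

lemma _root_.MeasureTheory.LocallyIntegrableOn.conj {U : Set ℂ} {u : ℂ → ℂ}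
    (h : LocallyIntegrableOn u U) : LocallyIntegrableOn (fun z => conj (u z)) U := fun z hz => by
  obtain ⟨s, hs, hi⟩ := h z hz
  exact ⟨s, hs, (Complex.conjCLE : ℂ →L[ℝ] ℂ).integrable_comp hi⟩

lemma IsWeakDeriv.conj {U : Set ℂ} {u w : ℂ → ℂ} (h : IsWeakDeriv dz U u w) :
    IsWeakDeriv dzbar U (fun z => conj (u z)) (fun z => conj (w z)) where
  locInt_fun := h.locInt_fun.conj
  locInt_deriv := h.locInt_deriv.conj
  integral_eq ψ hψ := by
    have := congrArg conj (h.integral_eq _ hψ.conj)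
    rw [map_neg, ← integral_conj, ← integral_conj] at this
    simpa [dz_conj (hψ.differentiableAt _)] using this

lemma IsWeakDeriv.conj' {U : Set ℂ} {u w : ℂ → ℂ} (h : IsWeakDeriv dzbar U u w) :
    IsWeakDeriv dz U (fun z => conj (u z)) (fun z => conj (w z)) where
  locInt_fun := h.locInt_fun.conj
  locInt_deriv := h.locInt_deriv.conj
  integral_eq ψ hψ := by
    have := congrArg conj (h.integral_eq _ hψ.conj)
    rw [map_neg, ← integral_conj, ← integral_conj] at this
    simpa [dzbar_conj (hψ.differentiableAt _)] using this

lemma isWeakDeriv_dz {U : Set ℂ} (hU : IsOpen U) {u : ℂ → ℂ} (hu : ContDiffOn ℝ ∞ u U) :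
    IsWeakDeriv dz U u (dz u) := by
  refine ⟨hu.continuousOn.locallyIntegrableOn hU.measurableSet,
    (continuousOn_dz hU hu).locallyIntegrableOn hU.measurableSet, fun ψ hψ => ?_⟩
  obtain ⟨a1, a2, a3⟩ := integral_mul_fderiv_test hU hu hψ 1
  obtain ⟨b1, b2, b3⟩ := integral_mul_fderiv_test hU hu hψ Complex.I
  have e1 : ∀ z, u z * dz ψ z = (1 / 2) * (u z * fderiv ℝ ψ z 1) -
      (Complex.I / 2) * (u z * fderiv ℝ ψ z Complex.I) := fun z => by
    unfold dz
    ring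
  have e2 : ∀ z, dz u z * ψ z = (1 / 2) * (fderiv ℝ u z 1 * ψ z) -
      (Complex.I / 2) * (fderiv ℝ u z Complex.I * ψ z) := fun z => by
    unfold dz
    ring
  simp only [e1, e2]
  rw [integral_sub (a1.const_mul _) (b1.const_mul _), integral_sub (a2.const_mul _)
    (b2.const_mul _)]
  simp only [integral_const_mul]
  rw [a3, b3]
  ring

lemma dzbar_eq_conj {u : ℂ → ℂ} {z : ℂ} (hu : DifferentiableAt ℝ u z) :
    dzbar u z = conj (dz (fun w => conj (u w)) z) := by
  rw [dz_conj hu, Complex.conj_conj]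

lemma contDiffOn_conj {U : Set ℂ} {u : ℂ → ℂ} (hu : ContDiffOn ℝ ∞ u U) :
    ContDiffOn ℝ ∞ (fun w => conj (u w)) U :=
  (Complex.conjCLE : ℂ →L[ℝ] ℂ).contDiff.comp_contDiffOn hu

lemma IsWeakDeriv.congr_deriv {D : (ℂ → ℂ) → ℂ → ℂ} {U : Set ℂ} {u w w' : ℂ → ℂ}
    (h : IsWeakDeriv D U u w) (hw : w =ᵐ[volume.restrict U] w') : IsWeakDeriv D U u w' where
  locInt_fun := h.locInt_fun
  locInt_deriv := h.locInt_deriv.congr hw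
  integral_eq ψ hψ := by
    rw [h.integral_eq ψ hψ]
    congr 1
    refine integral_congr_ae ?_
    filter_upwards [hw] with z hz
    rw [hz]

lemma isWeakDeriv_dzbar {U : Set ℂ} (hU : IsOpen U) {u : ℂ → ℂ} (hu : ContDiffOn ℝ ∞ u U) :
    IsWeakDeriv dzbar U u (dzbar u) := by
  have h := (isWeakDeriv_dz hU (contDiffOn_conj hu)).conj
  simp only [Complex.conj_conj] at h
  refine h.congr_deriv ?_
  filter_upwards [ae_restrict_mem hU.measurableSet] with z hz
  exact (dzbar_eq_conj ((hu.differentiableOn (by simp)).differentiableAt (hU.mem_nhds hz))).symm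

/-- The product of a weakly differentiable function on `U` and a test function on `U` is weakly
differentiable on `ℂ`. -/
lemma IsWeakDeriv.cutoff_dz {U : Set ℂ} (hU : IsOpen U) {u w θ : ℂ → ℂ}
    (h : IsWeakDeriv dz U u w) (hθ : IsTestFunction U θ) :
    IsWeakDeriv dz univ (fun z => θ z * u z) (fun z => θ z * w z + dz θ z * u z) := by
  have hi : ∀ {φ v : ℂ → ℂ}, Continuous φ → (∀ z, z ∉ tsupport θ → φ z = 0) →
      LocallyIntegrableOn v U → Integrable (fun z => φ z * v z) := by
    intro φ v hφ hs hv
    have := hθ.integrable_mul hφ hs hv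
    simp only [mul_comm (v _)] at this
    refine (integrableOn_iff_integrable_of_support_subset ?_).1 this
    intro z hz
    by_contra hzU
    exact hz (by simp [hs z fun h' => hzU (hθ.tsupport_subset h')])
  have e : ∀ z, z ∉ tsupport θ → θ z = 0 := fun z hz => image_eq_zero_of_notMem_tsupport hz
  have i1 := hi hθ.contDiff.continuous e h.locInt_fun
  have i2 := hi hθ.contDiff.continuous e h.locInt_deriv
  have i3 := hi hθ.dz_props.1 hθ.dz_props.2 h.locInt_fun
  refine ⟨i1.locallyIntegrable.locallyIntegrableOn _,
    (i2.add i3).locallyIntegrable.locallyIntegrableOn _, fun ψ hψ => ?_⟩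
  -- `ψ` lives on the whole plane; `θ ψ` is admissible on `U`. The Leibniz rule for `θ ψ` produces
  -- the extra term with `dz θ`.
  have hp : IsTestFunction U (fun z => θ z * ψ z) := hθ.mul hU hψ.contDiff.contDiffOn
  have key := h.integral_eq _ hp
  have cψ := hψ.contDiff.continuous
  have zψ : ∀ z, z ∉ tsupport ψ → ψ z = 0 := fun z hz => image_eq_zero_of_notMem_tsupport hz
  have j1 := hψ.integrable_mul hψ.dz_props.1 hψ.dz_props.2 (i1.locallyIntegrable.locallyIntegrableOn _)
  have j2 := hψ.integrable_mul cψ zψ (i2.locallyIntegrable.locallyIntegrableOn _)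
  have j3 := hψ.integrable_mul cψ zψ (i3.locallyIntegrable.locallyIntegrableOn _)
  rw [setIntegral_eq_integral_of_forall_compl_eq_zero,
    setIntegral_eq_integral_of_forall_compl_eq_zero] at key
  rotate_left
  · exact fun z hz => by rw [hp.eq_zero hz, mul_zero]
  · exact fun z hz => by rw [hp.dz_eq_zero hz, mul_zero]
  rw [integrableOn_univ] at j1 j2 j3
  have e1 : ∀ z, u z * dz (fun z => θ z * ψ z) z =
      θ z * u z * dz ψ z + dz θ z * u z * ψ z := fun z => by
    rw [dz_mul (hθ.differentiableAt z) (hψ.differentiableAt z)]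
    ring
  have e2 : ∀ z, w z * (θ z * ψ z) = θ z * w z * ψ z := fun z => by ring
  simp only [e1, e2] at key
  rw [integral_add j1 j3] at key
  simp only [add_mul, Measure.restrict_univ]
  rw [integral_add j2 j3]
  linear_combination key

lemma IsWeakDeriv.cutoff_dzbar {U : Set ℂ} (hU : IsOpen U) {u w θ : ℂ → ℂ}
    (h : IsWeakDeriv dzbar U u w) (hθ : IsTestFunction U θ) :
    IsWeakDeriv dzbar univ (fun z => θ z * u z) (fun z => θ z * w z + dzbar θ z * u z) := by
  have := (h.conj'.cutoff_dz hU hθ.conj).conj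
  simpa [dz_conj (hθ.differentiableAt _)] using this

/-! ### The area formula for holomorphic maps with finite fibres -/

/-- `F` is holomorphic on the open set `W`, its critical points in `W` form a null set, and its
fibres in `W` have at most `d` points. -/
structure FiniteBranched (F : ℂ → ℂ) (W : Set ℂ) (d : ℕ) : Prop where
  isOpen : IsOpen W
  differentiableOn : DifferentiableOn ℂ F W
  null_critical : volume {z ∈ W | deriv F z = 0} = 0
  encard_fibre_le : ∀ y, (W ∩ F ⁻¹' {y}).encard ≤ d

/-- The sum of `u` over the points of the fibre of `F` over `y` that lie in `W`. -/
noncomputable def fibreSum {M : Type*} [AddCommMonoid M] (F : ℂ → ℂ) (W : Set ℂ) (u : ℂ → M)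
    (y : ℂ) : M := ∑ᶠ z ∈ W ∩ F ⁻¹' {y}, u z

/-- The real determinant of a complex-linear map is the norm from `ℂ` to `ℝ` of its complex
determinant. Hence the Jacobian of a holomorphic map is `|F'|²`. -/
lemma abs_det_toSpanSingleton (a : ℂ) :
    |((ContinuousLinearMap.toSpanSingleton ℂ a).restrictScalars ℝ).det| = ‖a‖ ^ 2 := by
  have : ((ContinuousLinearMap.toSpanSingleton ℂ a).restrictScalars ℝ).det = ‖a‖ ^ 2 := by
    have h : ((ContinuousLinearMap.toSpanSingleton ℂ a) : ℂ →ₗ[ℂ] ℂ) = LinearMap.lsmul ℂ ℂ a := by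
      ext
      simp
    change LinearMap.det (((ContinuousLinearMap.toSpanSingleton ℂ a) : ℂ →ₗ[ℂ] ℂ).restrictScalars ℝ)
      = _
    rw [LinearMap.det_restrictScalars, h]
    simp [Algebra.norm_complex_eq, Complex.normSq_eq_norm_sq]
  rw [this, abs_of_nonneg (by positivity)]

namespace FiniteBranched

variable {F : ℂ → ℂ} {W : Set ℂ} {d : ℕ}

lemma finite_fibre (hF : FiniteBranched F W d) (y : ℂ) : (W ∩ F ⁻¹' {y}).Finite :=
  Set.finite_of_encard_le_coe (hF.encard_fibre_le y)

lemma hasDerivAt (hF : FiniteBranched F W d) {z : ℂ} (hz : z ∈ W) :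
    HasDerivAt F (deriv F z) z :=
  (hF.differentiableOn.differentiableAt (hF.isOpen.mem_nhds hz)).hasDerivAt

lemma analyticAt (hF : FiniteBranched F W d) {z : ℂ} (hz : z ∈ W) : AnalyticAt ℂ F z :=
  hF.differentiableOn.analyticAt (hF.isOpen.mem_nhds hz)

lemma differentiableOn_deriv (hF : FiniteBranched F W d) : DifferentiableOn ℂ (deriv F) W :=
  fun _ hz => (hF.analyticAt hz).deriv.differentiableAt.differentiableWithinAt

lemma contDiffOn (hF : FiniteBranched F W d) : ContDiffOn ℝ ∞ F W :=
  fun _ hz => (((hF.analyticAt hz).contDiffAt (n := ∞)).restrict_scalars ℝ).contDiffWithinAt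

lemma contDiffOn_deriv (hF : FiniteBranched F W d) : ContDiffOn ℝ ∞ (deriv F) W :=
  fun _ hz => (((hF.analyticAt hz).deriv.contDiffAt (n := ∞)).restrict_scalars ℝ).contDiffWithinAt

lemma fibreSum_eq {M : Type*} [AddCommMonoid M] (hF : FiniteBranched F W d) (u : ℂ → M) (y : ℂ) :
    fibreSum F W u y = ∑ z ∈ (hF.finite_fibre y).toFinset, u z :=
  finsum_mem_eq_finite_toFinset_sum _ _

lemma ae_deriv_ne_zero (hF : FiniteBranched F W d) :
    ∀ᵐ z ∂(volume.restrict W), deriv F z ≠ 0 := by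
  rw [ae_restrict_iff' hF.isOpen.measurableSet, ae_iff]
  convert hF.null_critical using 2
  ext z
  simp

/-- A property that holds almost everywhere on `W` holds on almost every fibre. -/
lemma ae_fibre (hF : FiniteBranched F W d) {p : ℂ → Prop} (hp : ∀ᵐ z ∂(volume.restrict W), p z) :
    ∀ᵐ y, ∀ z ∈ W, F z = y → p z := by
  rw [ae_restrict_iff' hF.isOpen.measurableSet, ae_iff] at hp
  -- A differentiable map between spaces of equal dimension sends null sets to null sets, so the
  -- values taken at exceptional points are negligible.
  have h0 : volume (F '' {z | ¬ (z ∈ W → p z)}) = 0 := by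
    refine addHaar_image_eq_zero_of_differentiableOn_of_addHaar_eq_zero volume ?_ hp
    refine (hF.differentiableOn.restrictScalars ℝ).mono fun z hz => ?_
    by_contra h
    exact hz fun h' => absurd h' h
  rw [ae_iff]
  refine measure_mono_null ?_ h0
  intro y hy
  simp only [mem_ofPred_eq, not_forall] at hy
  obtain ⟨z, hz, rfl, hpz⟩ := hy
  exact ⟨z, fun h => hpz (h hz), rfl⟩

lemma fibreSum_congr {M : Type*} [AddCommMonoid M] {u u' : ℂ → M} {y : ℂ}
    (h : ∀ z ∈ W, F z = y → u z = u' z) : fibreSum F W u y = fibreSum F W u' y :=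
  finsum_mem_congr rfl fun z hz => h z hz.1 hz.2

lemma fibreSum_congr_ae {M : Type*} [AddCommMonoid M] (hF : FiniteBranched F W d) {u u' : ℂ → M}
    (h : u =ᵐ[volume.restrict W] u') : fibreSum F W u =ᵐ[volume] fibreSum F W u' := by
  filter_upwards [hF.ae_fibre h] with y hy
  exact fibreSum_congr hy

/-- Projection formula: a factor depending only on `F z` is constant along the fibre. -/
lemma fibreSum_mul (hF : FiniteBranched F W d) (u g : ℂ → ℂ) (y : ℂ) :
    fibreSum F W (fun z => u z * g (F z)) y = fibreSum F W u y * g y := by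
  rw [hF.fibreSum_eq, hF.fibreSum_eq, Finset.sum_mul]
  refine Finset.sum_congr rfl fun z hz => ?_
  rw [Set.Finite.mem_toFinset] at hz
  rw [show F z = y from hz.2]

lemma fibreSum_mul_ennreal (hF : FiniteBranched F W d) (u g : ℂ → ENNReal) (y : ℂ) :
    fibreSum F W (fun z => u z * g (F z)) y = fibreSum F W u y * g y := by
  rw [hF.fibreSum_eq, hF.fibreSum_eq, Finset.sum_mul]
  refine Finset.sum_congr rfl fun z hz => ?_
  rw [Set.Finite.mem_toFinset] at hz
  rw [show F z = y from hz.2]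

lemma card_fibre_le (hF : FiniteBranched F W d) (y : ℂ) :
    (hF.finite_fibre y).toFinset.card ≤ d := by
  have := hF.encard_fibre_le y
  rw [(hF.finite_fibre y).encard_eq_coe_toFinset_card] at this
  exact_mod_cast this

lemma fibreSum_one_le (hF : FiniteBranched F W d) (y : ℂ) :
    fibreSum F W (fun _ => (1 : ENNReal)) y ≤ d := by
  rw [hF.fibreSum_eq, Finset.sum_const, nsmul_one]
  exact_mod_cast hF.card_fibre_le y

lemma enorm_fibreSum_le (hF : FiniteBranched F W d) (u : ℂ → ℂ) (y : ℂ) :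
    ‖fibreSum F W u y‖ₑ ≤ fibreSum F W (fun z => ‖u z‖ₑ) y := by
  rw [hF.fibreSum_eq, hF.fibreSum_eq]
  exact enorm_sum_le _ _

/-- Cauchy–Schwarz on a fibre of at most `d` points; the factor `d` in the push-forward estimates
has its source here. -/
lemma enorm_fibreSum_sq_le (hF : FiniteBranched F W d) (u : ℂ → ℂ) (y : ℂ) :
    ‖fibreSum F W u y‖ₑ ^ 2 ≤ d * fibreSum F W (fun z => ‖u z‖ₑ ^ 2) y := by
  refine (pow_le_pow_left' (hF.enorm_fibreSum_le u y) 2).trans ?_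
  rw [hF.fibreSum_eq, hF.fibreSum_eq]
  have h := sq_sum_le_card_mul_sum_sq (s := (hF.finite_fibre y).toFinset) (f := fun z => ‖u z‖₊)
  simp only [enorm_eq_nnnorm]
  calc (∑ z ∈ (hF.finite_fibre y).toFinset, (‖u z‖₊ : ENNReal)) ^ 2
      ≤ (hF.finite_fibre y).toFinset.card *
        ∑ z ∈ (hF.finite_fibre y).toFinset, (‖u z‖₊ : ENNReal) ^ 2 := by exact_mod_cast h
    _ ≤ _ := by
      gcongr
      exact_mod_cast hF.card_fibre_le y

/-- The regular points are covered by countably many disjoint sets on which `F` is injective. -/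
lemma exists_injective_pieces (hF : FiniteBranched F W d) :
    ∃ D : ℕ → Set ℂ, (∀ n, MeasurableSet (D n)) ∧ Pairwise (Disjoint on D) ∧
      (⋃ n, D n) = {z ∈ W | deriv F z ≠ 0} ∧ ∀ n, InjOn F (D n) := by
  set R : Set ℂ := {z ∈ W | deriv F z ≠ 0} with hR
  have hRo : IsOpen R :=
    hF.differentiableOn_deriv.continuousOn.isOpen_inter_preimage hF.isOpen isOpen_compl_singleton
  have h : ∀ z ∈ R, ∃ s ∈ 𝓝 z, IsOpen s ∧ InjOn F s := by
    intro z hz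
    have hs : HasStrictFDerivAt F ((ContinuousLinearEquiv.unitsEquivAut ℂ
        (Units.mk0 (deriv F z) hz.2) : ℂ ≃L[ℂ] ℂ) : ℂ →L[ℂ] ℂ) z :=
      ((hF.analyticAt hz.1).hasStrictDerivAt).hasStrictFDerivAt_equiv hz.2
    refine ⟨_, (hs.toOpenPartialHomeomorph F).open_source.mem_nhds
      hs.mem_toOpenPartialHomeomorph_source, (hs.toOpenPartialHomeomorph F).open_source, ?_⟩
    have := (hs.toOpenPartialHomeomorph F).injOn
    rwa [hs.toOpenPartialHomeomorph_coe] at this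
  choose! s hs hso hsi using h
  obtain ⟨t, htR, htc, ht⟩ := TopologicalSpace.countable_cover_nhdsWithin
    (fun z hz => mem_nhdsWithin_of_mem_nhds (hs z hz))
  obtain ⟨q, hq⟩ : ∃ q : ℕ → Set ℂ, (∀ n, MeasurableSet (q n) ∧ InjOn F (q n)) ∧
      R ⊆ ⋃ n, q n := by
    rcases t.eq_empty_or_nonempty with rfl | hne
    · exact ⟨fun _ => ∅, fun _ => ⟨MeasurableSet.empty, injOn_empty F⟩, by simpa using ht⟩
    · obtain ⟨p, rfl⟩ := htc.exists_eq_range hne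
      refine ⟨fun n => s (p n), fun n => ⟨(hso _ (htR ⟨n, rfl⟩)).measurableSet,
        hsi _ (htR ⟨n, rfl⟩)⟩, ?_⟩
      simpa using ht
  refine ⟨fun n => R ∩ disjointed q n, fun n =>
    hRo.measurableSet.inter (MeasurableSet.disjointed (fun i => (hq.1 i).1) n), ?_, ?_, ?_⟩
  · intro i j hij
    exact (disjoint_disjointed q hij).mono inter_subset_right inter_subset_right
  · rw [← inter_iUnion, iUnion_disjointed, inter_eq_left]
    exact hq.2
  · exact fun n => (hq.1 n).2.mono (inter_subset_right.trans (disjointed_subset q n))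

/-- The function `h` on `D` transported to `F '' D`, and extended by zero. -/
noncomputable def transport {M : Type*} [Zero M] (F : ℂ → ℂ) (D : Set ℂ) (h : ℂ → M) : ℂ → M :=
  Function.extend (D.domRestrict F) (D.domRestrict h) 0

lemma transport_apply {M : Type*} [Zero M] {D : Set ℂ} (hD : InjOn F D) (h : ℂ → M) {z : ℂ}
    (hz : z ∈ D) : transport F D h (F z) = h z :=
  (injOn_iff_injective.1 hD).extend_apply (D.domRestrict h) 0 ⟨z, hz⟩

lemma transport_apply_of_notMem {M : Type*} [Zero M] {D : Set ℂ} (h : ℂ → M) {y : ℂ}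
    (hy : y ∉ F '' D) : transport F D h y = 0 :=
  Function.extend_apply' _ _ _ fun ⟨a, ha⟩ => hy ⟨a, a.2, ha⟩

lemma hasFDerivWithinAt (hF : FiniteBranched F W d) {D : Set ℂ} {z : ℂ} (hz : z ∈ W) :
    HasFDerivWithinAt F
      ((ContinuousLinearMap.toSpanSingleton ℂ (deriv F z)).restrictScalars ℝ) D z :=
  ((hF.hasDerivAt hz).hasFDerivAt.restrictScalars ℝ).hasFDerivWithinAt

lemma measurable_transport {M : Type*} [Zero M] [MeasurableSpace M] (hF : FiniteBranched F W d)
    {D : Set ℂ} (hDW : D ⊆ W) (hDm : MeasurableSet D) (hD : InjOn F D) {h : ℂ → M}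
    (hh : Measurable h) : Measurable (transport F D h) :=
  (measurableEmbedding_of_fderivWithin hDm (fun _ hz => hF.hasFDerivWithinAt (hDW hz))
    hD).measurable_extend (hh.comp measurable_subtype_coe) measurable_const

/-- Over a value with no critical preimage in `W`, each point of the fibre lies in exactly one
piece, and by injectivity each piece contains at most one of them. The series over the pieces is
therefore the fibre sum reindexed. -/
lemma hasSum_transport {M : Type*} [AddCommMonoid M] [TopologicalSpace M] [ContinuousAdd M]
    (hF : FiniteBranched F W d)
    {D : ℕ → Set ℂ} (hDd : Pairwise (Disjoint on D)) (hDu : (⋃ n, D n) = {z ∈ W | deriv F z ≠ 0})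
    (hDi : ∀ n, InjOn F (D n)) (h : ℂ → M) {y : ℂ} (hy : ∀ z ∈ W, F z = y → deriv F z ≠ 0) :
    HasSum (fun n => transport F (D n) h y) (fibreSum F W h y) := by
  classical
  have hn : ∀ z ∈ W ∩ F ⁻¹' {y}, ∃ n, z ∈ D n := by
    intro z hz
    have : z ∈ ⋃ n, D n := by
      rw [hDu]
      exact ⟨hz.1, hy z hz.1 hz.2⟩
    exact mem_iUnion.1 this
  choose! N hN using hn
  have hDW : ∀ n, D n ⊆ W := fun n z hz =>
    (hDu ▸ mem_iUnion.2 ⟨n, hz⟩ : z ∈ {z ∈ W | deriv F z ≠ 0}).1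
  rw [hF.fibreSum_eq]
  have h1 : HasSum (fun n => ∑ z ∈ (hF.finite_fibre y).toFinset, if n = N z then h z else 0)
      (∑ z ∈ (hF.finite_fibre y).toFinset, h z) :=
    hasSum_sum fun z _ => hasSum_ite_eq (N z) (h z)
  convert h1 using 2 with n
  by_cases hyn : y ∈ F '' D n
  · obtain ⟨z, hz, rfl⟩ := hyn
    have hzf : z ∈ W ∩ F ⁻¹' {F z} := ⟨hDW n hz, rfl⟩
    rw [transport_apply (hDi n) h hz, Finset.sum_eq_single z]
    · rw [if_pos]
      by_contra hne
      exact disjoint_left.1 (hDd hne) hz (hN z hzf)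
    · intro b hb hbz
      rw [Set.Finite.mem_toFinset] at hb
      rw [if_neg]
      rintro rfl
      exact hbz (hDi _ (hN b hb) hz hb.2)
    · intro hz'
      exact absurd ((Set.Finite.mem_toFinset _).2 hzf) hz'
  · rw [transport_apply_of_notMem h hyn, Finset.sum_eq_zero]
    intro z hz
    rw [Set.Finite.mem_toFinset] at hz
    rw [if_neg]
    rintro rfl
    exact hyn ⟨z, hN z hz, hz.2⟩

lemma lintegral_transport (hF : FiniteBranched F W d)
    {D : Set ℂ} (hDW : D ⊆ W) (hDm : MeasurableSet D) (hD : InjOn F D) (h : ℂ → ENNReal) :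
    ∫⁻ y, transport F D h y = ∫⁻ z in D, ‖deriv F z‖ₑ ^ 2 * h z := by
  have h1 := lintegral_image_eq_lintegral_abs_det_fderiv_mul volume hDm
    (fun z hz => hF.hasFDerivWithinAt (hDW hz)) hD (transport F D h)
  rw [setLIntegral_eq_of_support_subset] at h1
  · rw [h1]
    refine setLIntegral_congr_fun hDm fun z hz => ?_
    simp only [abs_det_toSpanSingleton, transport_apply hD h hz]
    rw [ENNReal.ofReal_pow (norm_nonneg _), ofReal_norm]
  · intro y hy
    by_contra hy'
    exact hy (transport_apply_of_notMem h hy')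

lemma integral_transport (hF : FiniteBranched F W d)
    {D : Set ℂ} (hDW : D ⊆ W) (hDm : MeasurableSet D) (hD : InjOn F D) (h : ℂ → ℂ) :
    ∫ y, transport F D h y = ∫ z in D, (‖deriv F z‖ ^ 2 : ℝ) • h z := by
  have h1 := integral_image_eq_integral_abs_det_fderiv_smul volume hDm
    (fun z hz => hF.hasFDerivWithinAt (hDW hz)) hD (transport F D h)
  rw [setIntegral_eq_integral_of_forall_compl_eq_zero
    (fun y hy => transport_apply_of_notMem h hy)] at h1
  rw [h1]
  refine setIntegral_congr_fun hDm fun z hz => ?_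
  simp only [abs_det_toSpanSingleton, transport_apply hD h hz]

lemma ae_eq_regular (hF : FiniteBranched F W d) : {z ∈ W | deriv F z ≠ 0} =ᵐ[volume] W := by
  refine (Filter.EventuallyLE.antisymm (Filter.Eventually.of_forall fun z hz => hz.1) ?_)
  have : ∀ᵐ z, z ∉ {z ∈ W | deriv F z = 0} := measure_eq_zero_iff_ae_notMem.1 hF.null_critical
  filter_upwards [this] with z hz hzW
  exact ⟨hzW, fun h => hz ⟨hzW, h⟩⟩

/-- The area formula for nonnegative functions. -/
lemma lintegral_fibreSum (hF : FiniteBranched F W d) {h : ℂ → ENNReal}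
    (hh : AEMeasurable h (volume.restrict W)) :
    ∫⁻ y, fibreSum F W h y = ∫⁻ z in W, ‖deriv F z‖ₑ ^ 2 * h z := by
  obtain ⟨D, hDm, hDd, hDu, hDi⟩ := hF.exists_injective_pieces
  have hDW : ∀ n, D n ⊆ W := fun n z hz =>
    (hDu ▸ mem_iUnion.2 ⟨n, hz⟩ : z ∈ {z ∈ W | deriv F z ≠ 0}).1
  -- The Borel representative makes each transported piece measurable; on almost every fibre it
  -- agrees with `h`.
  have key : ∀ᵐ y, fibreSum F W h y = ∑' n, transport F (D n) (hh.mk h) y := by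
    filter_upwards [hF.fibreSum_congr_ae hh.ae_eq_mk, hF.ae_fibre hF.ae_deriv_ne_zero] with y h1 h2
    rw [h1, (hF.hasSum_transport hDd hDu hDi (hh.mk h) h2).tsum_eq]
  rw [lintegral_congr_ae key, lintegral_tsum fun n =>
    (hF.measurable_transport (hDW n) (hDm n) (hDi n) hh.measurable_mk).aemeasurable]
  simp only [hF.lintegral_transport (hDW _) (hDm _) (hDi _)]
  rw [← lintegral_iUnion hDm hDd, hDu, setLIntegral_congr hF.ae_eq_regular]
  refine lintegral_congr_ae ?_
  filter_upwards [hh.ae_eq_mk] with z hz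
  rw [hz]

lemma aestronglyMeasurable_fibreSum (hF : FiniteBranched F W d) {h : ℂ → ℂ}
    (hh : AEStronglyMeasurable h (volume.restrict W)) :
    AEStronglyMeasurable (fibreSum F W h) volume := by
  obtain ⟨D, hDm, hDd, hDu, hDi⟩ := hF.exists_injective_pieces
  have hDW : ∀ n, D n ⊆ W := fun n z hz =>
    (hDu ▸ mem_iUnion.2 ⟨n, hz⟩ : z ∈ {z ∈ W | deriv F z ≠ 0}).1
  refine AEStronglyMeasurable.congr ?_ (hF.fibreSum_congr_ae hh.ae_eq_mk).symm
  refine aestronglyMeasurable_of_tendsto_ae (u := Filter.atTop)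
    (f := fun k y => ∑ n ∈ Finset.range k, transport F (D n) (hh.mk h) y) (fun k => ?_) ?_
  · exact (Finset.measurable_sum _ fun n _ => hF.measurable_transport (hDW n) (hDm n) (hDi n)
      hh.stronglyMeasurable_mk.measurable).aestronglyMeasurable
  · filter_upwards [hF.ae_fibre hF.ae_deriv_ne_zero] with y hy
    exact (hF.hasSum_transport hDd hDu hDi (hh.mk h) hy).tendsto_sum_nat

/-- The area formula for integrable functions. -/
lemma integral_fibreSum (hF : FiniteBranched F W d) {h : ℂ → ℂ}
    (hh : AEStronglyMeasurable h (volume.restrict W))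
    (hi : IntegrableOn (fun z => (‖deriv F z‖ ^ 2 : ℝ) • h z) W) :
    Integrable (fibreSum F W h) ∧
      ∫ y, fibreSum F W h y = ∫ z in W, (‖deriv F z‖ ^ 2 : ℝ) • h z := by
  have hfin : ∫⁻ y, fibreSum F W (fun z => ‖h z‖ₑ) y < ⊤ := by
    rw [hF.lintegral_fibreSum hh.enorm]
    have := hi.2
    rw [HasFiniteIntegral] at this
    simpa only [enorm_smul, enorm_pow, enorm_norm] using this
  refine ⟨⟨hF.aestronglyMeasurable_fibreSum hh,
    (lintegral_mono fun y => hF.enorm_fibreSum_le h y).trans_lt hfin⟩, ?_⟩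
  obtain ⟨D, hDm, hDd, hDu, hDi⟩ := hF.exists_injective_pieces
  have hDW : ∀ n, D n ⊆ W := fun n z hz =>
    (hDu ▸ mem_iUnion.2 ⟨n, hz⟩ : z ∈ {z ∈ W | deriv F z ≠ 0}).1
  have key : ∀ᵐ y, fibreSum F W h y = ∑' n, transport F (D n) (hh.mk h) y := by
    filter_upwards [hF.fibreSum_congr_ae hh.ae_eq_mk, hF.ae_fibre hF.ae_deriv_ne_zero] with y h1 h2
    rw [h1, (hF.hasSum_transport hDd hDu hDi (hh.mk h) h2).tsum_eq]
  have hae : (fun z => (‖deriv F z‖ ^ 2 : ℝ) • h z) =ᵐ[volume.restrict W]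
      fun z => (‖deriv F z‖ ^ 2 : ℝ) • hh.mk h z := by
    filter_upwards [hh.ae_eq_mk] with z hz
    rw [hz]
  have hi' : IntegrableOn (fun z => (‖deriv F z‖ ^ 2 : ℝ) • hh.mk h z) (⋃ n, D n) := by
    rw [hDu]
    exact IntegrableOn.mono_set (hi.congr hae) fun z hz => hz.1
  have henorm : ∀ n y, ‖transport F (D n) (hh.mk h) y‖ₑ =
      transport F (D n) (fun z => ‖hh.mk h z‖ₑ) y := by
    intro n y
    by_cases hy : y ∈ F '' D n
    · obtain ⟨z, hz, rfl⟩ := hy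
      rw [transport_apply (hDi n) _ hz, transport_apply (hDi n) _ hz]
    · rw [transport_apply_of_notMem _ hy, transport_apply_of_notMem _ hy, enorm_zero]
  rw [integral_congr_ae key, integral_tsum fun n => (hF.measurable_transport (hDW n) (hDm n)
    (hDi n) hh.stronglyMeasurable_mk.measurable).aestronglyMeasurable]
  · simp only [hF.integral_transport (hDW _) (hDm _) (hDi _)]
    rw [(hasSum_integral_iUnion hDm hDd hi').tsum_eq, hDu, setIntegral_congr_set hF.ae_eq_regular]
    exact (integral_congr_ae hae).symm
  · simp only [henorm, hF.lintegral_transport (hDW _) (hDm _) (hDi _)]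
    rw [← lintegral_iUnion hDm hDd]
    have := hi'.2
    rw [HasFiniteIntegral] at this
    simpa only [enorm_smul, enorm_pow, enorm_norm] using this.ne

end FiniteBranched

/-! ### Push-forward of weak derivatives -/

namespace FiniteBranched

variable {F : ℂ → ℂ} {W V S : Set ℂ} {d : ℕ}

lemma measurableSet_inter_preimage (hF : FiniteBranched F W d) {K : Set ℂ} (hK : IsClosed K) :
    MeasurableSet (W ∩ F ⁻¹' K) := by
  have h1 : IsOpen (W ∩ F ⁻¹' Kᶜ) :=
    hF.differentiableOn.continuousOn.isOpen_inter_preimage hF.isOpen hK.isOpen_compl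
  have h2 : W ∩ F ⁻¹' K = W \ (W ∩ F ⁻¹' Kᶜ) := by
    ext z
    simp only [mem_inter_iff, mem_preimage, mem_sdiff, mem_compl_iff]
    tauto
  rw [h2]
  exact hF.isOpen.measurableSet.diff h1.measurableSet

/-- The area formula applied to `v · (G ∘ F)`. As `G` is bounded and vanishes off `K`, integrability
is needed only over the preimage of `K`. -/
lemma integral_fibreSum_mul (hF : FiniteBranched F W d) {K : Set ℂ}
    {v G : ℂ → ℂ} (hv : AEStronglyMeasurable v (volume.restrict W))
    (hi : IntegrableOn (fun z => (‖deriv F z‖ ^ 2 : ℝ) • v z) (W ∩ F ⁻¹' K))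
    (hG : Measurable G) {C : ℝ} (hC : ∀ y, ‖G y‖ ≤ C) (hGK : ∀ y ∉ K, G y = 0) :
    Integrable (fun y => fibreSum F W v y * G y) ∧
      ∫ y, fibreSum F W v y * G y = ∫ z in W, (‖deriv F z‖ ^ 2 : ℝ) • (v z * G (F z)) := by
  have hGF : AEStronglyMeasurable (fun z => G (F z)) (volume.restrict W) :=
    (hG.comp_aemeasurable
      (hF.differentiableOn.continuousOn.aemeasurable hF.isOpen.measurableSet)).aestronglyMeasurable
  have h1 : IntegrableOn (fun z => (‖deriv F z‖ ^ 2 : ℝ) • (v z * G (F z))) (W ∩ F ⁻¹' K) := by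
    have := Integrable.mul_bdd (c := C) hi
      (hGF.mono_measure (Measure.restrict_mono inter_subset_left le_rfl))
      (Filter.Eventually.of_forall fun z => hC (F z))
    simp only [smul_mul_assoc] at this
    exact this
  have h2 : IntegrableOn (fun z => (‖deriv F z‖ ^ 2 : ℝ) • (v z * G (F z))) W := by
    refine h1.of_forall_sdiff_eq_zero hF.isOpen.measurableSet fun z hz => ?_
    rw [hGK (F z) fun h => hz.2 ⟨hz.1, h⟩, mul_zero, smul_zero]
  have := hF.integral_fibreSum (hv.mul hGF) h2
  rw [show fibreSum F W (v * fun z => G (F z)) = fun y => fibreSum F W v y * G y from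
    funext (hF.fibreSum_mul v G)] at this
  exact this

lemma locallyIntegrableOn_fibreSum (hF : FiniteBranched F W d) (hV : IsOpen V) {v : ℂ → ℂ}
    (hv : AEStronglyMeasurable v (volume.restrict W))
    (hi : ∀ K ⊆ V, IsCompact K →
      IntegrableOn (fun z => (‖deriv F z‖ ^ 2 : ℝ) • v z) (W ∩ F ⁻¹' K)) :
    LocallyIntegrableOn (fibreSum F W v) V := by
  rw [locallyIntegrableOn_iff hV.isLocallyClosed]
  intro K hKV hK
  -- With the indicator of `K` as weight, integrability of the product is integrability of the fibre
  -- sum on `K`.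
  have h := (hF.integral_fibreSum_mul hv (hi K hKV hK) (G := K.indicator 1) (C := 1)
    (measurable_one.indicator hK.measurableSet) (fun y => ?_) fun y hy => ?_).1
  · rw [← integrable_indicator_iff hK.measurableSet]
    refine h.congr (Filter.Eventually.of_forall fun y => ?_)
    by_cases hy : y ∈ K <;> simp [hy]
  · by_cases hy : y ∈ K <;> simp [hy]
  · simp [hy]

/-- Properness on the support: the part of `S` over `K` is inside a compact subset of `W`, where
local integrability becomes integrability. -/
lemma integrableOn_of_proper (hF : FiniteBranched F W d) {K L : Set ℂ} {v c : ℂ → ℂ}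
    (hv : LocallyIntegrableOn v W) (hvS : ∀ z ∈ W, z ∉ S → v z = 0) (hc : ContinuousOn c W)
    (hK : IsCompact K) (hL : IsCompact L) (hLW : L ⊆ W)
    (hKL : ∀ z ∈ W, z ∈ S → F z ∈ K → z ∈ L) :
    IntegrableOn (fun z => v z * c z) (W ∩ F ⁻¹' K) := by
  refine ((hv.integrableOn_compact_subset hLW hL).mul_continuousOn (hc.mono hLW)
    hL).of_forall_sdiff_eq_zero (hF.measurableSet_inter_preimage hK.isClosed) fun z hz => ?_
  rw [hvS z hz.1.1 fun h => hz.2 (hKL z hz.1.1 h hz.1.2), zero_mul]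

/-- The sum over the fibres of a weakly differentiable function `u` with `∂u = w dz` is weakly
differentiable, provided that `F` is proper on a set `S` that contains the support of `u`. -/
lemma isWeakDeriv_dz_fibreSum (hF : FiniteBranched F W d) (hV : IsOpen V) {u w : ℂ → ℂ}
    (h : IsWeakDeriv dz W u w) (hu : ∀ z ∈ W, z ∉ S → u z = 0) (hw : ∀ z ∈ W, z ∉ S → w z = 0)
    (hS : ∀ K ⊆ V, IsCompact K →
      ∃ L ⊆ W, IsCompact L ∧ ∀ z ∈ W, z ∈ S → F z ∈ K → z ∈ L) :
    IsWeakDeriv dz V (fibreSum F W u) (fibreSum F W fun z => w z / deriv F z) := by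
  have cd := hF.differentiableOn_deriv.continuousOn
  have hnormsq : ∀ z, ((‖deriv F z‖ ^ 2 : ℝ) : ℂ) = conj (deriv F z) * deriv F z := fun z => by
    rw [mul_comm, Complex.mul_conj']
    push_cast
    rfl
  have mu := h.locInt_fun.aestronglyMeasurable
  have mw : AEStronglyMeasurable (fun z => w z / deriv F z) (volume.restrict W) :=
    (h.locInt_deriv.aestronglyMeasurable.aemeasurable.div
      (cd.aemeasurable hF.isOpen.measurableSet)).aestronglyMeasurable
  have iu : ∀ K ⊆ V, IsCompact K →
      IntegrableOn (fun z => (‖deriv F z‖ ^ 2 : ℝ) • u z) (W ∩ F ⁻¹' K) := by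
    intro K hKV hK
    obtain ⟨L, hLW, hL, hKL⟩ := hS K hKV hK
    have := hF.integrableOn_of_proper (c := fun z => ((‖deriv F z‖ ^ 2 : ℝ) : ℂ)) h.locInt_fun hu
      (Complex.continuous_ofReal.comp_continuousOn (cd.norm.pow 2)) hK hL hLW hKL
    simpa only [Complex.real_smul, mul_comm] using this
  -- Since `|F'|² = conj F' · F'`, the weighted integrand is `conj F' · w`: the pole of `w / F'` at
  -- a critical point has gone.
  have iw : ∀ K ⊆ V, IsCompact K →
      IntegrableOn (fun z => (‖deriv F z‖ ^ 2 : ℝ) • (w z / deriv F z)) (W ∩ F ⁻¹' K) := by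
    intro K hKV hK
    obtain ⟨L, hLW, hL, hKL⟩ := hS K hKV hK
    have := hF.integrableOn_of_proper (c := fun z => conj (deriv F z)) h.locInt_deriv hw
      (Complex.continuous_conj.comp_continuousOn cd) hK hL hLW hKL
    refine this.congr ?_
    filter_upwards [ae_restrict_of_ae_restrict_of_subset inter_subset_left
      hF.ae_deriv_ne_zero] with z hz
    rw [Complex.real_smul, hnormsq]
    field_simp
  refine ⟨hF.locallyIntegrableOn_fibreSum hV mu iu, hF.locallyIntegrableOn_fibreSum hV mw iw,
    fun ψ hψ => ?_⟩
  have hψc := hψ.hasCompactSupport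
  obtain ⟨L, hLW, hL, hKL⟩ := hS _ hψ.tsupport_subset hψc
  -- `ψ ∘ F` need not have compact support in `W`. The cutoff repairs this and equals one near the
  -- points of `S` lying over the support of `ψ`, the only ones that contribute.
  obtain ⟨θ, hθ, hθ1, -⟩ := exists_cutoff hL hF.isOpen hLW
  obtain ⟨C1, hC1⟩ := hψ.contDiff.continuous.bounded_above_of_compact_support hψc
  have hψc' : HasCompactSupport (dz ψ) := HasCompactSupport.intro hψc fun z hz => hψ.dz_props.2 z hz
  obtain ⟨C2, hC2⟩ := hψ.dz_props.1.bounded_above_of_compact_support hψc'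
  have e1 := (hF.integral_fibreSum_mul mu (iu _ hψ.tsupport_subset hψc)
    hψ.dz_props.1.measurable hC2 hψ.dz_props.2).2
  have e2 := (hF.integral_fibreSum_mul mw (iw _ hψ.tsupport_subset hψc)
    hψ.contDiff.continuous.measurable hC1 fun y hy => image_eq_zero_of_notMem_tsupport hy).2
  rw [setIntegral_eq_integral_of_forall_compl_eq_zero fun y hy => by
      rw [hψ.dz_eq_zero hy, mul_zero],
    setIntegral_eq_integral_of_forall_compl_eq_zero fun y hy => by
      rw [hψ.eq_zero hy, mul_zero], e1, e2]
  have hΨ : IsTestFunction W (fun z => θ z * (conj (deriv F z) * ψ (F z))) :=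
    hθ.mul hF.isOpen ((contDiffOn_conj hF.contDiffOn_deriv).mul
      (hψ.contDiff.comp_contDiffOn hF.contDiffOn))
  have key := h.integral_eq _ hΨ
  have near : ∀ z ∈ W, F z ∉ tsupport ψ → ∀ᶠ x in 𝓝 z, ψ (F x) = 0 := by
    intro z hz hFz
    filter_upwards [(hF.hasDerivAt hz).continuousAt.preimage_mem_nhds
      ((isClosed_tsupport ψ).isOpen_compl.mem_nhds hFz)] with x hx
    exact image_eq_zero_of_notMem_tsupport hx
  -- Because `dz (conj F') = 0`, the product and chain rules give `dz (conj F' · ψ ∘ F) = conj F' ·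
  -- F' · (dz ψ) ∘ F`, which is the weight of the area formula.
  have f1 : ∀ z ∈ W, u z * dz (fun z => θ z * (conj (deriv F z) * ψ (F z))) z =
      (‖deriv F z‖ ^ 2 : ℝ) • (u z * dz ψ (F z)) := by
    intro z hz
    by_cases hzS : z ∈ S
    · by_cases hFz : F z ∈ tsupport ψ
      · have : (fun z => θ z * (conj (deriv F z) * ψ (F z))) =ᶠ[𝓝 z]
            fun z => conj (deriv F z) * ψ (F z) := by
          filter_upwards [hθ1 z (hKL z hz hzS hFz)] with x hx
          rw [hx, one_mul]
        have dd : DifferentiableAt ℂ (deriv F) z := (hF.analyticAt hz).deriv.differentiableAt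
        have d1 : DifferentiableAt ℝ (fun z => conj (deriv F z)) z :=
          (Complex.conjCLE : ℂ →L[ℝ] ℂ).differentiableAt.comp z (dd.restrictScalars ℝ)
        have d2 : DifferentiableAt ℝ (fun z => ψ (F z)) z := (hψ.differentiableAt (F z)).comp z
          ((hF.hasDerivAt hz).differentiableAt.restrictScalars ℝ)
        rw [dz_congr this, dz_mul d1 d2, dz_conj_eq_zero dd, dz_comp (hψ.differentiableAt _) (hF.hasDerivAt hz),
          Complex.real_smul, hnormsq]
        ring
      · have : (fun z => θ z * (conj (deriv F z) * ψ (F z))) =ᶠ[𝓝 z] fun _ => 0 := by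
          filter_upwards [near z hz hFz] with x hx
          rw [hx, mul_zero, mul_zero]
        rw [dz_congr this, hψ.dz_props.2 _ hFz]
        simp [dz]
    · rw [hu z hz hzS]
      simp
  have f2 : ∀ᵐ z ∂(volume.restrict W), w z * (θ z * (conj (deriv F z) * ψ (F z))) =
      (‖deriv F z‖ ^ 2 : ℝ) • (w z / deriv F z * ψ (F z)) := by
    filter_upwards [hF.ae_deriv_ne_zero, ae_restrict_mem hF.isOpen.measurableSet] with z hz0 hz
    by_cases hzS : z ∈ S
    · by_cases hFz : F z ∈ tsupport ψ
      · rw [(hθ1 z (hKL z hz hzS hFz)).self_of_nhds, Complex.real_smul, hnormsq]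
        field_simp
      · rw [(near z hz hFz).self_of_nhds]
        simp
    · rw [hw z hz hzS]
      simp
  rw [setIntegral_congr_fun hF.isOpen.measurableSet f1, integral_congr_ae f2] at key
  exact key

lemma conj_fibreSum (hF : FiniteBranched F W d) (u : ℂ → ℂ) (y : ℂ) :
    conj (fibreSum F W u y) = fibreSum F W (fun z => conj (u z)) y := by
  rw [hF.fibreSum_eq, hF.fibreSum_eq, map_sum]

lemma isWeakDeriv_dzbar_fibreSum (hF : FiniteBranched F W d) (hV : IsOpen V) {u w : ℂ → ℂ}
    (h : IsWeakDeriv dzbar W u w) (hu : ∀ z ∈ W, z ∉ S → u z = 0)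
    (hw : ∀ z ∈ W, z ∉ S → w z = 0)
    (hS : ∀ K ⊆ V, IsCompact K →
      ∃ L ⊆ W, IsCompact L ∧ ∀ z ∈ W, z ∈ S → F z ∈ K → z ∈ L) :
    IsWeakDeriv dzbar V (fibreSum F W u) (fibreSum F W fun z => w z / conj (deriv F z)) := by
  have := (hF.isWeakDeriv_dz_fibreSum hV h.conj' (fun z hz hzS => by rw [hu z hz hzS, map_zero])
    (fun z hz hzS => by rw [hw z hz hzS, map_zero]) hS).conj
  simpa only [hF.conj_fibreSum, Complex.conj_conj, map_div₀] using this

end FiniteBranched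

/-! ### Mollification -/

lemma eLpNorm_two_sq {α : Type*} [MeasurableSpace α] {μ : Measure α} (f : α → ℂ) :
    eLpNorm f 2 μ ^ 2 = ∫⁻ x, ‖f x‖ₑ ^ 2 ∂μ := by
  have := eLpNorm_nnreal_pow_eq_lintegral (f := f) (μ := μ) (p := 2) two_ne_zero
  simpa using this

lemma eLpNorm_two_le_iff {α β : Type*} [MeasurableSpace α] {μ : Measure α} [MeasurableSpace β]
    {ν : Measure β} (f : α → ℂ) (g : β → ℂ) :
    eLpNorm f 2 μ ≤ eLpNorm g 2 ν ↔ ∫⁻ x, ‖f x‖ₑ ^ 2 ∂μ ≤ ∫⁻ x, ‖g x‖ₑ ^ 2 ∂ν := by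
  rw [← eLpNorm_two_sq, ← eLpNorm_two_sq]
  exact (ENNReal.pow_le_pow_left_iff two_ne_zero).symm

lemma sq_lintegral_mul_le {α : Type*} [MeasurableSpace α] {μ : Measure α} {f g : α → ENNReal}
    (hf : AEMeasurable f μ) (hg : AEMeasurable g μ) :
    (∫⁻ x, f x * g x ∂μ) ^ 2 ≤ (∫⁻ x, f x ^ 2 ∂μ) * ∫⁻ x, g x ^ 2 ∂μ := by
  have h := ENNReal.lintegral_mul_le_Lp_mul_Lq μ Real.HolderConjugate.two_two hf hg
  have h2 := pow_le_pow_left' h 2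
  simp only [Pi.mul_apply, ENNReal.rpow_ofNat, mul_pow] at h2
  refine h2.trans (le_of_eq ?_)
  rw [← ENNReal.rpow_natCast, ← ENNReal.rpow_natCast, ← ENNReal.rpow_mul, ← ENNReal.rpow_mul]
  norm_num

/-- The convolution of `u` with a normalized bump function. -/
noncomputable def mollify (φ : ContDiffBump (0 : ℂ)) (u : ℂ → ℂ) (z : ℂ) : ℂ :=
  ∫ t, φ.normed volume t • u (z - t)

section mollify

variable (φ : ContDiffBump (0 : ℂ))

lemma mollify_eq_convolution (u : ℂ → ℂ) :
    mollify φ u = convolution (φ.normed volume) u (ContinuousLinearMap.lsmul ℝ ℝ) volume := rfl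

lemma mollify_eq_swap (u : ℂ → ℂ) (z : ℂ) :
    mollify φ u z = ∫ t, φ.normed volume (z - t) • u t := by
  rw [mollify_eq_convolution, convolution_lsmul_swap]

lemma mollify_congr {u u' : ℂ → ℂ} (h : u =ᵐ[volume] u') : mollify φ u = mollify φ u' := by
  ext z
  rw [mollify_eq_swap, mollify_eq_swap]
  refine integral_congr_ae ?_
  filter_upwards [h] with t ht
  rw [ht]

lemma conj_mollify (u : ℂ → ℂ) (z : ℂ) :
    conj (mollify φ u z) = mollify φ (fun t => conj (u t)) z := by
  simp [mollify, ← integral_conj]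

lemma mollify_sub {u v : ℂ → ℂ} (hu : LocallyIntegrable u) (hv : LocallyIntegrable v) (z : ℂ) :
    mollify φ (u - v) z = mollify φ u z - mollify φ v z := by
  have h1 := (φ.hasCompactSupport_normed (μ := volume)).convolutionExists_left
    (ContinuousLinearMap.lsmul ℝ ℝ) φ.continuous_normed hu z
  have h2 := (φ.hasCompactSupport_normed (μ := volume)).convolutionExists_left
    (ContinuousLinearMap.lsmul ℝ ℝ) φ.continuous_normed hv z
  simp only [mollify, Pi.sub_apply, smul_sub]
  exact integral_sub h1 h2

lemma contDiff_mollify {u : ℂ → ℂ} (hu : LocallyIntegrable u) : ContDiff ℝ ∞ (mollify φ u) :=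
  (φ.hasCompactSupport_normed (μ := volume)).contDiff_convolution_left
    (ContinuousLinearMap.lsmul ℝ ℝ) φ.contDiff_normed hu

lemma mollify_eq_zero {u : ℂ → ℂ} {K : Set ℂ} {δ : ℝ} (hu : ∀ z ∉ K, u z = 0) (hφ : φ.rOut ≤ δ)
    {z : ℂ} (hz : z ∉ Metric.cthickening δ K) : mollify φ u z = 0 := by
  refine integral_eq_zero_of_ae (Filter.Eventually.of_forall fun t => ?_)
  by_cases ht : z - t ∈ K
  · have : t ∉ support (φ.normed volume) := by
      rw [φ.support_normed_eq, Metric.mem_ball, dist_zero_right, not_lt]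
      by_contra h
      refine hz (Metric.mem_cthickening_of_dist_le z (z - t) δ K ht ?_)
      rw [dist_eq_norm, sub_sub_cancel]
      linarith
    simp [notMem_support.1 this]
  · simp [hu _ ht]

/-- The normalized bump is a probability density `k`. Cauchy–Schwarz with `k = k^(1/2) · k^(1/2)`
bounds the square of the average by the average of the squares; Tonelli and translation invariance
conclude. -/
lemma lintegral_mollify_le {u : ℂ → ℂ} (hu : AEStronglyMeasurable u volume) :
    ∫⁻ z, ‖mollify φ u z‖ₑ ^ 2 ≤ ∫⁻ z, ‖u z‖ₑ ^ 2 := by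
  wlog hm : Measurable u generalizing u
  · have h := this hu.stronglyMeasurable_mk.aestronglyMeasurable
      hu.stronglyMeasurable_mk.measurable
    rw [← mollify_congr φ hu.ae_eq_mk] at h
    refine h.trans (le_of_eq (lintegral_congr_ae ?_))
    filter_upwards [hu.ae_eq_mk] with z hz
    rw [hz]
  set k : ℂ → ENNReal := fun t => ENNReal.ofReal (φ.normed volume t) with hk
  have hkm : Measurable k := (φ.continuous_normed (μ := volume)).measurable.ennreal_ofReal
  have hk1 : ∫⁻ t, k t = 1 := by
    rw [← ofReal_integral_eq_lintegral_ofReal φ.integrable_normed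
      (Filter.Eventually.of_forall φ.nonneg_normed), φ.integral_normed, ENNReal.ofReal_one]
  have hp : ∀ z, ‖mollify φ u z‖ₑ ^ 2 ≤ ∫⁻ t, k t * ‖u (z - t)‖ₑ ^ 2 := by
    intro z
    have h1 : ‖mollify φ u z‖ₑ ≤ ∫⁻ t, k t * ‖u (z - t)‖ₑ := by
      refine (enorm_integral_le_lintegral_enorm _).trans (le_of_eq ?_)
      refine lintegral_congr fun t => ?_
      rw [enorm_smul, Real.enorm_of_nonneg (φ.nonneg_normed t)]
    have hum : Measurable fun t => ‖u (z - t)‖ₑ := (hm.comp (measurable_const.sub measurable_id)).enorm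
    have hs : ∀ t, k t ^ (1 / 2 : ℝ) * k t ^ (1 / 2 : ℝ) = k t := fun t => by
      rw [← ENNReal.rpow_add_of_nonneg _ _ (by norm_num) (by norm_num)]
      norm_num
    have h2 := sq_lintegral_mul_le (μ := volume) (f := fun t => k t ^ (1 / 2 : ℝ))
      (g := fun t => k t ^ (1 / 2 : ℝ) * ‖u (z - t)‖ₑ) (hkm.pow_const _).aemeasurable
      ((hkm.pow_const _).mul hum).aemeasurable
    simp only [mul_pow, pow_two (k _ ^ (1 / 2 : ℝ)), ← mul_assoc, hs, hk1, one_mul] at h2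
    exact (pow_le_pow_left' h1 2).trans h2
  calc ∫⁻ z, ‖mollify φ u z‖ₑ ^ 2 ≤ ∫⁻ z, ∫⁻ t, k t * ‖u (z - t)‖ₑ ^ 2 := lintegral_mono hp
    _ = ∫⁻ t, ∫⁻ z, k t * ‖u (z - t)‖ₑ ^ 2 := by
      refine lintegral_lintegral_swap (Measurable.aemeasurable ?_)
      exact (hkm.comp measurable_snd).mul
        ((hm.comp (measurable_fst.sub measurable_snd)).enorm.pow_const 2)
    _ = ∫⁻ t, k t * ∫⁻ z, ‖u z‖ₑ ^ 2 := by
      refine lintegral_congr fun t => ?_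
      have hum : Measurable fun z => u (z - t) := hm.comp (measurable_id.sub measurable_const)
      rw [lintegral_const_mul _ (hum.enorm.pow_const 2),
        lintegral_sub_right_eq_self (fun z => ‖u z‖ₑ ^ 2) t]
    _ = ∫⁻ z, ‖u z‖ₑ ^ 2 := by
      rw [lintegral_mul_const _ hkm, hk1, one_mul]

lemma eLpNorm_mollify_le {u : ℂ → ℂ} (hu : AEStronglyMeasurable u volume) :
    eLpNorm (mollify φ u) 2 volume ≤ eLpNorm u 2 volume :=
  (eLpNorm_two_le_iff _ _).2 (lintegral_mollify_le φ hu)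

lemma _root_.MeasureTheory.MemLp.locallyIntegrable_two {u : ℂ → ℂ} (hu : MemLp u 2 volume) :
    LocallyIntegrable u := hu.locallyIntegrable (by norm_num)

/-- Mollifications converge in `L²`. -/
lemma exists_mollify_sub_le {u : ℂ → ℂ} (hu : MemLp u 2 volume) {ε : ENNReal} (hε : ε ≠ 0) :
    ∃ δ > 0, ∀ φ : ContDiffBump (0 : ℂ), φ.rOut ≤ δ →
      eLpNorm (mollify φ u - u) 2 volume ≤ ε := by
  have hε3 : ε / 3 ≠ 0 := by simp [hε]
  -- Three errors of `ε / 3`: replacing `u` by a continuous compactly supported `g` before and after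
  -- mollifying, where mollification is a contraction, and mollifying `g`.
  obtain ⟨g, hgc, hug, hg, hgm⟩ := hu.exists_hasCompactSupport_eLpNorm_sub_le (by norm_num) hε3
  set B : Set ℂ := Metric.cthickening 1 (tsupport g) with hB
  have hBc : IsCompact B := hgc.cthickening
  have hM : volume B ≠ ⊤ := hBc.measure_lt_top.ne
  -- `η` is the uniform error allowed for `g`. For radii at most one that error lives on `B`, so its
  -- squared norm is at most `η² · volume B`.
  obtain ⟨η, hη, hηB⟩ : ∃ η : ℝ, 0 < η ∧ ENNReal.ofReal η ^ 2 * volume B ≤ (ε / 3) ^ 2 := by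
    rcases eq_or_ne ε ⊤ with rfl | hεt
    · exact ⟨1, one_pos, by simp [ENNReal.top_div]⟩
    obtain ⟨η, hη0, hη⟩ := ENNReal.exists_nnreal_pos_mul_lt (a := volume B) (b := (ε / 3) ^ 2) hM
      (pow_ne_zero 2 hε3)
    -- Capping at one makes the square at most `η`.
    refine ⟨min 1 η, by positivity, le_trans ?_ hη.le⟩
    gcongr
    rw [pow_two]
    calc ENNReal.ofReal (min 1 η) * ENNReal.ofReal (min 1 η) ≤ 1 * η := by
          gcongr
          · exact ENNReal.ofReal_le_one.2 (min_le_left _ _)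
          · exact (ENNReal.ofReal_le_ofReal (min_le_right _ _)).trans
              (ENNReal.ofReal_coe_nnreal).le
      _ = η := one_mul _
  obtain ⟨δ, hδ, hgδ⟩ := Metric.uniformContinuous_iff.1 (hgc.uniformContinuous_of_continuous hg)
    η hη
  refine ⟨min δ 1, by positivity, fun φ hφ => ?_⟩
  have h2 : eLpNorm (mollify φ g - g) 2 volume ≤ ε / 3 := by
    rw [← ENNReal.pow_le_pow_left_iff (n := 2) two_ne_zero, eLpNorm_two_sq]
    refine le_trans ?_ hηB
    calc ∫⁻ z, ‖(mollify φ g - g) z‖ₑ ^ 2 ≤ ∫⁻ z, B.indicator (fun _ => ENNReal.ofReal η ^ 2) z := by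
          refine lintegral_mono fun z => ?_
          by_cases hz : z ∈ B
          · rw [indicator_of_mem hz]
            gcongr
            rw [Pi.sub_apply, ← ofReal_norm, ← dist_eq_norm]
            refine ENNReal.ofReal_le_ofReal ?_
            rw [mollify_eq_convolution]
            refine φ.dist_normed_convolution_le hg.aestronglyMeasurable fun x hx => ?_
            exact (hgδ (lt_of_lt_of_le hx (hφ.trans (min_le_left _ _)))).le
          · have h0 : ∀ z ∉ tsupport g, g z = 0 := fun z hz => image_eq_zero_of_notMem_tsupport hz
            rw [indicator_of_notMem hz, Pi.sub_apply,
              mollify_eq_zero φ h0 (hφ.trans (min_le_right _ _)) hz,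
              h0 z fun h => hz (Metric.self_subset_cthickening _ h)]
            simp
      _ = ENNReal.ofReal η ^ 2 * volume B := by
          rw [lintegral_indicator hBc.measurableSet, setLIntegral_const]
  have h1 : eLpNorm (mollify φ (u - g)) 2 volume ≤ ε / 3 :=
    (eLpNorm_mollify_le φ (hu.1.sub hgm.1)).trans hug
  have h3 : mollify φ u - u = mollify φ (u - g) + (mollify φ g - g) - (u - g) := by
    ext z
    simp only [Pi.add_apply, Pi.sub_apply,
      mollify_sub φ hu.locallyIntegrable_two hgm.locallyIntegrable_two]
    ring
  have m1 := (contDiff_mollify φ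
    (hu.sub hgm).locallyIntegrable_two).continuous.aestronglyMeasurable (μ := volume)
  have m2 := ((contDiff_mollify φ hgm.locallyIntegrable_two).continuous.sub
    hg).aestronglyMeasurable (μ := volume)
  rw [h3]
  calc _ ≤ eLpNorm (mollify φ (u - g) + (mollify φ g - g)) 2 volume + eLpNorm (u - g) 2 volume :=
        eLpNorm_sub_le (m1.add m2) (hu.1.sub hgm.1) (by norm_num)
    _ ≤ (ε / 3 + ε / 3) + ε / 3 := by
        gcongr
        exact (eLpNorm_add_le m1 m2 (by norm_num)).trans (add_le_add h1 h2)
    _ = ε := ENNReal.add_thirds ε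

/-- Differentiating a convolution, the derivative may be put on the bump `ρ`. As a function of `t`,
`ρ (z - t)` is a test function whose derivative carries the opposite sign, which cancels the sign in
the definition of a weak derivative. -/
lemma dz_mollify {v w : ℂ → ℂ} (h : IsWeakDeriv dz univ v w) (z : ℂ) :
    dz (mollify φ v) z = mollify φ w z := by
  have hv : LocallyIntegrable v := locallyIntegrableOn_univ.1 h.locInt_fun
  set ρ : ℂ → ℝ := φ.normed volume with hρ
  have hρd : ContDiff ℝ ∞ ρ := φ.contDiff_normed
  have hρc : HasCompactSupport ρ := φ.hasCompactSupport_normed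
  have hfd : ∀ e : ℂ, Integrable (fun t => fderiv ℝ ρ (z - t) e • v t) ∧
      fderiv ℝ (mollify φ v) z e = ∫ t, fderiv ℝ ρ (z - t) e • v t := by
    intro e
    have h1 := hρc.hasFDerivAt_convolution_left (ContinuousLinearMap.lsmul ℝ ℝ)
      (hρd.of_le (by simp)) hv z
    rw [mollify_eq_convolution, h1.fderiv, convolution_eq_swap]
    have hi : Integrable (fun t => (ContinuousLinearMap.precompL ℂ
        (ContinuousLinearMap.lsmul ℝ ℝ : ℝ →L[ℝ] ℂ →L[ℝ] ℂ)) (fderiv ℝ ρ (z - t)) (v t)) := by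
      have := (hρc.fderiv ℝ).convolutionExists_left (ContinuousLinearMap.precompL ℂ
        (ContinuousLinearMap.lsmul ℝ ℝ : ℝ →L[ℝ] ℂ →L[ℝ] ℂ))
        (hρd.continuous_fderiv (by simp)) hv z
      exact this.integrable_swap
    refine ⟨?_, ?_⟩
    · exact ((ContinuousLinearMap.apply ℝ ℂ e).integrable_comp hi).congr
        (Filter.Eventually.of_forall fun t => by
          simp [ContinuousLinearMap.precompL_apply])
    · rw [ContinuousLinearMap.integral_apply hi]
      simp [ContinuousLinearMap.precompL_apply]
  set Ψ : ℂ → ℂ := fun t => (ρ (z - t) : ℂ) with hΨ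
  have hΨt : IsTestFunction univ Ψ := by
    refine ⟨Complex.ofRealCLM.contDiff.comp (hρd.comp (contDiff_const.sub contDiff_id)), ?_,
      subset_univ _⟩
    have : HasCompactSupport (fun t => ρ (z - t)) :=
      hρc.comp_homeomorph (Homeomorph.subLeft z)
    exact this.comp_left (g := fun x : ℝ => (x : ℂ)) Complex.ofReal_zero
  have hΨf : ∀ t e, fderiv ℝ Ψ t e = -((fderiv ℝ ρ (z - t) e : ℝ) : ℂ) := by
    intro t e
    have h1 : HasFDerivAt ρ (fderiv ℝ ρ (z - t)) (z - t) :=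
      (hρd.differentiable (by simp) _).hasFDerivAt
    have h2 : HasFDerivAt (fun t : ℂ => z - t) (-ContinuousLinearMap.id ℝ ℂ) t := by
      simpa using (hasFDerivAt_id (𝕜 := ℝ) t).const_sub z
    have h3 := (Complex.ofRealCLM.hasFDerivAt.comp t (h1.comp t h2)).fderiv
    rw [hΨ]
    change fderiv ℝ (⇑Complex.ofRealCLM ∘ ρ ∘ fun t => z - t) t e = _
    rw [h3]
    simp
  have key := h.integral_eq Ψ hΨt
  rw [Measure.restrict_univ] at key
  obtain ⟨i1, e1⟩ := hfd 1
  obtain ⟨iI, eI⟩ := hfd Complex.I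
  rw [mollify_eq_swap, dz, e1, eI]
  have k1 : ∀ t, v t * dz Ψ t = -(1 / 2 : ℂ) * (fderiv ℝ ρ (z - t) 1 • v t) +
      (Complex.I / 2) * (fderiv ℝ ρ (z - t) Complex.I • v t) := by
    intro t
    simp only [dz, hΨf, Complex.real_smul]
    ring
  have k2 : ∀ t, w t * Ψ t = ρ (z - t) • w t := fun t => by
    rw [Complex.real_smul, mul_comm]
  simp only [k1, k2] at key
  rw [integral_add (i1.const_mul _) (iI.const_mul _), integral_const_mul, integral_const_mul] at key
  linear_combination -key

lemma dzbar_mollify {v w : ℂ → ℂ} (h : IsWeakDeriv dzbar univ v w) (z : ℂ) :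
    dzbar (mollify φ v) z = mollify φ w z := by
  have hv : LocallyIntegrable v := locallyIntegrableOn_univ.1 h.locInt_fun
  have h1 := dz_mollify φ h.conj' z
  rw [dzbar_eq_conj ((contDiff_mollify φ hv).differentiable (by simp) z)]
  simp only [conj_mollify]
  rw [h1, conj_mollify]
  simp

end mollify

/-! ### Compactly supported Sobolev functions in the plane -/

/-- `v` is a square integrable function that vanishes off `K`, with square integrable weak
derivatives `w = ∂v/∂z` and `w' = ∂v/∂z̄` that vanish off `K`. -/
structure SupportedSobolev (K : Set ℂ) (v w w' : ℂ → ℂ) : Prop where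
  memLp : MemLp v 2 volume
  memLp_dz : MemLp w 2 volume
  memLp_dzbar : MemLp w' 2 volume
  eq_zero : ∀ z ∉ K, v z = 0
  eq_zero_dz : ∀ z ∉ K, w z = 0
  eq_zero_dzbar : ∀ z ∉ K, w' z = 0
  weak_dz : IsWeakDeriv dz univ v w
  weak_dzbar : IsWeakDeriv dzbar univ v w'

lemma IsTestFunction.supportedSobolev {U : Set ℂ} {g : ℂ → ℂ} (h : IsTestFunction U g) :
    SupportedSobolev (tsupport g) g (dz g) (dzbar g) where
  memLp := h.contDiff.continuous.memLp_of_hasCompactSupport h.hasCompactSupport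
  memLp_dz := h.dz_props.1.memLp_of_hasCompactSupport
    (HasCompactSupport.intro h.hasCompactSupport h.dz_props.2)
  memLp_dzbar := h.dzbar_props.1.memLp_of_hasCompactSupport
    (HasCompactSupport.intro h.hasCompactSupport h.dzbar_props.2)
  eq_zero _ hz := image_eq_zero_of_notMem_tsupport hz
  eq_zero_dz := h.dz_props.2
  eq_zero_dzbar := h.dzbar_props.2
  weak_dz := isWeakDeriv_dz isOpen_univ h.contDiff.contDiffOn
  weak_dzbar := isWeakDeriv_dzbar isOpen_univ h.contDiff.contDiffOn

namespace SupportedSobolev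

variable {K K' : Set ℂ} {v w w' v₂ w₂ w₂' : ℂ → ℂ}

lemma mono (h : SupportedSobolev K v w w') (hK : K ⊆ K') : SupportedSobolev K' v w w' :=
  ⟨h.memLp, h.memLp_dz, h.memLp_dzbar, fun z hz => h.eq_zero z fun h' => hz (hK h'),
    fun z hz => h.eq_zero_dz z fun h' => hz (hK h'),
    fun z hz => h.eq_zero_dzbar z fun h' => hz (hK h'), h.weak_dz, h.weak_dzbar⟩

lemma add (h : SupportedSobolev K v w w') (h₂ : SupportedSobolev K v₂ w₂ w₂') :
    SupportedSobolev K (v + v₂) (w + w₂) (w' + w₂') :=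
  ⟨h.memLp.add h₂.memLp, h.memLp_dz.add h₂.memLp_dz, h.memLp_dzbar.add h₂.memLp_dzbar,
    fun z hz => by simp [h.eq_zero z hz, h₂.eq_zero z hz],
    fun z hz => by simp [h.eq_zero_dz z hz, h₂.eq_zero_dz z hz],
    fun z hz => by simp [h.eq_zero_dzbar z hz, h₂.eq_zero_dzbar z hz],
    h.weak_dz.add (fun _ hψ => hψ.dz_props) h₂.weak_dz,
    h.weak_dzbar.add (fun _ hψ => hψ.dzbar_props) h₂.weak_dzbar⟩

lemma smul (h : SupportedSobolev K v w w') (c : ℂ) :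
    SupportedSobolev K (c • v) (c • w) (c • w') :=
  ⟨h.memLp.const_smul c, h.memLp_dz.const_smul c, h.memLp_dzbar.const_smul c,
    fun z hz => by simp [h.eq_zero z hz], fun z hz => by simp [h.eq_zero_dz z hz],
    fun z hz => by simp [h.eq_zero_dzbar z hz], h.weak_dz.smul c, h.weak_dzbar.smul c⟩

lemma sub (h : SupportedSobolev K v w w') (h₂ : SupportedSobolev K v₂ w₂ w₂') :
    SupportedSobolev K (v - v₂) (w - w₂) (w' - w₂') := by
  simpa only [sub_eq_add_neg, neg_one_smul] using h.add (h₂.smul (-1))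

/-- Test functions are dense among the compactly supported Sobolev functions. -/
lemma exists_testFunction (h : SupportedSobolev K v w w') (hK : IsCompact K) {U : Set ℂ}
    (hU : IsOpen U) (hKU : K ⊆ U) {ε : ENNReal} (hε : ε ≠ 0) :
    ∃ g, IsTestFunction U g ∧ eLpNorm (v - g) 2 volume ≤ ε ∧
      eLpNorm (w - dz g) 2 volume ≤ ε ∧ eLpNorm (w' - dzbar g) 2 volume ≤ ε := by
  obtain ⟨δ₀, hδ₀, hδU⟩ := hK.exists_cthickening_subset_open hU hKU
  obtain ⟨δ₁, hδ₁, h₁⟩ := exists_mollify_sub_le h.memLp hε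
  obtain ⟨δ₂, hδ₂, h₂⟩ := exists_mollify_sub_le h.memLp_dz hε
  obtain ⟨δ₃, hδ₃, h₃⟩ := exists_mollify_sub_le h.memLp_dzbar hε
  set δ := min δ₀ (min δ₁ (min δ₂ δ₃)) with hδ
  have hδ0 : 0 < δ := by positivity
  let φ : ContDiffBump (0 : ℂ) := ⟨δ / 2, δ, half_pos hδ0, half_lt_self hδ0⟩
  have hφ₀ : φ.rOut ≤ δ₀ := min_le_left _ _
  have hφ₁ : φ.rOut ≤ δ₁ := (min_le_right _ _).trans (min_le_left _ _)
  have hφ₂ : φ.rOut ≤ δ₂ := (min_le_right _ _).trans ((min_le_right _ _).trans (min_le_left _ _))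
  have hφ₃ : φ.rOut ≤ δ₃ := (min_le_right _ _).trans ((min_le_right _ _).trans (min_le_right _ _))
  have hs : support (mollify φ v) ⊆ Metric.cthickening δ₀ K := by
    intro z hz
    by_contra hz'
    exact hz (mollify_eq_zero φ h.eq_zero hφ₀ hz')
  refine ⟨mollify φ v, ⟨contDiff_mollify φ h.memLp.locallyIntegrable_two,
    HasCompactSupport.of_support_subset_isCompact hK.cthickening hs,
    (closure_minimal hs Metric.isClosed_cthickening).trans hδU⟩, ?_, ?_, ?_⟩
  · rw [eLpNorm_sub_comm]
    exact h₁ φ hφ₁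
  · rw [eLpNorm_sub_comm, show dz (mollify φ v) = mollify φ w from funext (dz_mollify φ h.weak_dz)]
    exact h₂ φ hφ₂
  · rw [eLpNorm_sub_comm,
      show dzbar (mollify φ v) = mollify φ w' from funext (dzbar_mollify φ h.weak_dzbar)]
    exact h₃ φ hφ₃

end SupportedSobolev

/-! ### Equality of the `L²` norms of `∂g` and `∂̄g`, and the Poincaré inequality -/

lemma contDiff_fderiv_apply {g : ℂ → ℂ} (h : ContDiff ℝ ∞ g) (e : ℂ) :
    ContDiff ℝ ∞ (fun z => fderiv ℝ g z e) :=
  (h.fderiv_right (m := ∞) (by simp)).clm_apply contDiff_const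

lemma IsTestFunction.dz {U : Set ℂ} {g : ℂ → ℂ} (h : IsTestFunction U g) :
    IsTestFunction U (dz g) := by
  have hs : support (RiemannSurfaceL21.dz g) ⊆ tsupport g := fun z hz => by
    by_contra hz'
    exact hz (h.dz_props.2 z hz')
  refine ⟨?_, h.hasCompactSupport.mono' hs,
    (closure_minimal hs (isClosed_tsupport g)).trans h.tsupport_subset⟩
  exact ((contDiff_fderiv_apply h.contDiff 1).sub
    (contDiff_const.mul (contDiff_fderiv_apply h.contDiff Complex.I))).div_const 2

lemma IsTestFunction.dzbar {U : Set ℂ} {g : ℂ → ℂ} (h : IsTestFunction U g) :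
    IsTestFunction U (dzbar g) := by
  have hs : support (RiemannSurfaceL21.dzbar g) ⊆ tsupport g := fun z hz => by
    by_contra hz'
    exact hz (h.dzbar_props.2 z hz')
  refine ⟨?_, h.hasCompactSupport.mono' hs,
    (closure_minimal hs (isClosed_tsupport g)).trans h.tsupport_subset⟩
  exact ((contDiff_fderiv_apply h.contDiff 1).add
    (contDiff_const.mul (contDiff_fderiv_apply h.contDiff Complex.I))).div_const 2

/-- Symmetry of the second derivative. -/
lemma dz_dzbar_comm {g : ℂ → ℂ} (h : ContDiff ℝ ∞ g) (z : ℂ) :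
    dz (dzbar g) z = dzbar (dz g) z := by
  have hd : ∀ e, DifferentiableAt ℝ (fun z => fderiv ℝ g z e) z := fun e =>
    (contDiff_fderiv_apply h e).differentiable (by simp) z
  have hf : DifferentiableAt ℝ (fderiv ℝ g) z :=
    (h.fderiv_right (m := ∞) (by simp)).differentiable (by simp) z
  have happ : ∀ e e', fderiv ℝ (fun z => fderiv ℝ g z e) z e' = fderiv ℝ (fderiv ℝ g) z e' e := by
    intro e e'
    rw [fderiv_clm_apply hf (differentiableAt_const e)]
    simp
  have hsymm : fderiv ℝ (fderiv ℝ g) z Complex.I 1 = fderiv ℝ (fderiv ℝ g) z 1 Complex.I :=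
    (h.contDiffAt.isSymmSndFDerivAt (by
    rw [minSmoothness_of_isRCLikeNormedField]
    exact WithTop.coe_le_coe.2 (le_top : (2 : ℕ∞) ≤ ⊤))) _ _
  have e1 : ∀ e, fderiv ℝ (dz g) z e = (fderiv ℝ (fderiv ℝ g) z e 1 -
      Complex.I * fderiv ℝ (fderiv ℝ g) z e Complex.I) / 2 := by
    intro e
    have h1 := (((hd 1).hasFDerivAt.sub ((hd Complex.I).hasFDerivAt.const_mul Complex.I)).mul_const
      (2 : ℂ)⁻¹).fderiv
    have h2 : dz g = fun z => (fderiv ℝ g z 1 - Complex.I * fderiv ℝ g z Complex.I) * 2⁻¹ := by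
      ext z
      simp [dz, div_eq_mul_inv]
    rw [h2]
    erw [h1]
    simp [happ]
    ring
  have e2 : ∀ e, fderiv ℝ (dzbar g) z e = (fderiv ℝ (fderiv ℝ g) z e 1 +
      Complex.I * fderiv ℝ (fderiv ℝ g) z e Complex.I) / 2 := by
    intro e
    have h1 := (((hd 1).hasFDerivAt.add ((hd Complex.I).hasFDerivAt.const_mul Complex.I)).mul_const
      (2 : ℂ)⁻¹).fderiv
    have h2 : dzbar g = fun z => (fderiv ℝ g z 1 + Complex.I * fderiv ℝ g z Complex.I) * 2⁻¹ := by
      ext z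
      simp [dzbar, div_eq_mul_inv]
    rw [h2]
    erw [h1]
    simp [happ]
    ring
  rw [dz, dzbar, e1, e1, e2, e2, hsymm]
  ring

lemma enorm_complex_ofReal (r : ℝ) : ‖(r : ℂ)‖ₑ = ‖r‖ₑ := by
  rw [← ofReal_norm, Complex.norm_real, ofReal_norm]

/-- Rewrites a square norm as a complex pairing, the form in which integration by parts applies. -/
lemma lintegral_enorm_sq_eq {f : ℂ → ℂ} (hf : MemLp f 2 volume) :
    ∫⁻ z, ‖f z‖ₑ ^ 2 = ‖∫ z, f z * conj (f z)‖ₑ := by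
  have e : ∀ z, f z * conj (f z) = ((‖f z‖ ^ 2 : ℝ) : ℂ) := fun z => by
    rw [Complex.mul_conj']
    push_cast
    rfl
  simp only [e]
  rw [integral_complex_ofReal, enorm_complex_ofReal, Real.enorm_of_nonneg
    (integral_nonneg fun z => by positivity), ofReal_integral_eq_lintegral_ofReal
    (by simpa using hf.integrable_norm_pow (by norm_num))
    (Filter.Eventually.of_forall fun z => by positivity)]
  refine lintegral_congr fun z => ?_
  rw [ENNReal.ofReal_pow (norm_nonneg _), ofReal_norm]

/-- For a test function, the two Wirtinger derivatives have the same `L²` norm. -/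
lemma IsTestFunction.eLpNorm_dzbar {U : Set ℂ} {g : ℂ → ℂ} (h : IsTestFunction U g) :
    eLpNorm (RiemannSurfaceL21.dzbar g) 2 volume = eLpNorm (RiemannSurfaceL21.dz g) 2 volume := by
  have hg := h.mono (subset_univ U)
  have s := hg.supportedSobolev
  -- Testing against `conj (dz g)` and `conj (dzbar g)` turns the two square norms into minus the
  -- integrals of `g` against `conj (dzbar (dz g))` and `conj (dz (dzbar g))`, which coincide.
  have a1 := s.weak_dz.integral_eq _ hg.dz.conj
  have a2 := s.weak_dzbar.integral_eq _ hg.dzbar.conj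
  simp only [Measure.restrict_univ, dz_conj (hg.dz.differentiableAt _),
    dzbar_conj (hg.dzbar.differentiableAt _)] at a1 a2
  simp only [dz_dzbar_comm h.contDiff] at a2
  rw [a1] at a2
  have a3 := neg_injective a2
  rw [← (ENNReal.pow_right_strictMono two_ne_zero).injective.eq_iff]
  simp only [eLpNorm_two_sq]
  rw [lintegral_enorm_sq_eq s.memLp_dz, lintegral_enorm_sq_eq s.memLp_dzbar, a3]

/-- The norm of `L21` sees only `∂`; this recovers `∂̄` from it. The equality for test functions
passes to the general case by their density. -/
lemma SupportedSobolev.eLpNorm_dzbar_le {K : Set ℂ} {v w w' : ℂ → ℂ}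
    (h : SupportedSobolev K v w w') (hK : IsCompact K) :
    eLpNorm w' 2 volume ≤ eLpNorm w 2 volume := by
  refine ENNReal.le_of_forall_pos_le_add fun ε hε _ => ?_
  have hε2 : (ε / 2 : ENNReal) ≠ 0 := by simp [hε.ne']
  obtain ⟨g, hg, -, h2, h3⟩ := h.exists_testFunction hK isOpen_univ (subset_univ K) hε2
  have s := hg.supportedSobolev
  calc eLpNorm w' 2 volume = eLpNorm ((w' - dzbar g) + dzbar g) 2 volume := by
        rw [sub_add_cancel]
    _ ≤ ε / 2 + eLpNorm (dzbar g) 2 volume :=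
        (eLpNorm_add_le (h.memLp_dzbar.sub s.memLp_dzbar).1 s.memLp_dzbar.1 (by norm_num)).trans
          (add_le_add_left h3 _)
    _ = ε / 2 + eLpNorm (w - (w - dz g)) 2 volume := by
        rw [hg.eLpNorm_dzbar, sub_sub_cancel]
    _ ≤ ε / 2 + (eLpNorm w 2 volume + ε / 2) := by
        gcongr
        exact (eLpNorm_sub_le h.memLp_dz.1 (h.memLp_dz.sub s.memLp_dz).1 (by norm_num)).trans
          (add_le_add_right h2 _)
    _ = eLpNorm w 2 volume + ε := by
        rw [add_left_comm, ENNReal.add_halves]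

/-- The Poincaré inequality for test functions supported in a ball. -/
lemma IsTestFunction.eLpNorm_le {a : ℂ} {R : NNReal} {U : Set ℂ} {g : ℂ → ℂ}
    (h : IsTestFunction U g) (hR : U ⊆ Metric.closedBall a R) :
    eLpNorm g 2 volume ≤ 4 * R * eLpNorm (RiemannSurfaceL21.dz g) 2 volume := by
  have hg := h.mono (subset_univ U)
  have s := hg.supportedSobolev
  set f : ℂ → ℂ := fun z => fderiv ℝ g z 1 with hf
  have hfe : f = RiemannSurfaceL21.dz g + RiemannSurfaceL21.dzbar g := by
    ext z
    simp [hf, fderiv_one_eq]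
  have hfm : MemLp f 2 volume := by
    rw [hfe]
    exact s.memLp_dz.add s.memLp_dzbar
  -- The `x`-derivative is `∂ + ∂̄`, and both terms have the same norm.
  have hf2 : eLpNorm f 2 volume ≤ 2 * eLpNorm (RiemannSurfaceL21.dz g) 2 volume := by
    rw [hfe, two_mul]
    refine (eLpNorm_add_le s.memLp_dz.1 s.memLp_dzbar.1 (by norm_num)).trans ?_
    rw [hg.eLpNorm_dzbar]
  have hG : IsTestFunction univ (fun z => g z * conj (g z)) :=
    hg.mul isOpen_univ hg.conj.contDiff.contDiffOn
  -- The function `Re (z - a)` has `x`-derivative one and is at most `R` in absolute value on the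
  -- support. Integration by parts turns the integral of `|g|²` into minus that of `Re (z - a)`
  -- times the `x`-derivative of `|g|²`.
  have hx : ContDiff ℝ ∞ (fun z : ℂ => (((z - a).re : ℝ) : ℂ)) :=
    Complex.ofRealCLM.contDiff.comp (Complex.reCLM.contDiff.comp (contDiff_id.sub contDiff_const))
  have hdx : ∀ z, fderiv ℝ (fun z : ℂ => (((z - a).re : ℝ) : ℂ)) z 1 = 1 := by
    intro z
    have h1 : HasFDerivAt (fun z : ℂ => z - a) (ContinuousLinearMap.id ℝ ℂ) z :=
      (hasFDerivAt_id z).sub_const a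
    have h2 := (Complex.ofRealCLM.hasFDerivAt.comp z (Complex.reCLM.hasFDerivAt.comp z h1)).fderiv
    change fderiv ℝ (⇑Complex.ofRealCLM ∘ ⇑Complex.reCLM ∘ fun z => z - a) z 1 = 1
    rw [h2]
    simp
  have key := (integral_mul_fderiv_test isOpen_univ hx.contDiffOn hG 1).2.2
  simp only [hdx, one_mul, Measure.restrict_univ] at key
  have hdG : ∀ z, fderiv ℝ (fun z => g z * conj (g z)) z 1 = g z * conj (f z) + conj (g z) * f z := by
    intro z
    have hc : fderiv ℝ (fun w => conj (g w)) z 1 = conj (f z) := by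
      have : fderiv ℝ (fun w => conj (g w)) z =
          (Complex.conjCLE : ℂ →L[ℝ] ℂ).comp (fderiv ℝ g z) :=
        ((Complex.conjCLE : ℂ →L[ℝ] ℂ).hasFDerivAt.comp z
          (hg.differentiableAt z).hasFDerivAt).fderiv
      rw [this]
      simp [hf]
    rw [fderiv_fun_mul (hg.differentiableAt z) (hg.conj.differentiableAt z)]
    simp only [add_apply, smul_apply, smul_eq_mul, hc]
    rfl
  have hpt : ∀ z, ‖(((z - a).re : ℝ) : ℂ) * fderiv ℝ (fun z => g z * conj (g z)) z 1‖ₑ ≤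
      2 * R * (‖g z‖ₑ * ‖f z‖ₑ) := by
    intro z
    by_cases hz : z ∈ tsupport g
    · have h1 : ‖(((z - a).re : ℝ) : ℂ)‖ₑ ≤ R := by
        rw [enorm_complex_ofReal, Real.enorm_eq_ofReal_abs]
        refine ENNReal.ofReal_le_of_le_toReal ?_
        have := hR (h.tsupport_subset hz)
        rw [Metric.mem_closedBall, dist_eq_norm] at this
        exact (Complex.abs_re_le_norm _).trans this
      have hce : ∀ x : ℂ, ‖conj x‖ₑ = ‖x‖ₑ := fun x => by
        rw [← ofReal_norm, ← ofReal_norm, RCLike.norm_conj]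
      have h2 : ‖g z * conj (f z) + conj (g z) * f z‖ₑ ≤ 2 * (‖g z‖ₑ * ‖f z‖ₑ) := by
        refine (enorm_add_le _ _).trans (le_of_eq ?_)
        rw [enorm_mul, enorm_mul, hce, hce, two_mul]
      rw [hdG, enorm_mul, mul_comm (2 : ENNReal), mul_assoc]
      exact mul_le_mul' h1 h2
    · rw [hdG, image_eq_zero_of_notMem_tsupport hz]
      simp
  have h1 : eLpNorm g 2 volume ^ 2 ≤ eLpNorm g 2 volume * (2 * R * eLpNorm f 2 volume) := by
    calc eLpNorm g 2 volume ^ 2 = ‖∫ z, g z * conj (g z)‖ₑ := by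
          rw [eLpNorm_two_sq, lintegral_enorm_sq_eq s.memLp]
      _ = ‖∫ z : ℂ, (((z - a).re : ℝ) : ℂ) * fderiv ℝ (fun z => g z * conj (g z)) z 1‖ₑ := by
          rw [key, enorm_neg]
      _ ≤ ∫⁻ z, 2 * R * (‖g z‖ₑ * ‖f z‖ₑ) :=
          (enorm_integral_le_lintegral_enorm _).trans (lintegral_mono hpt)
      _ = 2 * R * ∫⁻ z, ‖g z‖ₑ * ‖f z‖ₑ := by
          rw [lintegral_const_mul' _ _ (ENNReal.mul_ne_top (by norm_num) ENNReal.coe_ne_top)]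
      _ ≤ 2 * R * (eLpNorm g 2 volume * eLpNorm f 2 volume) := by
          gcongr
          rw [← ENNReal.pow_le_pow_left_iff (n := 2) two_ne_zero, mul_pow, eLpNorm_two_sq,
            eLpNorm_two_sq]
          exact sq_lintegral_mul_le s.memLp.1.enorm hfm.1.enorm
      _ = _ := by ring
  -- One factor `‖g‖` is cancelled, which is legitimate as it is finite and, in the nontrivial case,
  -- nonzero.
  have h2 : eLpNorm g 2 volume ≤ 2 * R * eLpNorm f 2 volume := by
    rcases eq_or_ne (eLpNorm g 2 volume) 0 with h0 | h0
    · rw [h0]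
      exact zero_le
    · rw [pow_two] at h1
      exact (ENNReal.mul_le_mul_iff_right h0 s.memLp.2.ne).1 h1
  calc eLpNorm g 2 volume ≤ 2 * R * (2 * eLpNorm (RiemannSurfaceL21.dz g) 2 volume) :=
        h2.trans (by gcongr)
    _ = _ := by ring

/-! ### Holomorphic maps in charts -/

section Charts

variable {X Y : Type*} [TopologicalSpace X] [TopologicalSpace Y]

/-- The domain of the local expression of `φ` in the charts `e` and `e'`. -/
def chartDomain (φ : X → Y) (e : OpenPartialHomeomorph X ℂ) (e' : OpenPartialHomeomorph Y ℂ) :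
    Set ℂ := e.target ∩ (fun z => φ (e.symm z)) ⁻¹' e'.source

/-- The local expression of `φ` in the charts `e` and `e'`. -/
noncomputable def chartMap (φ : X → Y) (e : OpenPartialHomeomorph X ℂ) (e' : OpenPartialHomeomorph Y ℂ)
    (z : ℂ) : ℂ := e' (φ (e.symm z))

variable {φ : X → Y} {e e₁ : OpenPartialHomeomorph X ℂ} {e' e₁' : OpenPartialHomeomorph Y ℂ}

lemma isOpen_chartDomain (hφ : Continuous φ) : IsOpen (chartDomain φ e e') :=
  (hφ.comp_continuousOn e.continuousOn_symm).isOpen_inter_preimage e.open_target e'.open_source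

lemma chartMap_mem_target {z : ℂ} (hz : z ∈ chartDomain φ e e') :
    chartMap φ e e' z ∈ e'.target := e'.map_source hz.2

lemma symm_chartMap {z : ℂ} (hz : z ∈ chartDomain φ e e') :
    e'.symm (chartMap φ e e' z) = φ (e.symm z) := e'.left_inv hz.2

lemma mem_chartDomain {x : X} (hx : x ∈ e.source) (hx' : φ x ∈ e'.source) :
    e x ∈ chartDomain φ e e' := by
  refine ⟨e.map_source hx, ?_⟩
  rwa [mem_preimage, e.left_inv hx]

lemma chartMap_id_mem {z : ℂ} (hz : z ∈ chartDomain id e e₁) :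
    chartMap id e e₁ z ∈ chartDomain id e₁ e := by
  refine ⟨chartMap_mem_target hz, ?_⟩
  rw [mem_preimage, symm_chartMap hz]
  exact e.map_target hz.1

lemma chartMap_id_chartMap_id {z : ℂ} (hz : z ∈ chartDomain id e e₁) :
    chartMap id e₁ e (chartMap id e e₁ z) = z := by
  have h : e.symm z ∈ e₁.source := hz.2
  simp [chartMap, e₁.left_inv h, e.right_inv hz.1]

lemma chartMap_id_injective_aux {y z : ℂ} (hy : y ∈ chartDomain id e e₁)
    (hz : z ∈ chartDomain id e₁ e) : chartMap id e₁ e z = y ↔ z = chartMap id e e₁ y := by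
  constructor
  · rintro rfl
    exact (chartMap_id_chartMap_id hz).symm
  · rintro rfl
    exact chartMap_id_chartMap_id hy

/-- Fibres of a coordinate change are single points, so results on fibre sums specialize to changes
of charts. -/
lemma fibreSum_chartMap_id {M : Type*} [AddCommMonoid M] (u : ℂ → M) {y : ℂ}
    (hy : y ∈ chartDomain id e e₁) :
    fibreSum (chartMap id e₁ e) (chartDomain id e₁ e) u y = u (chartMap id e e₁ y) := by
  have : chartDomain id e₁ e ∩ chartMap id e₁ e ⁻¹' {y} = {chartMap id e e₁ y} := by
    ext z
    simp only [mem_inter_iff, mem_preimage, mem_singleton_iff]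
    constructor
    · rintro ⟨h1, h2⟩
      exact (chartMap_id_injective_aux hy h1).1 h2
    · rintro rfl
      exact ⟨chartMap_id_mem hy, chartMap_id_chartMap_id hy⟩
  rw [fibreSum, this, finsum_mem_singleton]

variable [ChartedSpace ℂ X] [ChartedSpace ℂ Y] [IsManifold 𝓘(ℂ) ω X] [IsManifold 𝓘(ℂ) ω Y]

lemma differentiableOn_chartMap (hφ : MDifferentiable 𝓘(ℂ) 𝓘(ℂ) φ) (he : e ∈ atlas ℂ X)
    (he' : e' ∈ atlas ℂ Y) : DifferentiableOn ℂ (chartMap φ e e') (chartDomain φ e e') := by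
  have h1 : MDifferentiableOn 𝓘(ℂ) 𝓘(ℂ) e.symm e.target :=
    (contMDiffOn_symm_of_mem_maximalAtlas (n := ω)
      (IsManifold.subset_maximalAtlas he)).mdifferentiableOn (by simp)
  have h2 : MDifferentiableOn 𝓘(ℂ) 𝓘(ℂ) e' e'.source :=
    (contMDiffOn_of_mem_maximalAtlas (n := ω)
      (IsManifold.subset_maximalAtlas he')).mdifferentiableOn (by simp)
  have h3 : MDifferentiableOn 𝓘(ℂ) 𝓘(ℂ) (e' ∘ (φ ∘ e.symm)) (chartDomain φ e e') :=
    h2.comp ((hφ.mdifferentiableOn (s := univ)).comp (h1.mono inter_subset_left)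
      fun z _ => mem_univ _) fun z hz => hz.2
  exact mdifferentiableOn_iff_differentiableOn.1 h3

lemma hasDerivAt_chartMap (hφ : MDifferentiable 𝓘(ℂ) 𝓘(ℂ) φ) (he : e ∈ atlas ℂ X)
    (he' : e' ∈ atlas ℂ Y) {z : ℂ} (hz : z ∈ chartDomain φ e e') :
    HasDerivAt (chartMap φ e e') (deriv (chartMap φ e e') z) z :=
  ((differentiableOn_chartMap hφ he he').differentiableAt
    ((isOpen_chartDomain hφ.continuous).mem_nhds hz)).hasDerivAt

lemma deriv_chartMap_id_mul (he : e ∈ atlas ℂ X) (he₁ : e₁ ∈ atlas ℂ X) {z : ℂ}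
    (hz : z ∈ chartDomain id e e₁) :
    deriv (chartMap id e₁ e) (chartMap id e e₁ z) * deriv (chartMap id e e₁) z = 1 := by
  have h1 := hasDerivAt_chartMap mdifferentiable_id he he₁ hz
  have h2 := hasDerivAt_chartMap mdifferentiable_id he₁ he (chartMap_id_mem hz)
  have h3 := (h2.comp z h1).congr_of_eventuallyEq (f₁ := id) (by
    filter_upwards [(isOpen_chartDomain continuous_id).mem_nhds hz] with w hw
    exact (chartMap_id_chartMap_id hw).symm)
  exact h3.unique (hasDerivAt_id z)

/-- The derivatives of the local expressions in different charts differ by nonzero factors. -/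
lemma deriv_chartMap_eq (hφ : MDifferentiable 𝓘(ℂ) 𝓘(ℂ) φ) (he : e ∈ atlas ℂ X)
    (he' : e' ∈ atlas ℂ Y) (he₁ : e₁ ∈ atlas ℂ X) (he₁' : e₁' ∈ atlas ℂ Y) {x : X}
    (hx : x ∈ e.source) (hx₁ : x ∈ e₁.source) (hy : φ x ∈ e'.source) (hy₁ : φ x ∈ e₁'.source) :
    ∃ a b : ℂ, deriv (chartMap φ e e') (e x) = a * deriv (chartMap φ e₁ e₁') (e₁ x) * b := by
  have hz : e x ∈ chartDomain id e e₁ := mem_chartDomain hx hx₁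
  have hz' : e₁' (φ x) ∈ chartDomain id e₁' e' := mem_chartDomain hy₁ hy
  have hz₁ : e₁ x ∈ chartDomain φ e₁ e₁' := mem_chartDomain hx₁ hy₁
  have d1 := hasDerivAt_chartMap mdifferentiable_id he he₁ hz
  have d2 := hasDerivAt_chartMap hφ he₁ he₁' hz₁
  have d3 := hasDerivAt_chartMap mdifferentiable_id he₁' he' hz'
  have e1 : chartMap id e e₁ (e x) = e₁ x := by simp [chartMap, e.left_inv hx]
  have e2 : chartMap φ e₁ e₁' (e₁ x) = e₁' (φ x) := by simp [chartMap, e₁.left_inv hx₁]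
  rw [← e2] at d3
  have d4 := d3.comp _ d2
  rw [← e1] at d4
  have d5 := d4.comp _ d1
  have h : chartMap φ e e' =ᶠ[𝓝 (e x)]
      (chartMap id e₁' e' ∘ chartMap φ e₁ e₁') ∘ chartMap id e e₁ := by
    have o1 : IsOpen (chartDomain id e e₁) := isOpen_chartDomain continuous_id
    have o2 : IsOpen (chartDomain φ e e₁') := isOpen_chartDomain hφ.continuous
    filter_upwards [o1.mem_nhds hz, o2.mem_nhds (mem_chartDomain hx hy₁)] with w hw hw'
    have h1 : e.symm w ∈ e₁.source := hw.2
    have h2 : φ (e.symm w) ∈ e₁'.source := hw'.2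
    simp [chartMap, e₁.left_inv h1, e₁'.left_inv h2]
  exact ⟨_, _, (d5.congr_of_eventuallyEq h).deriv.trans (by rw [e1])⟩

/-- At a point where the derivative in charts does not vanish, the ramification index is one. -/
lemma ramificationIndex_eq_one (hφ : MDifferentiable 𝓘(ℂ) 𝓘(ℂ) φ) (he : e ∈ atlas ℂ X)
    (he' : e' ∈ atlas ℂ Y) {x : X} (hx : x ∈ e.source) (hy : φ x ∈ e'.source)
    (h : deriv (chartMap φ e e') (e x) ≠ 0) : ramificationIndex φ x = 1 := by
  have hc := chart_mem_atlas ℂ x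
  have hc' := chart_mem_atlas ℂ (φ x)
  obtain ⟨a, b, hab⟩ := deriv_chartMap_eq hφ he he' hc hc' hx (mem_chart_source ℂ x) hy
    (mem_chart_source ℂ (φ x))
  have hne : deriv (chartMap φ (chartAt ℂ x) (chartAt ℂ (φ x))) (chartAt ℂ x x) ≠ 0 := by
    intro h0
    rw [h0, mul_zero, zero_mul] at hab
    exact h hab
  have hmem : chartAt ℂ x x ∈ chartDomain φ (chartAt ℂ x) (chartAt ℂ (φ x)) :=
    mem_chartDomain (mem_chart_source ℂ x) (mem_chart_source ℂ (φ x))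
  have han : AnalyticAt ℂ (chartMap φ (chartAt ℂ x) (chartAt ℂ (φ x))) (chartAt ℂ x x) :=
    (differentiableOn_chartMap hφ hc hc').analyticAt
      ((isOpen_chartDomain hφ.continuous).mem_nhds hmem)
  have h1 := han.analyticOrderAt_sub_eq_one_of_deriv_ne_zero hne
  have h2 : chartMap φ (chartAt ℂ x) (chartAt ℂ (φ x)) (chartAt ℂ x x) = chartAt ℂ (φ x) (φ x) := by
    simp [chartMap]
  rw [h2] at h1
  unfold ramificationIndex analyticOrderNatAt
  change (analyticOrderAt (fun z => chartMap φ (chartAt ℂ x) (chartAt ℂ (φ x)) z -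
    chartAt ℂ (φ x) (φ x)) (chartAt ℂ x x)).toNat = 1
  rw [h1]
  rfl

/-- A holomorphic map whose fibres have at most `d` points, and whose critical points form a null
set in every chart. -/
structure BranchedMap (φ : X → Y) (d : ℕ) : Prop where
  mdifferentiable : MDifferentiable 𝓘(ℂ) 𝓘(ℂ) φ
  encard_fibre_le : ∀ y, (φ ⁻¹' {y}).encard ≤ d
  null_critical : ∀ e ∈ atlas ℂ X, ∀ e' ∈ atlas ℂ Y,
    volume {z ∈ chartDomain φ e e' | deriv (chartMap φ e e') z = 0} = 0

/-- Puts coordinate changes under the theory of branched maps with `d = 1`; a coordinate change has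
no critical point since its derivative is invertible. -/
lemma branchedMap_id : BranchedMap (id : X → X) 1 where
  mdifferentiable := mdifferentiable_id
  encard_fibre_le y := by simp
  null_critical e he e' he' := by
    convert measure_empty (μ := (volume : Measure ℂ))
    refine eq_empty_of_forall_notMem fun z hz => ?_
    have := deriv_chartMap_id_mul he he' hz.1
    rw [hz.2, mul_zero] at this
    exact zero_ne_one this

lemma BranchedMap.finiteBranched {d : ℕ} (h : BranchedMap φ d) (he : e ∈ atlas ℂ X)
    (he' : e' ∈ atlas ℂ Y) : FiniteBranched (chartMap φ e e') (chartDomain φ e e') d where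
  isOpen := isOpen_chartDomain h.mdifferentiable.continuous
  differentiableOn := differentiableOn_chartMap h.mdifferentiable he he'
  null_critical := h.null_critical e he e' he'
  encard_fibre_le y := by
    have hi : InjOn e.symm (chartDomain φ e e' ∩ chartMap φ e e' ⁻¹' {y}) :=
      e.symm.injOn.mono fun z hz => hz.1.1
    rw [← hi.encard_image]
    refine (encard_le_encard ?_).trans (h.encard_fibre_le (e'.symm y))
    rintro _ ⟨z, ⟨hz, rfl⟩, rfl⟩
    exact (symm_chartMap hz).symm

/-- The function `v` in the chart `e`, extended by zero. -/
noncomputable def chartExtend {M : Type*} [Zero M] (e : OpenPartialHomeomorph X ℂ) (v : ℂ → M) :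
    X → M := e.source.indicator (fun x => v (e x))

/-- The push-forward of a function supported in a chart, read in a chart. -/
lemma pushforward_chartExtend {d : ℕ} (h : BranchedMap φ d) (he : e ∈ atlas ℂ X)
    (he' : e' ∈ atlas ℂ Y) (v : ℂ → ℂ) : ∀ᵐ y ∂(volume.restrict e'.target),
      pushforward φ (chartExtend e v) (e'.symm y) =
        fibreSum (chartMap φ e e') (chartDomain φ e e') v y := by
  have hF := h.finiteBranched he he'
  -- For almost every `y` no point of the fibre in this chart is critical, so all its ramification
  -- indices are one.
  filter_upwards [ae_restrict_of_ae (hF.ae_fibre hF.ae_deriv_ne_zero),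
    ae_restrict_mem e'.open_target.measurableSet] with y hy hyt
  have hbij : BijOn e.symm (chartDomain φ e e' ∩ chartMap φ e e' ⁻¹' {y})
      (φ ⁻¹' {e'.symm y} ∩ e.source) := by
    refine ⟨?_, e.symm.injOn.mono fun z hz => hz.1.1, ?_⟩
    · rintro z ⟨hz, rfl⟩
      exact ⟨(symm_chartMap hz).symm, e.map_target hz.1⟩
    · rintro x ⟨hx, hxs⟩
      have hx' : φ x = e'.symm y := hx
      have hxs' : φ x ∈ e'.source := hx' ▸ e'.map_target hyt
      refine ⟨e x, ⟨mem_chartDomain hxs hxs', ?_⟩, e.left_inv hxs⟩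
      simp [chartMap, e.left_inv hxs, hx', e'.right_inv hyt]
  rw [fibreSum, finsum_mem_eq_of_bijOn (g := fun x => (ramificationIndex φ x : ℂ) *
    chartExtend e v x) _ hbij, pushforward]
  · refine finsum_mem_inter_support_eq _ _ _ ?_
    ext x
    simp only [mem_inter_iff, mem_support]
    constructor
    · rintro ⟨h1, h2⟩
      refine ⟨⟨h1, ?_⟩, h2⟩
      by_contra hx
      exact h2 (by simp [chartExtend, hx])
    · rintro ⟨⟨h1, -⟩, h2⟩
      exact ⟨h1, h2⟩
  · rintro z ⟨hz, hzy⟩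
    have h1 := hy z hz hzy
    rw [ramificationIndex_eq_one h.mdifferentiable he he' (e.map_target hz.1) hz.2
      (by rwa [e.right_inv hz.1])]
    simp [chartExtend, e.map_target hz.1, e.right_inv hz.1]

end Charts

/-! ### Integrals over a compact Riemann surface in charts -/

/-- Integrals of compositions with a finite-to-one holomorphic map. -/
lemma FiniteBranched.lintegral_comp_le {F : ℂ → ℂ} {W A B : Set ℂ} {d : ℕ}
    (hF : FiniteBranched F W d) (hA : MeasurableSet A) (hAW : A ⊆ W) (hB : MeasurableSet B)
    (hAB : ∀ z ∈ A, F z ∈ B) {h : ℂ → ENNReal} (hh : AEMeasurable h (volume.restrict B)) :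
    ∫⁻ z in A, ‖deriv F z‖ₑ ^ 2 * h (F z) ≤ d * ∫⁻ y in B, h y := by
  classical
  -- `h` is replaced by a Borel majorant, infinite on a null set that contains the exceptional
  -- points. It dominates `h` everywhere, so it may be composed with `F`, and it has the same
  -- integral over `B`.
  set N := toMeasurable (volume.restrict B) {x | h x ≠ hh.mk h x} with hN
  have hN0 : volume.restrict B N = 0 := by
    rw [hN, measure_toMeasurable]
    exact hh.ae_eq_mk
  have hNm : MeasurableSet N := measurableSet_toMeasurable _ _
  set h' : ℂ → ENNReal := N.piecewise (fun _ => ⊤) (hh.mk h) with hh'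
  have hm : Measurable h' := Measurable.piecewise hNm measurable_const hh.measurable_mk
  have hle : ∀ x, h x ≤ h' x := by
    intro x
    by_cases hx : x ∈ N
    · simp [hh', hx]
    · have : h x = hh.mk h x := by
        by_contra hne
        exact hx (subset_toMeasurable _ _ hne)
      simp [hh', hx, this]
  have hint : ∫⁻ y in B, h' y = ∫⁻ y in B, h y := by
    refine lintegral_congr_ae ?_
    filter_upwards [measure_eq_zero_iff_ae_notMem.1 hN0, hh.ae_eq_mk] with y hy hy'
    simp [hh', hy, hy']
  have hFm : AEMeasurable (fun z => h' (F z)) (volume.restrict W) :=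
    hm.comp_aemeasurable (hF.differentiableOn.continuousOn.aemeasurable hF.isOpen.measurableSet)
  have hAm : Measurable (A.indicator (1 : ℂ → ENNReal)) := measurable_one.indicator hA
  calc ∫⁻ z in A, ‖deriv F z‖ₑ ^ 2 * h (F z) ≤ ∫⁻ z in A, ‖deriv F z‖ₑ ^ 2 * h' (F z) :=
        lintegral_mono fun z => by gcongr; exact hle _
    _ = ∫⁻ z in W, ‖deriv F z‖ₑ ^ 2 * (A.indicator 1 z * h' (F z)) := by
        rw [← inter_eq_left.2 hAW, ← setLIntegral_indicator hA]
        refine lintegral_congr fun z => ?_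
        by_cases hz : z ∈ A <;> simp [hz, inter_eq_left.2 hAW]
    -- The area formula for `1_A · h' ∘ F`: the fibre sum of `1_A` counts at most `d` points, and
    -- none when `y` is outside `B`.
    _ = ∫⁻ y, fibreSum F W (A.indicator 1) y * h' y := by
        refine (hF.lintegral_fibreSum (hAm.aemeasurable.mul hFm)).symm.trans ?_
        exact lintegral_congr fun y => hF.fibreSum_mul_ennreal _ _ y
    _ ≤ ∫⁻ y, B.indicator (fun y => d * h' y) y := by
        refine lintegral_mono fun y => ?_
        by_cases hy : y ∈ B
        · rw [indicator_of_mem hy]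
          gcongr
          refine le_trans ?_ (hF.fibreSum_one_le y)
          rw [hF.fibreSum_eq, hF.fibreSum_eq]
          exact Finset.sum_le_sum fun z _ => indicator_le_self' (fun _ _ => zero_le_one) z
        · rw [hF.fibreSum_eq, Finset.sum_eq_zero, zero_mul]
          · exact zero_le
          · intro z hz
            rw [Set.Finite.mem_toFinset] at hz
            refine indicator_of_notMem (fun hzA => hy ?_) _
            have := hAB z hzA
            rwa [show F z = y from hz.2] at this
    _ = d * ∫⁻ y in B, h y := by
        rw [lintegral_indicator hB, lintegral_const_mul _ hm, hint]

lemma measurableSet_inter_preimage_of_continuousOn {α β : Type*} [TopologicalSpace α]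
    [MeasurableSpace α] [BorelSpace α] [TopologicalSpace β] [MeasurableSpace β] [BorelSpace β]
    {f : α → β} {s : Set α} (hs : MeasurableSet s) (hf : ContinuousOn f s) {t : Set β}
    (ht : MeasurableSet t) : MeasurableSet (s ∩ f ⁻¹' t) := by
  have h2 := hs.subtype_image (hf.domRestrict.measurable ht)
  convert h2 using 1
  ext z
  simp [and_comm]

section Measure

variable {X : Type*} [TopologicalSpace X] [ChartedSpace ℂ X] [MeasurableSpace X] [CompactSpace X]
  [T2Space X] [BorelSpace X] (ν : VolumeForm X)

namespace VolumeForm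

/-- The part of the measure of `ν` that is carried by the `i`-th piece. -/
noncomputable def pieceMeasure (i : Fin (chartPartition X).n) : Measure X :=
  ((volume.restrict ((chartPartition X).image i)).withDensity
    (fun z => ENNReal.ofReal (ν.coeff ((chartPartition X).chart i) z))).map
      ((chartPartition X).chart i).symm

lemma measure_eq_sum : ν.measure = ∑ i, ν.pieceMeasure i := rfl

/-- A converse to `VolumeForm.ae_chart`, for one piece. The exceptional set is enlarged to a Borel
set, made of the complement of the source and the preimage of a null Borel set, so that the image
measure can be evaluated on it. -/
lemma ae_pieceMeasure {p : X → Prop} (i : Fin (chartPartition X).n)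
    (hp : ∀ᵐ z ∂(volume.restrict ((chartPartition X).chart i).target),
      p (((chartPartition X).chart i).symm z)) : ∀ᵐ x ∂ν.pieceMeasure i, p x := by
  set c := (chartPartition X).chart i with hc
  rw [ae_restrict_iff' c.open_target.measurableSet, ae_iff] at hp
  set N := toMeasurable volume {z | ¬ (z ∈ c.target → p (c.symm z))} with hN
  have hNm : MeasurableSet N := measurableSet_toMeasurable _ _
  have hS : MeasurableSet (c.sourceᶜ ∪ c.source ∩ c ⁻¹' N) :=
    c.open_source.measurableSet.compl.union
      (measurableSet_inter_preimage_of_continuousOn c.open_source.measurableSet c.continuousOn hNm)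
  have hsub : {x | ¬ p x} ⊆ c.sourceᶜ ∪ c.source ∩ c ⁻¹' N := by
    intro x hx
    by_cases hxs : x ∈ c.source
    · refine Or.inr ⟨hxs, subset_toMeasurable _ _ ?_⟩
      simp only [mem_ofPred_eq, Classical.not_imp]
      exact ⟨c.map_source hxs, by rwa [c.left_inv hxs]⟩
    · exact Or.inl hxs
  rw [ae_iff]
  refine measure_mono_null hsub ?_
  rw [pieceMeasure, Measure.map_apply_of_aemeasurable (ν.aemeasurable_symm i) hS]
  refine withDensity_absolutelyContinuous _ _ ?_
  rw [Measure.restrict_apply' ((chartPartition X).measurableSet_image i)]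
  refine measure_mono_null (t := N) ?_ (by rw [hN, measure_toMeasurable, hp])
  rintro z ⟨hz, hzi⟩
  have hzt : z ∈ c.target := (chartPartition X).image_subset_target i hzi
  rcases hz with hz | hz
  · exact absurd (c.map_target hzt) hz
  · have h2 : c (c.symm z) ∈ N := hz.2
    rwa [c.right_inv hzt] at h2

lemma aestronglyMeasurable_of_chart {u : X → ℂ}
    (hu : ∀ e ∈ atlas ℂ X,
      AEStronglyMeasurable (fun z => u (e.symm z)) (volume.restrict e.target)) :
    AEStronglyMeasurable u ν.measure := by
  classical
  rw [measure_eq_sum, ← Measure.sum_fintype, aestronglyMeasurable_sum_measure_iff]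
  intro i
  have h := hu _ ((chartPartition X).chart_mem i)
  set c := (chartPartition X).chart i with hc
  set g := h.mk _ with hg
  have hgm : Measurable g := h.stronglyMeasurable_mk.measurable
  -- Extending the chart by zero off its source gives a Borel map on all of `X`.
  have hcm : Measurable (c.source.piecewise c 0) :=
    c.continuousOn.measurable_piecewise continuousOn_const c.open_source.measurableSet
  refine AEStronglyMeasurable.congr
    (f := c.source.indicator fun x => g (c.source.piecewise c 0 x)) ?_ ?_
  · exact ((hgm.comp hcm).indicator c.open_source.measurableSet).aestronglyMeasurable
  · refine ν.ae_pieceMeasure i ?_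
    filter_upwards [h.ae_eq_mk, ae_restrict_mem c.open_target.measurableSet] with z hz hzt
    rw [indicator_of_mem (c.map_target hzt), piecewise_eq_of_mem _ _ _ (c.map_target hzt),
      c.right_inv hzt, hz]

lemma lintegral_measure {g : X → ENNReal} (hg : AEMeasurable g ν.measure) :
    ∫⁻ x, g x ∂ν.measure = ∑ i, ∫⁻ z in (chartPartition X).image i,
      ENNReal.ofReal (ν.coeff ((chartPartition X).chart i) z) *
        g (((chartPartition X).chart i).symm z) := by
  rw [measure_eq_sum, lintegral_finsetSum_measure]
  refine Finset.sum_congr rfl fun i _ => ?_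
  have hle : ν.pieceMeasure i ≤ ν.measure := by
    rw [measure_eq_sum]
    exact Finset.single_le_sum (f := ν.pieceMeasure) (fun _ _ => Measure.zero_le _)
      (Finset.mem_univ i)
  have hg' : AEMeasurable g (ν.pieceMeasure i) := hg.mono_measure hle
  rw [pieceMeasure] at hg' ⊢
  rw [lintegral_map' hg' (ν.aemeasurable_symm i)]
  have hg2 := hg'.comp_aemeasurable (ν.aemeasurable_symm i)
  exact lintegral_withDensity_eq_lintegral_mul₀' (ν.aemeasurable_coeff i) hg2

end VolumeForm

end Measure

/-! ### The norm of `L²₁(X)` in charts -/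

section Norm

variable {X : Type*} [TopologicalSpace X] [T2Space X] [CompactSpace X] [ChartedSpace ℂ X]
  [MeasurableSpace X] [BorelSpace X]

/-- The part of the chart `e` that lies in the `i`-th piece. -/
def chartPiece (e : OpenPartialHomeomorph X ℂ) (i : Fin (chartPartition X).n) : Set ℂ :=
  e.target ∩ e.symm ⁻¹' (chartPartition X).piece i

lemma measurableSet_chartPiece (e : OpenPartialHomeomorph X ℂ) (i : Fin (chartPartition X).n) :
    MeasurableSet (chartPiece e i) :=
  measurableSet_inter_preimage_of_continuousOn e.open_target.measurableSet e.continuousOn_symm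
    ((chartPartition X).measurableSet_piece i)

lemma chartPiece_subset (e : OpenPartialHomeomorph X ℂ) (i : Fin (chartPartition X).n) :
    chartPiece e i ⊆ chartDomain id e ((chartPartition X).chart i) :=
  fun _ hz => ⟨hz.1, (chartPartition X).closure_subset i (subset_closure hz.2)⟩

lemma chartMap_mem_image {e : OpenPartialHomeomorph X ℂ} {i : Fin (chartPartition X).n} {z : ℂ}
    (hz : z ∈ chartPiece e i) :
    chartMap id e ((chartPartition X).chart i) z ∈ (chartPartition X).image i := by
  refine ⟨chartMap_mem_target (chartPiece_subset e i hz), ?_⟩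
  rw [mem_preimage, symm_chartMap (chartPiece_subset e i hz)]
  exact hz.2

lemma target_eq_iUnion_chartPiece (e : OpenPartialHomeomorph X ℂ) :
    e.target = ⋃ i, chartPiece e i := by
  simp only [chartPiece]
  rw [← inter_iUnion, ← preimage_iUnion, (chartPartition X).iUnion_piece, preimage_univ, inter_univ]

lemma setLIntegral_target_le (e : OpenPartialHomeomorph X ℂ) (h : ℂ → ENNReal) :
    ∫⁻ z in e.target, h z ≤ ∑ i, ∫⁻ z in chartPiece e i, h z := by
  conv_lhs => rw [target_eq_iUnion_chartPiece]
  refine (lintegral_iUnion_le _ _).trans (le_of_eq ?_)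
  rw [tsum_fintype]

variable [IsManifold 𝓘(ℂ) ω X] {ν : VolumeForm X}

namespace L21

/-- In this form, with integrals valued in `[0, ∞]`, the norm can be estimated piece by piece
without integrability conditions. -/
lemma enorm_sq (f : L21 ν) : ‖f‖ₑ ^ 2 = ∫⁻ x, ‖toLp f x‖ₑ ^ 2 ∂ν.measure +
    ∑ i, ∫⁻ z in (chartPartition X).image i,
      2 * ‖weakDz (toLp f) ((chartPartition X).chart i) z‖ₑ ^ 2 := by
  have h1 : ‖f‖ ^ 2 = ‖toLp f‖ ^ 2 + (dirichletPairing (toLp f : X → ℂ) (toLp f)).re := by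
    rw [← inner_self_eq_norm_sq (𝕜 := ℂ) f, ← inner_self_eq_norm_sq (𝕜 := ℂ) (toLp f)]
    exact map_add (RCLike.re : ℂ →+ ℝ) _ _
  have h2 : ‖toLp f‖ₑ ^ 2 = ∫⁻ x, ‖toLp f x‖ₑ ^ 2 ∂ν.measure := by
    rw [← eLpNorm_two_sq, Lp.enorm_def]
  have e : ∀ (c : OpenPartialHomeomorph X ℂ) z, (2 * (weakDz (toLp f) c z *
      conj (weakDz (toLp f) c z)) : ℂ) = ((2 * ‖weakDz (toLp f) c z‖ ^ 2 : ℝ) : ℂ) := by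
    intro c z
    rw [Complex.mul_conj']
    push_cast
    ring
  have h3 : ENNReal.ofReal (dirichletPairing (toLp f : X → ℂ) (toLp f)).re =
      ∑ i, ∫⁻ z in (chartPartition X).image i,
        2 * ‖weakDz (toLp f) ((chartPartition X).chart i) z‖ₑ ^ 2 := by
    simp only [dirichletPairing, ChartPartition.integral, Complex.re_sum, e, integral_complex_ofReal,
      Complex.ofReal_re]
    rw [ENNReal.ofReal_sum_of_nonneg fun i _ => integral_nonneg fun z => by positivity]
    refine Finset.sum_congr rfl fun i _ => ?_
    have hi := (integrableOn_dirichlet f f i).re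
    simp only [e, RCLike.re_to_complex, Complex.ofReal_re] at hi
    rw [ofReal_integral_eq_lintegral_ofReal hi
      (Filter.Eventually.of_forall fun z => by positivity)]
    refine lintegral_congr fun z => ?_
    rw [ENNReal.ofReal_mul (by norm_num), ENNReal.ofReal_pow (norm_nonneg _), ofReal_norm]
    simp
  rw [← h2, ← h3, ← ofReal_norm, ← ENNReal.ofReal_pow (norm_nonneg _), h1, ENNReal.ofReal_add
    (by positivity) (dirichlet_nonneg f), ENNReal.ofReal_pow (norm_nonneg _), ofReal_norm]

lemma aestronglyMeasurable_chart (f : L21 ν) {e : OpenPartialHomeomorph X ℂ}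
    (he : e ∈ atlas ℂ X) :
    AEStronglyMeasurable (fun z => toLp f (e.symm z)) (volume.restrict e.target) :=
  (f.weakDz_spec he).1.locInt_fun.aestronglyMeasurable

lemma aestronglyMeasurable_weakDz (f : L21 ν) {e : OpenPartialHomeomorph X ℂ}
    (he : e ∈ atlas ℂ X) :
    AEStronglyMeasurable (weakDz (toLp f) e) (volume.restrict e.target) :=
  (f.weakDz_spec he).1.locInt_deriv.aestronglyMeasurable

/-- The chain rule for the weak derivative under a change of charts. -/
lemma weakDz_chartMap (f : L21 ν) {e e₁ : OpenPartialHomeomorph X ℂ} (he : e ∈ atlas ℂ X)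
    (he₁ : e₁ ∈ atlas ℂ X) : ∀ᵐ z ∂(volume.restrict (chartDomain id e e₁)),
      weakDz (toLp f) e z =
        weakDz (toLp f) e₁ (chartMap id e e₁ z) * deriv (chartMap id e e₁) z := by
  have hV : IsOpen (chartDomain id e e₁) := isOpen_chartDomain continuous_id
  have hG := branchedMap_id.finiteBranched he₁ he
  have hF := branchedMap_id.finiteBranched he he₁
  have h1 : IsWeakDeriv dz (chartDomain id e₁ e) (fun z => toLp f (e₁.symm z))
      (weakDz (toLp f) e₁) :=
    (f.weakDz_spec he₁).1.mono (fun ψ hψ z hz => hψ.dz_eq_zero hz) inter_subset_left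
  -- The chain rule is the push-forward of the weak derivative along the inverse coordinate change;
  -- properness holds because that map is a homeomorphism.
  have h2 := hG.isWeakDeriv_dz_fibreSum (S := univ) hV h1 (by simp) (by simp) (by
    intro K hK hKc
    refine ⟨chartMap id e e₁ '' K, ?_, hKc.image_of_continuousOn
      (hF.differentiableOn.continuousOn.mono hK), ?_⟩
    · rintro _ ⟨z, hz, rfl⟩
      exact chartMap_id_mem (hK hz)
    · intro z hz _ hzK
      exact ⟨_, hzK, chartMap_id_chartMap_id hz⟩)
  have h3 : IsWeakDeriv dz (chartDomain id e e₁) (fun z => toLp f (e.symm z))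
      (weakDz (toLp f) e) :=
    (f.weakDz_spec he).1.mono (fun ψ hψ z hz => hψ.dz_eq_zero hz) inter_subset_left
  have h4 := h3.unique hV h2 (by
    filter_upwards [ae_restrict_mem hV.measurableSet] with z hz
    rw [fibreSum_chartMap_id _ hz, symm_chartMap hz, id])
  filter_upwards [h4, ae_restrict_mem hV.measurableSet] with z hz hzV
  rw [hz, fibreSum_chartMap_id _ hzV, div_eq_iff, mul_assoc, mul_comm (deriv _ _),
    deriv_chartMap_id_mul he he₁ hzV, mul_one]
  exact left_ne_zero_of_mul_eq_one (deriv_chartMap_id_mul he he₁ hzV)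

/-- Conformal invariance of the Dirichlet integral. The norm is defined with the charts of one fixed
partition; here any chart of the atlas is allowed, with constant one. -/
lemma lintegral_weakDz_le (f : L21 ν) {e : OpenPartialHomeomorph X ℂ} (he : e ∈ atlas ℂ X) :
    ∫⁻ z in e.target, ‖weakDz (toLp f) e z‖ₑ ^ 2 ≤ ‖f‖ₑ ^ 2 := by
  refine (setLIntegral_target_le e _).trans ?_
  rw [enorm_sq]
  refine le_trans (Finset.sum_le_sum fun i _ => ?_) le_add_self
  have hc := (chartPartition X).chart_mem i
  calc ∫⁻ z in chartPiece e i, ‖weakDz (toLp f) e z‖ₑ ^ 2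
      = ∫⁻ z in chartPiece e i, ‖deriv (chartMap id e ((chartPartition X).chart i)) z‖ₑ ^ 2 *
          ‖weakDz (toLp f) ((chartPartition X).chart i)
            (chartMap id e ((chartPartition X).chart i) z)‖ₑ ^ 2 := by
        refine lintegral_congr_ae ?_
        filter_upwards [ae_restrict_of_ae_restrict_of_subset (chartPiece_subset e i)
          (f.weakDz_chartMap he hc)] with z hz
        rw [hz, enorm_mul, mul_pow, mul_comm]
    _ ≤ (1 : ℕ) * ∫⁻ z in (chartPartition X).image i,
          ‖weakDz (toLp f) ((chartPartition X).chart i) z‖ₑ ^ 2 := by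
        refine (branchedMap_id.finiteBranched he hc).lintegral_comp_le
          (h := fun z => ‖weakDz (toLp f) ((chartPartition X).chart i) z‖ₑ ^ 2)
          (measurableSet_chartPiece e i) (chartPiece_subset e i)
          ((chartPartition X).measurableSet_image i) (fun z hz => chartMap_mem_image hz) ?_
        exact (((f.aestronglyMeasurable_weakDz hc).mono_measure (Measure.restrict_mono
          ((chartPartition X).image_subset_target i) le_rfl)).enorm.pow_const 2)
    _ ≤ _ := by
        rw [Nat.cast_one, one_mul]
        exact lintegral_mono fun z => le_mul_of_one_le_left zero_le (by norm_num)

/-- On a compact set the density of `ν` has a positive lower bound `m`, and `m⁻¹` serves as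
constant. The compatibility of the coefficients supplies the Jacobian needed to pass to the charts
of the partition. -/
lemma exists_lintegral_chart_le (ν : VolumeForm X) {e : OpenPartialHomeomorph X ℂ}
    (he : e ∈ atlas ℂ X) {K : Set ℂ} (hK : IsCompact K) (hKe : K ⊆ e.target) :
    ∃ C : NNReal, ∀ f : L21 ν, ∫⁻ z in K, ‖toLp f (e.symm z)‖ₑ ^ 2 ≤ C * ‖f‖ₑ ^ 2 := by
  obtain ⟨m, hm, hmK⟩ : ∃ m : NNReal, 0 < m ∧ ∀ z ∈ K, (m : ℝ) ≤ ν.coeff e z := by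
    rcases K.eq_empty_or_nonempty with rfl | hne
    · exact ⟨1, one_pos, by simp⟩
    · obtain ⟨z₀, hz₀, hmin⟩ := hK.exists_isMinOn hne ((ν.continuousOn_coeff e he).mono hKe)
      have hpos := ν.coeff_pos e he z₀ (hKe hz₀)
      exact ⟨⟨ν.coeff e z₀, hpos.le⟩, hpos, fun z hz => hmin hz⟩
  refine ⟨m⁻¹, fun f => ?_⟩
  have h1 : ∫⁻ z in K, ‖toLp f (e.symm z)‖ₑ ^ 2 ≤
      (m⁻¹ : NNReal) * ∫⁻ z in e.target, ENNReal.ofReal (ν.coeff e z) *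
        ‖toLp f (e.symm z)‖ₑ ^ 2 := by
    rw [← lintegral_const_mul' _ _ ENNReal.coe_ne_top]
    refine le_trans (setLIntegral_mono_ae' hK.measurableSet
      (Filter.Eventually.of_forall fun z hz => ?_)) (lintegral_mono_set hKe)
    rw [← mul_assoc]
    refine le_mul_of_one_le_left zero_le ?_
    rw [ENNReal.coe_inv hm.ne', mul_comm, ← div_eq_mul_inv, ENNReal.le_div_iff_mul_le
      (Or.inl (by simpa using hm.ne')) (Or.inl ENNReal.coe_ne_top), one_mul]
    exact ENNReal.le_ofReal_iff_toReal_le ENNReal.coe_ne_top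
      ((ν.coeff_pos e he z (hKe hz)).le) |>.2 (by simpa using hmK z hz)
  refine h1.trans ?_
  gcongr
  refine (setLIntegral_target_le e _).trans ?_
  rw [enorm_sq, ν.lintegral_measure ((Lp.aestronglyMeasurable _).enorm.pow_const 2)]
  refine le_trans (Finset.sum_le_sum fun i _ => ?_) le_self_add
  have hc := (chartPartition X).chart_mem i
  calc ∫⁻ z in chartPiece e i, ENNReal.ofReal (ν.coeff e z) * ‖toLp f (e.symm z)‖ₑ ^ 2
      = ∫⁻ z in chartPiece e i, ‖deriv (chartMap id e ((chartPartition X).chart i)) z‖ₑ ^ 2 *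
          (ENNReal.ofReal (ν.coeff ((chartPartition X).chart i)
              (chartMap id e ((chartPartition X).chart i) z)) *
            ‖toLp f (((chartPartition X).chart i).symm
              (chartMap id e ((chartPartition X).chart i) z))‖ₑ ^ 2) := by
        refine setLIntegral_congr_fun (measurableSet_chartPiece e i) fun z hz => ?_
        have hz' := chartPiece_subset e i hz
        simp only [symm_chartMap hz', id]
        rw [ν.coeff_compat e he _ hc z hz.1 hz'.2, ENNReal.ofReal_mul (by positivity),
          ENNReal.ofReal_pow (norm_nonneg _), ofReal_norm, mul_assoc]
        rfl
    _ ≤ (1 : ℕ) * ∫⁻ z in (chartPartition X).image i,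
          (ENNReal.ofReal (ν.coeff ((chartPartition X).chart i) z) *
            ‖toLp f (((chartPartition X).chart i).symm z)‖ₑ ^ 2) := by
        refine (branchedMap_id.finiteBranched he hc).lintegral_comp_le
          (h := fun z => ENNReal.ofReal (ν.coeff ((chartPartition X).chart i) z) *
            ‖toLp f (((chartPartition X).chart i).symm z)‖ₑ ^ 2)
          (measurableSet_chartPiece e i) (chartPiece_subset e i)
          ((chartPartition X).measurableSet_image i) (fun z hz => chartMap_mem_image hz) ?_
        exact (ν.aemeasurable_coeff i).mul (((f.aestronglyMeasurable_chart hc).mono_measure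
          (Measure.restrict_mono ((chartPartition X).image_subset_target i)
            le_rfl)).enorm.pow_const 2)
    _ = _ := by
        rw [Nat.cast_one, one_mul]

end L21

end Norm

/-! ### Push-forward of Sobolev functions supported in a chart -/

lemma memLp_two_of_lintegral_lt_top {α : Type*} [MeasurableSpace α] {μ : Measure α} {f : α → ℂ}
    (hf : AEStronglyMeasurable f μ) (h : ∫⁻ x, ‖f x‖ₑ ^ 2 ∂μ < ⊤) : MemLp f 2 μ := by
  refine ⟨hf, ?_⟩
  rw [← eLpNorm_two_sq] at h
  exact (ENNReal.pow_lt_top_iff).1 h |>.resolve_right two_ne_zero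

lemma _root_.MeasureTheory.MemLp.lintegral_lt_top_two {α : Type*} [MeasurableSpace α]
    {μ : Measure α} {f : α → ℂ} (hf : MemLp f 2 μ) : ∫⁻ x, ‖f x‖ₑ ^ 2 ∂μ < ⊤ := by
  rw [← eLpNorm_two_sq]
  exact ENNReal.pow_lt_top hf.2

lemma FiniteBranched.aestronglyMeasurable_div {F : ℂ → ℂ} {W : Set ℂ} {d : ℕ}
    (hF : FiniteBranched F W d) {w : ℂ → ℂ} (hw : AEStronglyMeasurable w (volume.restrict W)) :
    AEStronglyMeasurable (fun z => w z / deriv F z) (volume.restrict W) :=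
  (hw.aemeasurable.div (hF.differentiableOn_deriv.continuousOn.aemeasurable
    hF.isOpen.measurableSet)).aestronglyMeasurable

/-- The weight `|F'|²` of the area formula cancels the denominator of `|w / F'|²` almost everywhere,
so critical points cost nothing. -/
lemma FiniteBranched.lintegral_fibreSum_div_le {F : ℂ → ℂ} {W : Set ℂ} {d : ℕ}
    (hF : FiniteBranched F W d) {w : ℂ → ℂ} (hw : AEStronglyMeasurable w (volume.restrict W)) :
    ∫⁻ y, ‖fibreSum F W (fun z => w z / deriv F z) y‖ₑ ^ 2 ≤ d * ∫⁻ z in W, ‖w z‖ₑ ^ 2 := by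
  have hm := hF.aestronglyMeasurable_div hw
  calc ∫⁻ y, ‖fibreSum F W (fun z => w z / deriv F z) y‖ₑ ^ 2
      ≤ ∫⁻ y, d * fibreSum F W (fun z => ‖w z / deriv F z‖ₑ ^ 2) y :=
        lintegral_mono fun y => hF.enorm_fibreSum_sq_le _ y
    _ = d * ∫⁻ z in W, ‖deriv F z‖ₑ ^ 2 * ‖w z / deriv F z‖ₑ ^ 2 := by
        rw [lintegral_const_mul' _ _ (ENNReal.natCast_ne_top d),
          hF.lintegral_fibreSum (hm.enorm.pow_const 2)]
    _ = d * ∫⁻ z in W, ‖w z‖ₑ ^ 2 := by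
        congr 1
        refine lintegral_congr_ae ?_
        filter_upwards [hF.ae_deriv_ne_zero] with z hz
        rw [← mul_pow, ← enorm_mul, mul_div_cancel₀ _ hz]

/-- The restriction of a continuous map to a compact set is proper: `L` consists of the points of
`K` whose image lies in the compact, hence closed, subset of `Y` with coordinates in `K'`. -/
lemma exists_compact_chartDomain {X Y : Type*} [TopologicalSpace X] [TopologicalSpace Y] [T2Space Y]
    {φ : X → Y} {e : OpenPartialHomeomorph X ℂ} {e' : OpenPartialHomeomorph Y ℂ} (hφ : Continuous φ) {K K' : Set ℂ} (hK : IsCompact K)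
    (hKe : K ⊆ e.target) (hK' : IsCompact K') (hKe' : K' ⊆ e'.target) :
    ∃ L ⊆ chartDomain φ e e', IsCompact L ∧
      ∀ z ∈ chartDomain φ e e', z ∈ K → chartMap φ e e' z ∈ K' → z ∈ L := by
  have hS : IsClosed (e'.symm '' K') :=
    (hK'.image_of_continuousOn (e'.continuousOn_symm.mono hKe')).isClosed
  refine ⟨K ∩ (fun z => φ (e.symm z)) ⁻¹' (e'.symm '' K'), ?_, ?_, ?_⟩
  · rintro z ⟨hz, y, hy, hyz⟩
    refine ⟨hKe hz, ?_⟩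
    have hyz' : e'.symm y = φ (e.symm z) := hyz
    change φ (e.symm z) ∈ e'.source
    rw [← hyz']
    exact e'.map_target (hKe' hy)
  · exact hK.of_isClosed_subset ((hφ.comp_continuousOn
      (e.continuousOn_symm.mono hKe)).preimage_isClosed_of_isClosed hK.isClosed hS)
      inter_subset_left
  · intro z hz hzK hzK'
    exact ⟨hzK, _, hzK', symm_chartMap hz⟩

section Push

variable {X Y : Type*} [TopologicalSpace X] [ChartedSpace ℂ X] [IsManifold 𝓘(ℂ) ω X]
  [TopologicalSpace Y] [ChartedSpace ℂ Y] [IsManifold 𝓘(ℂ) ω Y] [T2Space Y]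
  {φ : X → Y} {d : ℕ} {e : OpenPartialHomeomorph X ℂ} {e' : OpenPartialHomeomorph Y ℂ}

namespace BranchedMap

/-- Without a division by `F'` the weight `|F'|²` of the area formula stays, and is bounded on the
compact set of points of `K` lying over `K'`. -/
lemma exists_lintegral_fibreSum_le (h : BranchedMap φ d) (he : e ∈ atlas ℂ X)
    (he' : e' ∈ atlas ℂ Y) {K K' : Set ℂ} (hK : IsCompact K)
    (hKe : K ⊆ e.target) (hK' : IsCompact K') (hKe' : K' ⊆ e'.target) :
    ∃ C : NNReal, ∀ v : ℂ → ℂ, AEStronglyMeasurable v volume → (∀ z ∉ K, v z = 0) →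
      ∫⁻ y in K', ‖fibreSum (chartMap φ e e') (chartDomain φ e e') v y‖ₑ ^ 2 ≤
        C * ∫⁻ z, ‖v z‖ₑ ^ 2 := by
  have hF := h.finiteBranched he he'
  obtain ⟨L, hLW, hL, hKL⟩ := exists_compact_chartDomain h.mdifferentiable.continuous hK hKe hK' hKe'
  obtain ⟨B, hB⟩ := hL.exists_bound_of_continuousOn
    (hF.differentiableOn_deriv.continuousOn.mono hLW)
  refine ⟨d * (B.toNNReal) ^ 2, fun v hv hvK => ?_⟩
  set F := chartMap φ e e' with hFd
  set W := chartDomain φ e e' with hWd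
  have hvm : AEMeasurable (fun z => ‖v z‖ₑ ^ 2) (volume.restrict W) :=
    (hv.mono_measure Measure.restrict_le_self).enorm.pow_const 2
  have hFm : AEMeasurable (fun z => K'.indicator (1 : ℂ → ENNReal) (F z)) (volume.restrict W) :=
    (measurable_one.indicator hK'.measurableSet).comp_aemeasurable
      (hF.differentiableOn.continuousOn.aemeasurable hF.isOpen.measurableSet)
  calc ∫⁻ y in K', ‖fibreSum F W v y‖ₑ ^ 2
      ≤ ∫⁻ y in K', d * fibreSum F W (fun z => ‖v z‖ₑ ^ 2) y :=
        lintegral_mono fun y => hF.enorm_fibreSum_sq_le _ y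
    _ = d * ∫⁻ y, fibreSum F W (fun z => ‖v z‖ₑ ^ 2 * K'.indicator 1 (F z)) y := by
        rw [lintegral_const_mul' _ _ (ENNReal.natCast_ne_top d),
          ← lintegral_indicator hK'.measurableSet]
        congr 1
        refine lintegral_congr fun y => ?_
        rw [hF.fibreSum_mul_ennreal]
        by_cases hy : y ∈ K' <;> simp [hy]
    _ = d * ∫⁻ z in W, ‖deriv F z‖ₑ ^ 2 * (‖v z‖ₑ ^ 2 * K'.indicator 1 (F z)) := by
        congr 1
        exact hF.lintegral_fibreSum (hvm.mul hFm)
    _ ≤ d * ∫⁻ z in W, (B.toNNReal : ENNReal) ^ 2 * ‖v z‖ₑ ^ 2 := by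
        gcongr 1
        refine setLIntegral_mono_ae' hF.isOpen.measurableSet
          (Filter.Eventually.of_forall fun z hz => ?_)
        by_cases hzK : z ∈ K
        · by_cases hzK' : F z ∈ K'
          · have := hB z (hKL z hz hzK hzK')
            rw [indicator_of_mem hzK', Pi.one_apply, mul_one]
            gcongr
            rw [← ofReal_norm]
            exact ENNReal.ofReal_le_ofReal this
          · simp [hzK']
        · simp [hvK z hzK]
    _ ≤ d * ((B.toNNReal : ENNReal) ^ 2 * ∫⁻ z, ‖v z‖ₑ ^ 2) := by
        rw [lintegral_const_mul' _ _ (by simp)]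
        gcongr
        exact Measure.restrict_le_self
    _ = _ := by
        push_cast
        rw [mul_assoc]

variable [CompactSpace Y] [MeasurableSpace Y] [BorelSpace Y]

/-- The push-forward of a Sobolev function supported in a chart of `X` belongs to `L²₁(Y)`, and
its norm is controlled by the Sobolev norm in the chart. -/
theorem exists_push (h : BranchedMap φ d) (ν : VolumeForm Y) (he : e ∈ atlas ℂ X) {K : Set ℂ}
    (hK : IsCompact K) (hKe : K ⊆ e.target) :
    ∃ C : NNReal, ∀ v w w', SupportedSobolev K v w w' → ∃ P : L21 ν,
      L21.toLp P =ᵐ[ν.measure] pushforward φ (chartExtend e v) ∧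
      ‖P‖ₑ ≤ C * (eLpNorm v 2 volume + eLpNorm w 2 volume) := by
  have hc := (chartPartition Y).chart_mem
  choose K' hK' hKt hiK using (chartPartition Y).exists_compact
  choose C₁ hC₁ using fun i => h.exists_lintegral_fibreSum_le he (hc i) hK hKe (hK' i) (hKt i)
  have hM : ∀ i, ∃ M : NNReal, ∀ z ∈ K' i,
      ENNReal.ofReal (ν.coeff ((chartPartition Y).chart i) z) ≤ M := by
    intro i
    obtain ⟨M, hM⟩ := (hK' i).exists_bound_of_continuousOn
      ((ν.continuousOn_coeff _ (hc i)).mono (hKt i))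
    exact ⟨M.toNNReal, fun z hz => ENNReal.ofReal_le_ofReal ((le_abs_self _).trans (hM z hz))⟩
  choose M hM using hM
  -- `N` bounds the `L²` part of the squared norm. In `N'`, the `2` comes from the Dirichlet
  -- pairing, `d` from Cauchy–Schwarz on the fibres, and `n` from the number of pieces.
  set N : NNReal := ∑ i, M i * C₁ i with hN
  set N' : NNReal := 2 * d * (chartPartition Y).n with hN'
  -- The extra one makes `N + N'` at most the square of the constant, which replaces a square root.
  refine ⟨N + N' + 1, fun v w w' hv => ?_⟩
  set u := pushforward φ (chartExtend e v) with hu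
  have hae : ∀ e' ∈ atlas ℂ Y, (fun y => u (e'.symm y)) =ᵐ[volume.restrict e'.target]
      fibreSum (chartMap φ e e') (chartDomain φ e e') v :=
    fun e' he' => pushforward_chartExtend h he he' v
  have hum : AEStronglyMeasurable u ν.measure := by
    refine ν.aestronglyMeasurable_of_chart fun e' he' => ?_
    refine AEStronglyMeasurable.congr ?_ (hae e' he').symm
    exact ((h.finiteBranched he he').aestronglyMeasurable_fibreSum
      (hv.memLp.1.mono_measure Measure.restrict_le_self)).mono_measure Measure.restrict_le_self
  have hu2 : ∫⁻ x, ‖u x‖ₑ ^ 2 ∂ν.measure ≤ N * ∫⁻ z, ‖v z‖ₑ ^ 2 := by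
    rw [ν.lintegral_measure (hum.enorm.pow_const 2), hN]
    push_cast
    rw [Finset.sum_mul]
    refine Finset.sum_le_sum fun i _ => ?_
    calc _ ≤ ∫⁻ z in K' i, M i *
          ‖fibreSum (chartMap φ e ((chartPartition Y).chart i))
            (chartDomain φ e ((chartPartition Y).chart i)) v z‖ₑ ^ 2 := by
          refine le_trans (lintegral_mono_ae ?_) (lintegral_mono_set (hiK i))
          filter_upwards [L21.ae_image i (hae _ (hc i)),
            ae_restrict_mem ((chartPartition Y).measurableSet_image i)] with z hz hzi
          rw [hz]
          gcongr
          exact hM i z (hiK i hzi)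
      _ ≤ M i * (C₁ i * ∫⁻ z, ‖v z‖ₑ ^ 2) := by
          rw [lintegral_const_mul' _ _ ENNReal.coe_ne_top]
          gcongr
          exact hC₁ i v hv.memLp.1 hv.eq_zero
      _ = _ := by rw [mul_assoc]
  have hmem : MemLp u 2 ν.measure := memLp_two_of_lintegral_lt_top hum
    (hu2.trans_lt (ENNReal.mul_lt_top ENNReal.coe_lt_top hv.memLp.lintegral_lt_top_two))
  have hproper : ∀ e' : OpenPartialHomeomorph Y ℂ, ∀ K₁ ⊆ e'.target, IsCompact K₁ →
      ∃ L ⊆ chartDomain φ e e', IsCompact L ∧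
        ∀ z ∈ chartDomain φ e e', z ∈ K → chartMap φ e e' z ∈ K₁ → z ∈ L :=
    fun e' K₁ h₁ h₂ => exists_compact_chartDomain h.mdifferentiable.continuous hK hKe h₂ h₁
  have hdz : ∀ e' ∈ atlas ℂ Y, IsWeakDeriv dz e'.target (fun y => u (e'.symm y))
      (fibreSum (chartMap φ e e') (chartDomain φ e e')
        fun z => w z / deriv (chartMap φ e e') z) := fun e' he' =>
    ((h.finiteBranched he he').isWeakDeriv_dz_fibreSum (S := K) e'.open_target
      (hv.weak_dz.mono (fun ψ hψ z hz => hψ.dz_eq_zero hz) (subset_univ _))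
      (fun z _ => hv.eq_zero z) (fun z _ => hv.eq_zero_dz z) (hproper e')).congr (hae e' he').symm
  have hdzbar : ∀ e' ∈ atlas ℂ Y, IsWeakDeriv dzbar e'.target (fun y => u (e'.symm y))
      (fibreSum (chartMap φ e e') (chartDomain φ e e')
        fun z => w' z / conj (deriv (chartMap φ e e') z)) := fun e' he' =>
    ((h.finiteBranched he he').isWeakDeriv_dzbar_fibreSum (S := K) e'.open_target
      (hv.weak_dzbar.mono (fun ψ hψ z hz => hψ.dzbar_eq_zero hz) (subset_univ _))
      (fun z _ => hv.eq_zero z) (fun z _ => hv.eq_zero_dzbar z) (hproper e')).congr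
        (hae e' he').symm
  have hle : ∀ e' ∈ atlas ℂ Y, ∀ w₁ : ℂ → ℂ, MemLp w₁ 2 volume →
      ∫⁻ y, ‖fibreSum (chartMap φ e e') (chartDomain φ e e')
        (fun z => w₁ z / deriv (chartMap φ e e') z) y‖ₑ ^ 2 ≤ d * ∫⁻ z, ‖w₁ z‖ₑ ^ 2 := by
    intro e' he' w₁ hw₁
    refine ((h.finiteBranched he he').lintegral_fibreSum_div_le
      (hw₁.1.mono_measure Measure.restrict_le_self)).trans ?_
    gcongr
    exact Measure.restrict_le_self
  have hL2 : ∀ e' ∈ atlas ℂ Y, ∀ w₁ : ℂ → ℂ, MemLp w₁ 2 volume →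
      MemLp (fibreSum (chartMap φ e e') (chartDomain φ e e')
        (fun z => w₁ z / deriv (chartMap φ e e') z)) 2 volume := by
    intro e' he' w₁ hw₁
    refine memLp_two_of_lintegral_lt_top ?_ ((hle e' he' w₁ hw₁).trans_lt
      (ENNReal.mul_lt_top (ENNReal.natCast_lt_top d) hw₁.lintegral_lt_top_two))
    have hF := h.finiteBranched he he'
    exact hF.aestronglyMeasurable_fibreSum
      (hF.aestronglyMeasurable_div (hw₁.1.mono_measure Measure.restrict_le_self))
  have hderivs : HasL2Derivs u := by
    intro e' he'
    refine ⟨⟨_, hdz e' he', fun K₁ _ _ => (hL2 e' he' w hv.memLp_dz).mono_measure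
      Measure.restrict_le_self⟩, ⟨_, hdzbar e' he', fun K₁ _ _ => ?_⟩⟩
    have hF := h.finiteBranched he he'
    -- The bound for division by `conj F'` is the conjugate of the one for division by `F'`.
    have h1 := (hL2 e' he' _ hv.memLp_dzbar.star).star
    have h2 : star (fibreSum (chartMap φ e e') (chartDomain φ e e')
        (fun z => (star w') z / deriv (chartMap φ e e') z)) =
        fibreSum (chartMap φ e e') (chartDomain φ e e')
          fun z => w' z / conj (deriv (chartMap φ e e') z) := by
      ext y
      have := hF.conj_fibreSum (fun z => (star w') z / deriv (chartMap φ e e') z) y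
      simpa only [map_div₀, Pi.star_apply, RCLike.star_def, Complex.conj_conj] using this
    rw [h2] at h1
    exact h1.mono_measure Measure.restrict_le_self
  let P : L21 ν := ⟨hmem.toLp u, hderivs.congr (MemLp.coeFn_toLp hmem).symm⟩
  have hP : L21.toLp P =ᵐ[ν.measure] u := MemLp.coeFn_toLp hmem
  refine ⟨P, hP, ?_⟩
  have hsq : ‖P‖ₑ ^ 2 ≤ N * eLpNorm v 2 volume ^ 2 + N' * eLpNorm w 2 volume ^ 2 := by
    rw [L21.enorm_sq, eLpNorm_two_sq, eLpNorm_two_sq]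
    refine add_le_add ?_ ?_
    · refine le_trans (le_of_eq (lintegral_congr_ae ?_)) hu2
      filter_upwards [hP] with x hx
      rw [hx]
    · calc _ ≤ ∑ _i : Fin (chartPartition Y).n, 2 * (d * ∫⁻ z, ‖w z‖ₑ ^ 2) := by
            refine Finset.sum_le_sum fun i _ => ?_
            have huniq := (P.weakDz_spec (hc i)).1.unique ((chartPartition Y).chart i).open_target
              (hdz _ (hc i)) (ν.ae_chart hP (hc i))
            rw [lintegral_const_mul' _ _ (by norm_num)]
            gcongr
            refine le_trans ?_ (hle _ (hc i) w hv.memLp_dz)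
            refine le_trans (le_of_eq (lintegral_congr_ae ?_))
              (lintegral_mono' (μ := volume.restrict ((chartPartition Y).image i))
                Measure.restrict_le_self le_rfl)
            filter_upwards [L21.ae_image i huniq] with z hz
            rw [hz]
        _ = _ := by
            rw [Finset.sum_const, Finset.card_univ, Fintype.card_fin, hN', nsmul_eq_mul]
            push_cast
            ring
  rw [← ENNReal.pow_le_pow_left_iff (n := 2) two_ne_zero]
  refine hsq.trans ?_
  set a := eLpNorm v 2 volume
  set b := eLpNorm w 2 volume
  have h1 : a ^ 2 ≤ (a + b) ^ 2 := pow_le_pow_left' le_self_add 2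
  have h2 : b ^ 2 ≤ (a + b) ^ 2 := pow_le_pow_left' le_add_self 2
  calc (N : ENNReal) * a ^ 2 + N' * b ^ 2 ≤ N * (a + b) ^ 2 + N' * (a + b) ^ 2 := by gcongr
    _ = (N + N') * (a + b) ^ 2 := by ring
    _ ≤ (N + N' + 1) ^ 2 * (a + b) ^ 2 := by
        gcongr
        calc (N + N' : ENNReal) ≤ N + N' + 1 := le_self_add
          _ ≤ (N + N' + 1) ^ 2 := le_self_pow₀ le_add_self two_ne_zero
    _ = _ := by
        push_cast
        rw [mul_pow]

end BranchedMap

end Push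

/-! ### Fibres of holomorphic maps -/

/-- Near `z₀` the quotient `g / g z₀` stays close to one, where the logarithm is analytic; multiply
its `n`-th root by an `n`-th root of `g z₀`. -/
lemma exists_analyticAt_pow_eq {g : ℂ → ℂ} {z₀ : ℂ} (hg : AnalyticAt ℂ g z₀) (h0 : g z₀ ≠ 0)
    {n : ℕ} (hn : n ≠ 0) :
    ∃ r : ℂ → ℂ, AnalyticAt ℂ r z₀ ∧ r z₀ ≠ 0 ∧ ∀ᶠ z in 𝓝 z₀, r z ^ n = g z := by
  obtain ⟨c, hc⟩ := IsAlgClosed.exists_pow_nat_eq (g z₀) (Nat.pos_of_ne_zero hn)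
  have hc0 : c ≠ 0 := by
    rintro rfl
    exact h0 (by rw [← hc, zero_pow hn])
  have hdiv : AnalyticAt ℂ (fun z => g z / g z₀) z₀ := hg.div analyticAt_const h0
  have hslit : g z₀ / g z₀ ∈ Complex.slitPlane := by
    rw [div_self h0]
    exact Complex.one_mem_slitPlane
  refine ⟨fun z => c * Complex.exp (Complex.log (g z / g z₀) / n), ?_, ?_, ?_⟩
  · exact analyticAt_const.mul ((hdiv.clog hslit).div analyticAt_const
      (Nat.cast_ne_zero.2 hn)).cexp
  · exact mul_ne_zero hc0 (Complex.exp_ne_zero _)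
  · filter_upwards [hg.continuousAt.eventually_ne h0] with z hz
    rw [mul_pow, hc, ← Complex.exp_nat_mul, mul_div_cancel₀ _ (Nat.cast_ne_zero.2 hn),
      Complex.exp_log (div_ne_zero hz h0), mul_div_cancel₀ _ h0]

lemma encard_pow_eq_le {n : ℕ} (hn : n ≠ 0) (w : ℂ) : {z : ℂ | z ^ n = w}.encard ≤ n := by
  classical
  have h : {z : ℂ | z ^ n = w} = ((Polynomial.nthRoots n w).toFinset : Set ℂ) := by
    ext z
    simp [Polynomial.mem_nthRoots (Nat.pos_of_ne_zero hn)]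
  rw [h, encard_coe_eq_coe_finsetCard]
  exact_mod_cast (Multiset.toFinset_card_le _).trans (Polynomial.card_nthRoots n w)

/-- A nonconstant analytic function takes every value only a bounded number of times near a
given point. -/
lemma exists_encard_fibre_le {f : ℂ → ℂ} {z₀ : ℂ} (hf : AnalyticAt ℂ f z₀)
    (hne : ¬ ∀ᶠ z in 𝓝 z₀, f z = f z₀) :
    ∃ U ∈ 𝓝 z₀, ∃ n : ℕ, ∀ w, (U ∩ f ⁻¹' {w}).encard ≤ n := by
  have hf₀ : AnalyticAt ℂ (fun z => f z - f z₀) z₀ := hf.sub analyticAt_const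
  obtain ⟨n, g, hg, hg0, hfg⟩ := hf₀.exists_eventuallyEq_pow_smul_nonzero_iff.2
    fun h => hne (h.mono fun z hz => sub_eq_zero.1 hz)
  have hn : n ≠ 0 := by
    rintro rfl
    have := hfg.self_of_nhds
    simp at this
    exact hg0 this.symm
  obtain ⟨r, hr, hr0, hrg⟩ := exists_analyticAt_pow_eq hg hg0 hn
  -- `f - f z₀` is the `n`-th power of `k = (z - z₀) r`, whose derivative at `z₀` is nonzero. So `k`
  -- is injective near `z₀` and sends each fibre into the `n`-th roots of one number.
  have hk : AnalyticAt ℂ (fun z => (z - z₀) * r z) z₀ :=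
    (analyticAt_id.sub analyticAt_const).mul hr
  have hd : HasStrictDerivAt (fun z => (z - z₀) * r z) (r z₀) z₀ := by
    have h1 := (((hasDerivAt_id z₀).sub_const z₀).mul hr.differentiableAt.hasDerivAt)
    have h2 := hk.hasStrictDerivAt
    rw [show deriv (fun z => (z - z₀) * r z) z₀ = r z₀ from by
      refine HasDerivAt.deriv (h1.congr_deriv ?_)
      simp] at h2
    exact h2
  refine ⟨_, (hfg.and (hrg.and (hd.eventually_left_inverse hr0))), n, fun w => ?_⟩
  have hmaps : MapsTo (fun z => (z - z₀) * r z)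
      ({z | f z - f z₀ = (z - z₀) ^ n • g z ∧ r z ^ n = g z ∧
        HasStrictDerivAt.localInverse (fun z => (z - z₀) * r z) (r z₀) z₀ hd hr0
          ((z - z₀) * r z) = z} ∩ f ⁻¹' {w}) {z : ℂ | z ^ n = w - f z₀} := by
    rintro z ⟨⟨h1, h2, -⟩, rfl⟩
    change ((z - z₀) * r z) ^ n = f z - f z₀
    rw [mul_pow, h2, h1, smul_eq_mul]
  refine (encard_le_encard_of_injOn hmaps ?_).trans (encard_pow_eq_le hn _)
  rintro z ⟨⟨-, -, h1⟩, -⟩ z' ⟨⟨-, -, h1'⟩, -⟩ h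
  have h' : (z - z₀) * r z = (z' - z₀) * r z' := h
  rw [← h1, ← h1', h']

/-! ### Local constancy, isolated critical points and bounded fibres -/

lemma eventually_eq_iff_chartMap {X Y : Type*} [TopologicalSpace X] [TopologicalSpace Y] {φ : X → Y}
    {e : OpenPartialHomeomorph X ℂ} {e' : OpenPartialHomeomorph Y ℂ} (hφ : Continuous φ) {x : X}
    (hx : x ∈ e.source)
    (hx' : φ x ∈ e'.source) : (∀ᶠ x' in 𝓝 x, φ x' = φ x) ↔
      ∀ᶠ z in 𝓝 (e x), chartMap φ e e' z = chartMap φ e e' (e x) := by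
  rw [← e.map_nhds_eq hx, Filter.eventually_map]
  refine Filter.eventually_congr ?_
  filter_upwards [e.open_source.mem_nhds hx,
    (e'.open_source.preimage hφ).mem_nhds hx'] with x' h1 h2
  simp only [chartMap, e.left_inv h1, e.left_inv hx]
  exact (e'.injOn.eq_iff h2 hx').symm

section

variable {X Y : Type*} [TopologicalSpace X] [ChartedSpace ℂ X] [IsManifold 𝓘(ℂ) ω X]
  [TopologicalSpace Y] [ChartedSpace ℂ Y] [IsManifold 𝓘(ℂ) ω Y] {φ : X → Y}
  {e : OpenPartialHomeomorph X ℂ} {e' : OpenPartialHomeomorph Y ℂ}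

lemma analyticAt_chartMap (hφ : MDifferentiable 𝓘(ℂ) 𝓘(ℂ) φ) (he : e ∈ atlas ℂ X)
    (he' : e' ∈ atlas ℂ Y) {z : ℂ} (hz : z ∈ chartDomain φ e e') :
    AnalyticAt ℂ (chartMap φ e e') z :=
  (differentiableOn_chartMap hφ he he').analyticAt ((isOpen_chartDomain hφ.continuous).mem_nhds hz)

/-- Either `φ` is constant near a point, or its derivative does not vanish in a punctured
neighbourhood. -/
lemma eventually_eq_or_eventually_deriv_ne_zero (hφ : MDifferentiable 𝓘(ℂ) 𝓘(ℂ) φ)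
    (he : e ∈ atlas ℂ X) (he' : e' ∈ atlas ℂ Y) {x : X} (hx : x ∈ e.source)
    (hx' : φ x ∈ e'.source) : (∀ᶠ x' in 𝓝 x, φ x' = φ x) ∨
      ∀ᶠ z in 𝓝[≠] (e x), deriv (chartMap φ e e') z ≠ 0 := by
  have hz := mem_chartDomain (φ := φ) hx hx'
  have han := analyticAt_chartMap hφ he he' hz
  -- Isolated zeros for the derivative; if it vanishes near the point, the map is constant on a
  -- disc.
  refine han.deriv.eventually_eq_zero_or_eventually_ne_zero.imp (fun h => ?_) id
  rw [eventually_eq_iff_chartMap hφ.continuous hx hx']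
  obtain ⟨r, hr, hball⟩ := Metric.eventually_nhds_iff_ball.1
    (h.and ((isOpen_chartDomain hφ.continuous).mem_nhds hz))
  filter_upwards [Metric.ball_mem_nhds _ hr] with z hzr
  exact Metric.isOpen_ball.is_const_of_deriv_eq_zero (convex_ball _ _).isPreconnected
    ((differentiableOn_chartMap hφ he he').mono fun w hw => (hball w hw).2)
    (fun w hw => (hball w hw).1) hzr (Metric.mem_ball_self hr)

/-- The points of local constancy form a clopen set, and so do those among them with a given value.
Such a set contains the component of each of its points, against the hypothesis. -/
lemma not_eventually_eq [T1Space Y] (hφ : MDifferentiable 𝓘(ℂ) 𝓘(ℂ) φ)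
    (hnc : ∀ x, ∃ x' ∈ connectedComponent x, φ x' ≠ φ x) (x : X) :
    ¬ ∀ᶠ x' in 𝓝 x, φ x' = φ x := by
  intro hx
  have hopen : IsOpen {x | ∀ᶠ x' in 𝓝 x, φ x' = φ x} := by
    rw [isOpen_iff_mem_nhds]
    intro a (ha : ∀ᶠ x' in 𝓝 a, φ x' = φ a)
    filter_upwards [ha, ha.eventually_nhds] with b hb hb'
    exact hb'.mono fun c hc => hc.trans hb.symm
  -- Around a point where `φ` is not locally constant the derivative is nonzero on a punctured
  -- neighbourhood, which excludes local constancy there.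
  have hclosed : IsClosed {x | ∀ᶠ x' in 𝓝 x, φ x' = φ x} := by
    rw [← isOpen_compl_iff, isOpen_iff_mem_nhds]
    intro a ha
    have hc := chart_mem_atlas ℂ a
    have hc' := chart_mem_atlas ℂ (φ a)
    have has := mem_chart_source ℂ a
    have has' := mem_chart_source ℂ (φ a)
    have h := (eventually_eq_or_eventually_deriv_ne_zero hφ hc hc' has has').resolve_left ha
    rw [eventually_nhdsWithin_iff, ← (chartAt ℂ a).map_nhds_eq has, Filter.eventually_map] at h
    filter_upwards [h, (chartAt ℂ a).open_source.mem_nhds has,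
      ((chartAt ℂ (φ a)).open_source.preimage hφ.continuous).mem_nhds has'] with b hb hbs hbs' hbA
    rcases eq_or_ne b a with rfl | hba
    · exact ha hbA
    · refine hb (fun h => hba ((chartAt ℂ a).injOn hbs has h)) ?_
      have := (eventually_eq_iff_chartMap hφ.continuous hbs hbs').1 hbA
      rw [Filter.EventuallyEq.deriv_eq (f := fun _ => _) this, deriv_const]
  have hclopen : IsClopen ({x | ∀ᶠ x' in 𝓝 x, φ x' = φ x} ∩ φ ⁻¹' {φ x}) := by
    refine ⟨hclosed.inter (isClosed_singleton.preimage hφ.continuous), ?_⟩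
    rw [isOpen_iff_mem_nhds]
    rintro a ⟨ha, hax⟩
    filter_upwards [hopen.mem_nhds ha, (show ∀ᶠ x' in 𝓝 a, φ x' = φ a from ha)] with b hb hb'
    exact ⟨hb, hb'.trans hax⟩
  obtain ⟨x', hx', hne⟩ := hnc x
  exact hne (hclopen.connectedComponent_subset ⟨hx, rfl⟩ hx').2

/-- A holomorphic map of compact Riemann surfaces, constant on no component, is a branched map. -/
theorem exists_branchedMap [CompactSpace X] [T1Space Y] (hφ : MDifferentiable 𝓘(ℂ) 𝓘(ℂ) φ)
    (hnc : ∀ x, ∃ x' ∈ connectedComponent x, φ x' ≠ φ x) : ∃ d, BranchedMap φ d := by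
  have hloc : ∀ x, ∃ U ∈ 𝓝 x, ∃ n : ℕ, ∀ y, (U ∩ φ ⁻¹' {y}).encard ≤ n := by
    intro x
    have hs := mem_chart_source ℂ x
    have hs' := mem_chart_source ℂ (φ x)
    have hne := not_eventually_eq hφ hnc x
    rw [eventually_eq_iff_chartMap hφ.continuous hs hs'] at hne
    obtain ⟨U, hU, n, hn⟩ := exists_encard_fibre_le (analyticAt_chartMap hφ
      (chart_mem_atlas ℂ x) (chart_mem_atlas ℂ (φ x)) (mem_chartDomain hs hs')) hne
    refine ⟨(chartAt ℂ x).source ∩ chartAt ℂ x ⁻¹' U, ?_, n, fun y => ?_⟩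
    · exact Filter.inter_mem ((chartAt ℂ x).open_source.mem_nhds hs)
        ((chartAt ℂ x).continuousAt hs hU)
    · refine (encard_le_encard_of_injOn (t := U ∩ chartMap φ (chartAt ℂ x) (chartAt ℂ (φ x)) ⁻¹'
        {chartAt ℂ (φ x) y}) (f := chartAt ℂ x) ?_ ?_).trans (hn _)
      · rintro z ⟨⟨h1, h2⟩, rfl⟩
        exact ⟨h2, by simp [chartMap, (chartAt ℂ x).left_inv h1]⟩
      · exact (chartAt ℂ x).injOn.mono fun z hz => hz.1.1
  choose U hU n hn using hloc
  obtain ⟨t, -, ht⟩ := isCompact_univ.elim_nhds_subcover U fun x _ => hU x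
  refine ⟨∑ x ∈ t, n x, hφ, fun y => ?_, fun e he e' he' => ?_⟩
  · have hsub : φ ⁻¹' {y} ⊆ ⋃ x ∈ t, U x ∩ φ ⁻¹' {y} := by
      intro a ha
      obtain ⟨x, hx, hax⟩ := mem_iUnion₂.1 (ht (mem_univ a))
      exact mem_iUnion₂.2 ⟨x, hx, hax, ha⟩
    refine (encard_le_encard hsub).trans ((t.set_encard_biUnion_le _).trans ?_)
    push_cast
    exact Finset.sum_le_sum fun x _ => hn x y
  -- Critical points are isolated, so the critical set is locally contained in a singleton.
  · refine measure_null_of_locally_null _ fun z hz => ?_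
    have hx := e.map_target hz.1.1
    have h := (eventually_eq_or_eventually_deriv_ne_zero hφ he he' hx hz.1.2).resolve_left
      (not_eventually_eq hφ hnc _)
    rw [e.right_inv hz.1.1, eventually_nhdsWithin_iff] at h
    refine ⟨{z}, ?_, measure_singleton z⟩
    rw [mem_nhdsWithin_iff_eventually]
    filter_upwards [h] with w hw hwS
    by_contra hne
    exact hw hne hwS.2

end

/-! ### Partitions of unity and localization -/

section Unity

variable {X : Type*} [TopologicalSpace X] [ChartedSpace ℂ X] [IsManifold 𝓘(ℂ) ω X]
  {e : OpenPartialHomeomorph X ℂ}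

/-- A smooth function supported in the domain of a chart is a test function in the chart. -/
lemma isTestFunction_of_tsupport_subset [CompactSpace X] (he : e ∈ atlas ℂ X) {ρ : X → ℂ}
    (hρ : ρ ∈ SmoothFun X) (hs : tsupport ρ ⊆ e.source) :
    IsTestFunction e.target (e.target.indicator fun z => ρ (e.symm z)) := by
  have hK : IsCompact (e '' tsupport ρ) :=
    (isClosed_tsupport ρ).isCompact.image_of_continuousOn (e.continuousOn.mono hs)
  have hsupp : support (e.target.indicator fun z => ρ (e.symm z)) ⊆ e '' tsupport ρ := by
    intro z hz
    rw [mem_support, indicator_apply_ne_zero] at hz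
    exact ⟨e.symm z, subset_tsupport _ hz.2, e.right_inv hz.1⟩
  have hKt : e '' tsupport ρ ⊆ e.target := by
    rintro _ ⟨x, hx, rfl⟩
    exact e.map_source (hs hx)
  refine ⟨?_, HasCompactSupport.of_support_subset_isCompact hK hsupp,
    (closure_minimal hsupp hK.isClosed).trans hKt⟩
  rw [contDiff_iff_contDiffAt]
  intro z
  by_cases hz : z ∈ e '' tsupport ρ
  · refine ((smooth_chart hρ he).contDiffAt (e.open_target.mem_nhds (hKt hz))).congr_of_eventuallyEq
      ?_
    filter_upwards [e.open_target.mem_nhds (hKt hz)] with w hw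
    rw [indicator_of_mem hw]
  · refine (contDiffAt_const (c := (0 : ℂ))).congr_of_eventuallyEq ?_
    filter_upwards [hK.isClosed.isOpen_compl.mem_nhds hz] with w hw
    by_contra h
    exact hw (hsupp h)

variable [T2Space X]

/-- In the Hausdorff space `X` the support transported from the chart is compact, hence closed, and
the extension vanishes near every point outside it. -/
lemma chartExtend_mem_smoothFun (he : e ∈ atlas ℂ X) {g : ℂ → ℂ} (hg : IsTestFunction e.target g) :
    chartExtend e g ∈ SmoothFun X := by
  have := isManifold_real (X := X)
  have hS : IsClosed (e.symm '' tsupport g) :=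
    (hg.hasCompactSupport.image_of_continuousOn
      (e.continuousOn_symm.mono hg.tsupport_subset)).isClosed
  intro x
  by_cases hx : x ∈ e.symm '' tsupport g
  · have hxs : x ∈ e.source := by
      obtain ⟨z, hz, rfl⟩ := hx
      exact e.map_target (hg.tsupport_subset hz)
    have h1 : ContMDiffAt 𝓘(ℝ, ℂ) 𝓘(ℝ, ℂ) ∞ (fun x => g (e x)) x :=
      hg.contDiff.contMDiff.contMDiffAt.comp x
        (contMDiffAt_of_mem_maximalAtlas (IsManifold.subset_maximalAtlas he) hxs)
    refine h1.congr_of_eventuallyEq ?_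
    filter_upwards [e.open_source.mem_nhds hxs] with y hy
    simp [chartExtend, hy]
  · refine (contMDiffAt_const (c := (0 : ℂ))).congr_of_eventuallyEq ?_
    filter_upwards [hS.isOpen_compl.mem_nhds hx] with y hy
    by_cases hys : y ∈ e.source
    · simp only [chartExtend, indicator_of_mem hys]
      exact image_eq_zero_of_notMem_tsupport fun h => hy ⟨_, h, e.left_inv hys⟩
    · simp [chartExtend, hys]

variable (X) in
/-- A finite smooth partition of unity, in charts. -/
theorem exists_chartUnity [CompactSpace X] : ∃ (t : Finset X) (θ : X → ℂ → ℂ),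
    (∀ a, IsTestFunction (chartAt ℂ a).target (θ a)) ∧
      ∀ x, ∑ a ∈ t, chartExtend (chartAt ℂ a) (θ a) x = 1 := by
  have := isManifold_real (X := X)
  obtain ⟨f, hf⟩ := SmoothPartitionOfUnity.exists_isSubordinate_chartAt_source 𝓘(ℝ, ℂ) X
  have hsupp : ∀ a, support (fun x => (f a x : ℂ)) = support (f a) := fun a => by
    ext x
    simp
  have hts : ∀ a, tsupport (fun x => (f a x : ℂ)) ⊆ (chartAt ℂ a).source := fun a => by
    unfold tsupport
    rw [hsupp]
    exact hf a
  have hsm : ∀ a, (fun x => (f a x : ℂ)) ∈ SmoothFun X := fun a =>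
    Complex.ofRealCLM.contDiff.contMDiff.comp (f a).contMDiff
  refine ⟨(f.locallyFinite.finite_nonempty_of_compact).toFinset, _, fun a =>
    isTestFunction_of_tsupport_subset (chart_mem_atlas ℂ a) (hsm a) (hts a), fun x => ?_⟩
  have h1 := f.sum_eq_one (mem_univ x)
  rw [finsum_eq_sum_of_support_subset (s := (f.locallyFinite.finite_nonempty_of_compact).toFinset)
    _ (fun a ha => Finset.mem_coe.2 ((Set.Finite.mem_toFinset _).2 ⟨x, ha⟩))] at h1
  rw [← Complex.ofReal_one, ← h1, Complex.ofReal_sum]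
  refine Finset.sum_congr rfl fun a _ => ?_
  by_cases hx : x ∈ (chartAt ℂ a).source
  · simp [chartExtend, hx]
  · rw [chartExtend, indicator_of_notMem hx]
    exact (image_eq_zero_of_notMem_tsupport fun h => hx (hts a h)).symm

end Unity

lemma chartExtend_mul {X : Type*} [TopologicalSpace X] (e : OpenPartialHomeomorph X ℂ)
    (θ : ℂ → ℂ) (f : X → ℂ) (x : X) :
    chartExtend e (fun z => θ z * f (e.symm z)) x = chartExtend e θ x * f x := by
  by_cases hx : x ∈ e.source
  · simp [chartExtend, hx]
  · simp [chartExtend, hx]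

lemma pushforward_id {X : Type*} [TopologicalSpace X] [ChartedSpace ℂ X] [IsManifold 𝓘(ℂ) ω X]
    (g : X → ℂ) : pushforward (id : X → X) g = g := by
  ext x
  have hc := chart_mem_atlas ℂ x
  have hs := mem_chart_source ℂ x
  have h : deriv (chartMap id (chartAt ℂ x) (chartAt ℂ x)) (chartAt ℂ x x) ≠ 0 := fun h0 => by
    have := deriv_chartMap_id_mul hc hc (mem_chartDomain (φ := id) hs hs)
    rw [h0, mul_zero] at this
    exact zero_ne_one this
  rw [pushforward, preimage_id, finsum_mem_singleton,
    ramificationIndex_eq_one mdifferentiable_id hc hc hs hs h, Nat.cast_one, one_mul]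

lemma exists_memLp_mul_bound {K : Set ℂ} (hK : IsCompact K) {θ : ℂ → ℂ} (hθ : Continuous θ)
    (h0 : ∀ z ∉ K, θ z = 0) : ∃ C : NNReal, ∀ u : ℂ → ℂ, MemLp u 2 (volume.restrict K) →
      MemLp (fun z => θ z * u z) 2 volume ∧
        eLpNorm (fun z => θ z * u z) 2 volume ≤ C * eLpNorm u 2 (volume.restrict K) := by
  obtain ⟨B, hB⟩ := hK.exists_bound_of_continuousOn hθ.continuousOn
  refine ⟨B.toNNReal, fun u hu => ?_⟩
  have hle : ∀ᵐ z ∂(volume.restrict K), ‖θ z * u z‖ ≤ B.toNNReal * ‖u z‖ := by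
    filter_upwards [ae_restrict_mem hK.measurableSet] with z hz
    rw [norm_mul]
    gcongr
    exact (hB z hz).trans (Real.le_coe_toNNReal B)
  have hind : K.indicator (fun z => θ z * u z) = fun z => θ z * u z := by
    refine indicator_eq_self.2 fun z hz => ?_
    by_contra hzK
    exact hz (by simp [h0 z hzK])
  have h1 : MemLp (fun z => θ z * u z) 2 (volume.restrict K) :=
    hu.of_le_mul (hθ.aestronglyMeasurable.mul hu.1) hle
  have h2 := eLpNorm_le_nnreal_smul_eLpNorm_of_ae_le_mul hle 2
  refine ⟨?_, ?_⟩
  · rw [← hind, memLp_indicator_iff_restrict hK.measurableSet]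
    exact h1
  · rw [← hind, eLpNorm_indicator_eq_eLpNorm_restrict hK.measurableSet]
    exact h2

section Localization

variable {X : Type*} [TopologicalSpace X] [T2Space X] [CompactSpace X] [ChartedSpace ℂ X]
  [IsManifold 𝓘(ℂ) ω X] [MeasurableSpace X] [BorelSpace X] {ν : VolumeForm X}
  {e : OpenPartialHomeomorph X ℂ}

/-- Extension by zero of Sobolev functions supported in a chart. -/
theorem exists_ofChart (ν : VolumeForm X) (he : e ∈ atlas ℂ X) {K : Set ℂ}
    (hK : IsCompact K) (hKe : K ⊆ e.target) :
    ∃ C : NNReal, ∀ v w w', SupportedSobolev K v w w' → ∃ P : L21 ν,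
      L21.toLp P =ᵐ[ν.measure] chartExtend e v ∧
      ‖P‖ₑ ≤ C * (eLpNorm v 2 volume + eLpNorm w 2 volume) := by
  -- Extension by zero is the push-forward along the identity.
  obtain ⟨C, hC⟩ := branchedMap_id.exists_push ν he hK hKe
  refine ⟨C, fun v w w' h => ?_⟩
  obtain ⟨P, hP, hP'⟩ := hC v w w' h
  rw [pushforward_id] at hP
  exact ⟨P, hP, hP'⟩

namespace L21

lemma ext_ae {f g : L21 ν} (h : toLp f =ᵐ[ν.measure] toLp g) : f = g :=
  toLp_injective (Lp.ext h)

lemma toLp_sub_ae (f g : L21 ν) : toLp (f - g) =ᵐ[ν.measure] toLp f - toLp g := by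
  rw [map_sub]
  exact Lp.coeFn_sub _ _

lemma toLp_sum_ae {ι : Type*} (s : Finset ι) (f : ι → L21 ν) :
    toLp (∑ i ∈ s, f i) =ᵐ[ν.measure] fun x => ∑ i ∈ s, toLp (f i) x := by
  rw [map_sum]
  refine (Lp.coeFn_finsetSum s fun i => toLp (f i)).trans (Filter.Eventually.of_forall fun x => ?_)
  simp

lemma exists_eLpNorm_chart_le (ν : VolumeForm X) (he : e ∈ atlas ℂ X) {K : Set ℂ}
    (hK : IsCompact K) (hKe : K ⊆ e.target) : ∃ C : NNReal, ∀ f : L21 ν,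
      MemLp (fun z => toLp f (e.symm z)) 2 (volume.restrict K) ∧
        eLpNorm (fun z => toLp f (e.symm z)) 2 (volume.restrict K) ≤ C * ‖f‖ₑ := by
  obtain ⟨C, hC⟩ := exists_lintegral_chart_le ν he hK hKe
  refine ⟨C + 1, fun f => ?_⟩
  have h1 : eLpNorm (fun z => toLp f (e.symm z)) 2 (volume.restrict K) ≤ (C + 1 : NNReal) * ‖f‖ₑ := by
    rw [← ENNReal.pow_le_pow_left_iff (n := 2) two_ne_zero, eLpNorm_two_sq, mul_pow]
    refine (hC f).trans ?_
    gcongr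
    push_cast
    exact le_self_add.trans (le_self_pow₀ le_add_self two_ne_zero)
  exact ⟨⟨(f.aestronglyMeasurable_chart he).mono_measure (Measure.restrict_mono hKe le_rfl),
    h1.trans_lt (ENNReal.mul_lt_top ENNReal.coe_lt_top enorm_lt_top)⟩, h1⟩

lemma eLpNorm_weakDz_le (f : L21 ν) (he : e ∈ atlas ℂ X) {K : Set ℂ} (hKe : K ⊆ e.target) :
    eLpNorm (weakDz (toLp f) e) 2 (volume.restrict K) ≤ ‖f‖ₑ := by
  rw [← ENNReal.pow_le_pow_left_iff (n := 2) two_ne_zero, eLpNorm_two_sq]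
  exact (lintegral_mono_set hKe).trans (f.lintegral_weakDz_le he)

/-- The localization of an element of `L²₁(X)` by a cutoff function in a chart. -/
lemma exists_supportedSobolev (ν : VolumeForm X) (he : e ∈ atlas ℂ X) {θ : ℂ → ℂ}
    (hθ : IsTestFunction e.target θ) : ∃ C : NNReal, ∀ f : L21 ν, ∃ w w',
      SupportedSobolev (tsupport θ) (fun z => θ z * toLp f (e.symm z)) w w' ∧
      eLpNorm (fun z => θ z * toLp f (e.symm z)) 2 volume + eLpNorm w 2 volume ≤ C * ‖f‖ₑ := by
  have hK : IsCompact (tsupport θ) := hθ.hasCompactSupport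
  have hz : ∀ z ∉ tsupport θ, θ z = 0 := fun z hz => image_eq_zero_of_notMem_tsupport hz
  obtain ⟨A, hA⟩ := exists_memLp_mul_bound hK hθ.contDiff.continuous hz
  obtain ⟨B, hB⟩ := exists_memLp_mul_bound hK hθ.dz_props.1 hθ.dz_props.2
  obtain ⟨B', hB'⟩ := exists_memLp_mul_bound hK hθ.dzbar_props.1 hθ.dzbar_props.2
  obtain ⟨D, hD⟩ := exists_eLpNorm_chart_le ν he hK hθ.tsupport_subset
  -- Leibniz: `A` bounds multiplication by `θ`, `B` by `dz θ`, and `D` bounds `f` in the chart. The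
  -- first summand is for `θ f`, the bracket for `θ ∂f + ∂θ f`.
  refine ⟨A * D + (A + B * D), fun f => ?_⟩
  obtain ⟨w', hw', hw2'⟩ := (f.hasL2Derivs e he).2
  obtain ⟨hw, hw2⟩ := f.weakDz_spec he
  have m := (hD f).1
  have m1 := hw2 _ hθ.tsupport_subset hK
  have m2 := hw2' _ hθ.tsupport_subset hK
  refine ⟨_, _, ⟨(hA _ m).1, (hA _ m1).1.add (hB _ m).1, (hA _ m2).1.add (hB' _ m).1,
    fun z h => by simp [hz z h], fun z h => ?_, fun z h => ?_,
    hw.cutoff_dz e.open_target hθ, hw'.cutoff_dzbar e.open_target hθ⟩, ?_⟩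
  · simp [hz z h, hθ.dz_props.2 z h]
  · simp [hz z h, hθ.dzbar_props.2 z h]
  · push_cast
    rw [add_mul, add_mul]
    refine add_le_add ?_ ((eLpNorm_add_le (hA _ m1).1.1 (hB _ m).1.1 (by norm_num)).trans
      (add_le_add ?_ ?_))
    · refine (hA _ m).2.trans ?_
      rw [mul_assoc]
      gcongr
      exact (hD f).2
    · refine (hA _ m1).2.trans ?_
      gcongr
      exact f.eLpNorm_weakDz_le he hθ.tsupport_subset
    · refine (hB _ m).2.trans ?_
      rw [mul_assoc]
      gcongr
      exact (hD f).2

/-- The localizations of an element of `L²₁(X)` are bounded by its norm. -/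
theorem exists_eLpNorm_localization_le (ν : VolumeForm X) (he : e ∈ atlas ℂ X) {θ : ℂ → ℂ}
    (hθ : IsTestFunction e.target θ) : ∃ C : NNReal, ∀ (f : L21 ν) (u : X → ℂ),
      toLp f =ᵐ[ν.measure] u → ∀ K v w w', SupportedSobolev K v w w' →
      (∀ᵐ z, v z = θ z * u (e.symm z)) →
      eLpNorm v 2 volume + eLpNorm w 2 volume ≤ C * ‖f‖ₑ := by
  obtain ⟨C, hC⟩ := exists_supportedSobolev ν he hθ
  refine ⟨C, fun f u hu K v w w' h hv => ?_⟩
  obtain ⟨w₀, w₀', h₀, hle⟩ := hC f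
  have hv₀ : v =ᵐ[volume] fun z => θ z * toLp f (e.symm z) := by
    have := (ae_restrict_iff' e.open_target.measurableSet).1 (ν.ae_chart hu he)
    filter_upwards [this, hv] with z hz hz'
    rw [hz']
    by_cases hze : z ∈ e.target
    · rw [hz hze]
    · rw [image_eq_zero_of_notMem_tsupport fun h => hze (hθ.tsupport_subset h), zero_mul, zero_mul]
  have hw₀ : w =ᵐ[volume] w₀ := by
    have := h.weak_dz.unique isOpen_univ h₀.weak_dz (by rwa [Measure.restrict_univ])
    rwa [Measure.restrict_univ] at this
  rwa [eLpNorm_congr_ae hv₀, eLpNorm_congr_ae hw₀]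

end L21

end Localization

/-! ### Density of smooth functions and completeness -/

lemma tendsto_integral_mul_of_eLpNorm {v : ℕ → ℂ → ℂ} {v₀ g : ℂ → ℂ} (hv : ∀ n, MemLp (v n) 2 volume)
    (hv₀ : MemLp v₀ 2 volume) (hg : MemLp g 2 volume)
    (h : Filter.Tendsto (fun n => eLpNorm (v n - v₀) 2 volume) Filter.atTop (𝓝 0)) :
    Filter.Tendsto (fun n => ∫ z, v n z * g z) Filter.atTop (𝓝 (∫ z, v₀ z * g z)) := by
  refine tendsto_integral_of_L1' _ (MemLp.integrable_mul hv₀ hg).1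
    (Filter.Eventually.of_forall fun n => MemLp.integrable_mul (hv n) hg) ?_
  have hle : ∀ n, eLpNorm ((fun z => v n z * g z) - fun z => v₀ z * g z) 1 volume ≤
      eLpNorm (v n - v₀) 2 volume * eLpNorm g 2 volume := by
    intro n
    have e : ((fun z => v n z * g z) - fun z => v₀ z * g z) = (v n - v₀) • g := by
      ext z
      simp [sub_mul]
    rw [e]
    exact eLpNorm_smul_le_mul_eLpNorm hg.1 ((hv n).sub hv₀).1
  refine tendsto_of_tendsto_of_tendsto_of_le_of_le tendsto_const_nhds ?_ (fun _ => zero_le) hle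
  simpa using ENNReal.Tendsto.mul_const h (Or.inr hg.2.ne)

/-- Weak differentiation is a closed operator: `L²` convergence allows passing to the limit on both
sides of the identity for a fixed test function. -/
lemma IsWeakDeriv.of_tendsto {D : (ℂ → ℂ) → ℂ → ℂ} (hD : ∀ ψ, IsTestFunction univ ψ →
    Continuous (D ψ) ∧ ∀ z, z ∉ tsupport ψ → D ψ z = 0) {v w : ℕ → ℂ → ℂ} {v₀ w₀ : ℂ → ℂ}
    (h : ∀ n, IsWeakDeriv D univ (v n) (w n)) (hv : ∀ n, MemLp (v n) 2 volume)
    (hw : ∀ n, MemLp (w n) 2 volume) (hv₀ : MemLp v₀ 2 volume) (hw₀ : MemLp w₀ 2 volume)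
    (hvt : Filter.Tendsto (fun n => eLpNorm (v n - v₀) 2 volume) Filter.atTop (𝓝 0))
    (hwt : Filter.Tendsto (fun n => eLpNorm (w n - w₀) 2 volume) Filter.atTop (𝓝 0)) :
    IsWeakDeriv D univ v₀ w₀ where
  locInt_fun := hv₀.locallyIntegrable_two.locallyIntegrableOn _
  locInt_deriv := hw₀.locallyIntegrable_two.locallyIntegrableOn _
  integral_eq ψ hψ := by
    have h1 := tendsto_integral_mul_of_eLpNorm hv hv₀ ((hD ψ hψ).1.memLp_of_hasCompactSupport
      (HasCompactSupport.intro hψ.hasCompactSupport (hD ψ hψ).2)) hvt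
    have h2 := (tendsto_integral_mul_of_eLpNorm hw hw₀
      (hψ.contDiff.continuous.memLp_of_hasCompactSupport hψ.hasCompactSupport) hwt).neg
    rw [Measure.restrict_univ]
    refine tendsto_nhds_unique h1 (h2.congr fun n => ?_)
    have := (h n).integral_eq ψ hψ
    rw [Measure.restrict_univ] at this
    exact this.symm

lemma exists_tendsto_eLpNorm {K : Set ℂ} (hK : IsCompact K) {v : ℕ → ℂ → ℂ}
    (hv : ∀ n, MemLp (v n) 2 volume) (h0 : ∀ n, ∀ z ∉ K, v n z = 0) {B : ℕ → ENNReal}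
    (hB : ∑' i, B i ≠ ⊤)
    (hc : ∀ N n m, N ≤ n → N ≤ m → eLpNorm (v n - v m) 2 volume < B N) :
    ∃ v₀, MemLp v₀ 2 volume ∧ (∀ z ∉ K, v₀ z = 0) ∧
      Filter.Tendsto (fun n => eLpNorm (v n - v₀) 2 volume) Filter.atTop (𝓝 0) := by
  obtain ⟨u, hu, hut⟩ := Lp.cauchy_complete_eLpNorm (by norm_num) hv hB hc
  -- The `L²` limit vanishes off `K` only almost everywhere; cutting it by the indicator makes this
  -- hold at every point and does not increase the error.
  refine ⟨K.indicator u, hu.indicator hK.measurableSet, fun z hz => indicator_of_notMem hz u, ?_⟩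
  refine tendsto_of_tendsto_of_tendsto_of_le_of_le tendsto_const_nhds hut (fun _ => zero_le)
    fun n => ?_
  refine eLpNorm_mono fun z => ?_
  by_cases hz : z ∈ K
  · simp [hz]
  · simp [hz, h0 n z hz]

/-- Only `v` and `w` are assumed to be Cauchy. The sequence `w'` follows from `eLpNorm_dzbar_le`
applied to differences, and closedness of the weak derivatives identifies the limits. -/
lemma SupportedSobolev.exists_tendsto {K : Set ℂ} (hK : IsCompact K) {v w w' : ℕ → ℂ → ℂ}
    (h : ∀ n, SupportedSobolev K (v n) (w n) (w' n)) {B : ℕ → ENNReal} (hB : ∑' i, B i ≠ ⊤)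
    (hc : ∀ N n m, N ≤ n → N ≤ m →
      eLpNorm (v n - v m) 2 volume + eLpNorm (w n - w m) 2 volume < B N) :
    ∃ v₀ w₀ w₀', SupportedSobolev K v₀ w₀ w₀' ∧
      Filter.Tendsto (fun n => eLpNorm (v n - v₀) 2 volume + eLpNorm (w n - w₀) 2 volume)
        Filter.atTop (𝓝 0) := by
  obtain ⟨v₀, m, z, t⟩ := exists_tendsto_eLpNorm hK (fun n => (h n).memLp)
    (fun n => (h n).eq_zero) hB fun N n k hn hk => le_self_add.trans_lt (hc N n k hn hk)
  obtain ⟨w₀, m₁, z₁, t₁⟩ := exists_tendsto_eLpNorm hK (fun n => (h n).memLp_dz)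
    (fun n => (h n).eq_zero_dz) hB fun N n k hn hk => le_add_self.trans_lt (hc N n k hn hk)
  obtain ⟨w₀', m₂, z₂, t₂⟩ := exists_tendsto_eLpNorm hK (fun n => (h n).memLp_dzbar)
    (fun n => (h n).eq_zero_dzbar) hB fun N n k hn hk =>
      (((h n).sub (h k)).eLpNorm_dzbar_le hK).trans_lt (le_add_self.trans_lt (hc N n k hn hk))
  refine ⟨v₀, w₀, w₀', ⟨m, m₁, m₂, z, z₁, z₂, ?_, ?_⟩, by simpa using t.add t₁⟩
  · exact IsWeakDeriv.of_tendsto (fun ψ hψ => hψ.dz_props) (fun n => (h n).weak_dz)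
      (fun n => (h n).memLp) (fun n => (h n).memLp_dz) m m₁ t t₁
  · exact IsWeakDeriv.of_tendsto (fun ψ hψ => hψ.dzbar_props) (fun n => (h n).weak_dzbar)
      (fun n => (h n).memLp) (fun n => (h n).memLp_dzbar) m m₂ t t₂

lemma chartExtend_sub {X : Type*} [TopologicalSpace X] (e : OpenPartialHomeomorph X ℂ) (v v' : ℂ → ℂ) :
    chartExtend e (v - v') = chartExtend e v - chartExtend e v' := by
  ext x
  by_cases hx : x ∈ e.source <;> simp [chartExtend, hx]

section

variable {X : Type*} [TopologicalSpace X] [T2Space X] [CompactSpace X] [ChartedSpace ℂ X]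
  [IsManifold 𝓘(ℂ) ω X] [MeasurableSpace X] [BorelSpace X]

lemma smoothToL21_ae (ν : VolumeForm X) (f : SmoothFun X) :
    L21.toLp (smoothToL21 ν f) =ᵐ[ν.measure] (f : X → ℂ) := MemLp.coeFn_toLp (smooth_memLp f.2 ν)

/-- Smooth functions are dense in `L²₁(X)`. -/
theorem denseRange_smoothToL21 (ν : VolumeForm X) : DenseRange (smoothToL21 ν) := by
  intro f
  rw [EMetric.mem_closure_iff]
  intro ε hε
  obtain ⟨t, θ, hθ, h1⟩ := exists_chartUnity X
  have hat : ∀ a : X, chartAt ℂ a ∈ atlas ℂ X := fun a => chart_mem_atlas ℂ a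
  -- The compact set `K a` leaves room around the support of `θ a` for mollification, and provides
  -- one constant `C a` valid for approximations of every accuracy.
  choose K hK hKi hKt using fun a : X => exists_compact_between (hθ a).hasCompactSupport
    (chartAt ℂ a).open_target (hθ a).tsupport_subset
  choose C hC using fun a => exists_ofChart ν (hat a) (hK a) (hKt a)
  obtain ⟨δ, hδ, hδε⟩ := ENNReal.exists_nnreal_pos_mul_lt (a := 2 * ∑ a ∈ t, (C a : ENNReal))
    (ENNReal.mul_ne_top (by simp) (ENNReal.sum_ne_top.2 fun a _ => ENNReal.coe_ne_top)) hε.ne'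
  have hδ' : (δ : ENNReal) ≠ 0 := by simpa using hδ.ne'
  choose A hA using fun a => L21.exists_supportedSobolev ν (hat a) (hθ a)
  choose w w' hS hw using fun a => hA a f
  choose g hg hg1 hg2 hg3 using fun a => (hS a).exists_testFunction (hθ a).hasCompactSupport
    isOpen_interior (hKi a) hδ'
  have hgS : ∀ a, SupportedSobolev (K a) (g a) (dz (g a)) (dzbar (g a)) := fun a =>
    (hg a).supportedSobolev.mono ((hg a).tsupport_subset.trans interior_subset)
  have hgt : ∀ a, IsTestFunction (chartAt ℂ a).target (g a) := fun a =>
    (hg a).mono (interior_subset.trans (hKt a))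
  choose P hP hPle using fun a => hC a _ _ _
    (((hS a).mono ((hKi a).trans interior_subset)).sub (hgS a))
  let G : SmoothFun X := ∑ a ∈ t, ⟨_, chartExtend_mem_smoothFun (hat a) (hgt a)⟩
  have hG : ∀ x, (G : X → ℂ) x = ∑ a ∈ t, chartExtend (chartAt ℂ a) (g a) x := by
    intro x
    simp [G]
  -- As the `θ a` sum to one, the local errors add up to the global one.
  have key : f - smoothToL21 ν G = ∑ a ∈ t, P a := by
    refine L21.ext_ae ?_
    have hall : ∀ᵐ x ∂ν.measure, ∀ a ∈ t, L21.toLp (P a) x = chartExtend (chartAt ℂ a)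
        ((fun z => θ a z * L21.toLp f ((chartAt ℂ a).symm z)) - g a) x :=
      (ae_ball_iff t.countable_toSet).2 fun a _ => hP a
    filter_upwards [L21.toLp_sub_ae f (smoothToL21 ν G), L21.toLp_sum_ae t P,
      smoothToL21_ae ν G, hall] with x hx1 hx2 hx3 hx4
    rw [hx1, hx2, Pi.sub_apply, hx3, hG, Finset.sum_congr rfl fun a ha => hx4 a ha]
    simp only [chartExtend_sub, Pi.sub_apply, chartExtend_mul, Finset.sum_sub_distrib]
    rw [← Finset.sum_mul, h1, one_mul]
  refine ⟨_, ⟨G, rfl⟩, ?_⟩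
  rw [edist_eq_enorm_sub, key]
  refine (enorm_sum_le _ _).trans_lt (lt_of_le_of_lt ?_ hδε)
  rw [Finset.mul_sum, Finset.mul_sum]
  refine Finset.sum_le_sum fun a _ => (hPle a).trans ?_
  calc (C a : ENNReal) * _ ≤ C a * (δ + δ) := by
        gcongr
        · exact hg1 a
        · exact hg2 a
    _ = _ := by ring

/-- `L²₁(X)` is complete. -/
theorem completeSpace_L21 (ν : VolumeForm X) : CompleteSpace (L21 ν) := by
  obtain ⟨t, θ, hθ, h1⟩ := exists_chartUnity X
  have hat : ∀ a : X, chartAt ℂ a ∈ atlas ℂ X := fun a => chart_mem_atlas ℂ a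
  choose C hC using fun a => exists_ofChart ν (hat a) (hθ a).hasCompactSupport
    (hθ a).tsupport_subset
  choose A hA using fun a => L21.exists_eLpNorm_localization_le ν (hat a) (hθ a)
  choose A' hA' using fun a => L21.exists_supportedSobolev ν (hat a) (hθ a)
  refine EMetric.complete_of_convergent_controlled_sequences (fun n => (1 / 2 : ENNReal) ^ n)
    (fun n => ENNReal.pow_pos (by simp) n) fun f hf => ?_
  choose w w' hS hw using fun a n => hA' a (f n)
  have hlim : ∀ a, ∃ v₀ w₀ w₀', SupportedSobolev (tsupport (θ a)) v₀ w₀ w₀' ∧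
      Filter.Tendsto (fun n => eLpNorm ((fun z => θ a z * L21.toLp (f n) ((chartAt ℂ a).symm z)) - v₀)
        2 volume + eLpNorm (w a n - w₀) 2 volume) Filter.atTop (𝓝 0) := by
    intro a
    -- `A a + 1` rather than `A a`: the bound must be strict, so the factor may not vanish.
    refine SupportedSobolev.exists_tendsto (B := fun n => (A a + 1) * (1 / 2 : ENNReal) ^ n)
      (hθ a).hasCompactSupport (hS a) ?_ fun N n m hn hm => ?_
    · rw [ENNReal.tsum_mul_left, ENNReal.tsum_geometric]
      refine ENNReal.mul_ne_top (by simp) ?_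
      norm_num
    · refine (hA a (f n - f m) (fun x => L21.toLp (f n) x - L21.toLp (f m) x)
        (L21.toLp_sub_ae _ _) _ _ _ _ ((hS a n).sub (hS a m))
        (Filter.Eventually.of_forall fun z => by simp [mul_sub])).trans_lt ?_
      have := hf N n m hn hm
      rw [edist_eq_enorm_sub] at this
      calc (A a : ENNReal) * ‖f n - f m‖ₑ ≤ (A a + 1) * ‖f n - f m‖ₑ := by
            gcongr
            exact le_self_add
        _ < (A a + 1) * (1 / 2) ^ N :=
            ENNReal.mul_right_strictMono (by simp) (by simp) this
  choose v₀ w₀ w₀' hS₀ hlim using hlim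
  choose P hP hPle using fun a => hC a _ _ _ (hS₀ a)
  choose Q hQ hQle using fun a n => hC a _ _ _ ((hS a n).sub (hS₀ a))
  -- The candidate limit is the sum of the local limits, each extended by zero; the partition of
  -- unity reassembles the differences.
  have key : ∀ n, f n - ∑ a ∈ t, P a = ∑ a ∈ t, Q a n := by
    intro n
    refine L21.ext_ae ?_
    have hallP : ∀ᵐ x ∂ν.measure, ∀ a ∈ t, L21.toLp (P a) x =
        chartExtend (chartAt ℂ a) (v₀ a) x :=
      (ae_ball_iff t.countable_toSet).2 fun a _ => hP a
    have hallQ : ∀ᵐ x ∂ν.measure, ∀ a ∈ t, L21.toLp (Q a n) x = chartExtend (chartAt ℂ a)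
        ((fun z => θ a z * L21.toLp (f n) ((chartAt ℂ a).symm z)) - v₀ a) x :=
      (ae_ball_iff t.countable_toSet).2 fun a _ => hQ a n
    filter_upwards [L21.toLp_sub_ae (f n) (∑ a ∈ t, P a), L21.toLp_sum_ae t P,
      L21.toLp_sum_ae t fun a => Q a n, hallP, hallQ] with x hx1 hx2 hx3 hx4 hx5
    rw [hx1, hx3, Pi.sub_apply, hx2, Finset.sum_congr rfl fun a ha => hx4 a ha,
      Finset.sum_congr rfl fun a ha => hx5 a ha]
    simp only [chartExtend_sub, Pi.sub_apply, chartExtend_mul, Finset.sum_sub_distrib]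
    rw [← Finset.sum_mul, h1, one_mul]
  refine ⟨∑ a ∈ t, P a, ?_⟩
  rw [tendsto_iff_edist_tendsto_0]
  have hsum : Filter.Tendsto (fun n => ∑ a ∈ t, (C a : ENNReal) *
      (eLpNorm ((fun z => θ a z * L21.toLp (f n) ((chartAt ℂ a).symm z)) - v₀ a)
        2 volume + eLpNorm (w a n - w₀ a) 2 volume)) Filter.atTop (𝓝 0) := by
    have := tendsto_finsetSum t fun a _ =>
      ENNReal.Tendsto.const_mul (hlim a) (Or.inr (ENNReal.coe_ne_top (r := C a)))
    simpa using this
  refine tendsto_of_tendsto_of_tendsto_of_le_of_le tendsto_const_nhds hsum (fun _ => zero_le)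
    fun n => ?_
  rw [edist_eq_enorm_sub, key]
  exact (enorm_sum_le _ _).trans (Finset.sum_le_sum fun a _ => hQle a n)

end

/-! ### Estimates for the pull-back -/

/-- `C + 1` stands for a bound of the square root of `C`. -/
lemma eLpNorm_two_le_of_lintegral_le {α : Type*} [MeasurableSpace α] {μ : Measure α} {u : α → ℂ}
    {C : NNReal} {a : ENNReal} (h : ∫⁻ x, ‖u x‖ₑ ^ 2 ∂μ ≤ C * a ^ 2) :
    eLpNorm u 2 μ ≤ (C + 1) * a := by
  rw [← ENNReal.pow_le_pow_left_iff (n := 2) two_ne_zero, eLpNorm_two_sq, mul_pow]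
  refine h.trans ?_
  gcongr
  exact le_self_add.trans (le_self_pow₀ le_add_self two_ne_zero)

/-- On a disc, a function is controlled by its derivative `∂` and its values on an annulus. -/
lemma exists_eLpNorm_le_annulus (z₀ : ℂ) {R : ℝ} (hR : 0 < R) {W : Set ℂ} (hW : IsOpen W)
    (hRW : Metric.closedBall z₀ R ⊆ W) : ∃ C : NNReal, ∀ h : ℂ → ℂ, ContDiffOn ℝ ∞ h W →
      eLpNorm h 2 (volume.restrict (Metric.closedBall z₀ (R / 2))) ≤
        C * (eLpNorm (dz h) 2 (volume.restrict (Metric.closedBall z₀ R)) +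
          eLpNorm h 2 (volume.restrict (Metric.closedBall z₀ R \ Metric.ball z₀ (R / 2)))) := by
  obtain ⟨θ, hθ, hθ1, -⟩ := exists_cutoff (isCompact_closedBall z₀ (R / 2))
    (Metric.isOpen_ball (x := z₀) (ε := R)) (Metric.closedBall_subset_ball (by linarith))
  have hA : IsCompact (Metric.closedBall z₀ R \ Metric.ball z₀ (R / 2)) :=
    (isCompact_closedBall z₀ R).diff Metric.isOpen_ball
  obtain ⟨B, hB⟩ := exists_memLp_mul_bound (isCompact_closedBall z₀ R) hθ.contDiff.continuous
    fun z hz => hθ.eq_zero fun h => hz (Metric.ball_subset_closedBall h)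
  -- `θ` is one near the half disc and zero off the disc, so `dz θ` lives on the annulus. The
  -- Poincaré inequality for `θ h` therefore sees `h` itself only there.
  obtain ⟨B', hB'⟩ := exists_memLp_mul_bound hA hθ.dz_props.1 fun z hz => by
    by_cases hzR : z ∈ Metric.ball z₀ R
    · have hz2 : z ∈ Metric.ball z₀ (R / 2) := by
        by_contra h
        exact hz ⟨Metric.ball_subset_closedBall hzR, h⟩
      have : dz θ z = dz (fun _ => 1) z := dz_congr (hθ1 z (Metric.ball_subset_closedBall hz2))
      rw [this]
      simp [dz]
    · exact hθ.dz_eq_zero hzR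
  refine ⟨4 * R.toNNReal * (B + B'), fun h hh => ?_⟩
  have hhR : ContDiffOn ℝ ∞ h (Metric.ball z₀ R) :=
    hh.mono (Metric.ball_subset_closedBall.trans hRW)
  have hg := hθ.mul Metric.isOpen_ball hhR
  have m1 := isL2Loc_of_continuousOn (continuousOn_dz hW hh) _ hRW (isCompact_closedBall z₀ R)
  have m2 := isL2Loc_of_continuousOn hh.continuousOn _ (sdiff_subset.trans hRW) hA
  have hdz : dz (fun z => θ z * h z) = fun z => θ z * dz h z + dz θ z * h z := by
    ext z
    by_cases hz : z ∈ Metric.ball z₀ R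
    · exact dz_mul (hθ.differentiableAt z) ((hhR.contDiffAt
        (Metric.isOpen_ball.mem_nhds hz)).differentiableAt (by simp))
    · rw [hg.dz_eq_zero hz, hθ.dz_eq_zero hz, hθ.eq_zero hz]
      ring
  calc eLpNorm h 2 (volume.restrict (Metric.closedBall z₀ (R / 2)))
      = eLpNorm (fun z => θ z * h z) 2 (volume.restrict (Metric.closedBall z₀ (R / 2))) := by
        refine eLpNorm_congr_ae ?_
        filter_upwards [ae_restrict_mem Metric.isClosed_closedBall.measurableSet] with z hz
        rw [(hθ1 z hz).self_of_nhds, one_mul]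
    _ ≤ eLpNorm (fun z => θ z * h z) 2 volume := eLpNorm_restrict_le _ _ _ _
    _ ≤ 4 * R.toNNReal * eLpNorm (dz fun z => θ z * h z) 2 volume := by
        refine hg.eLpNorm_le (a := z₀) ?_
        rw [Real.coe_toNNReal R hR.le]
        exact Metric.ball_subset_closedBall
    _ ≤ 4 * R.toNNReal * (B * eLpNorm (dz h) 2 (volume.restrict (Metric.closedBall z₀ R)) +
          B' * eLpNorm h 2 (volume.restrict (Metric.closedBall z₀ R \ Metric.ball z₀ (R / 2)))) := by
        rw [hdz]
        gcongr
        exact (eLpNorm_add_le (hB _ m1).1.1 (hB' _ m2).1.1 (by norm_num)).trans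
          (add_le_add (hB _ m1).2 (hB' _ m2).2)
    _ ≤ 4 * R.toNNReal * ((B + B') * (eLpNorm (dz h) 2 (volume.restrict (Metric.closedBall z₀ R)) +
          eLpNorm h 2 (volume.restrict (Metric.closedBall z₀ R \ Metric.ball z₀ (R / 2))))) := by
        rw [mul_add (B + B' : ENNReal)]
        gcongr
        · exact le_self_add
        · exact le_add_self
    _ = _ := by
        push_cast
        ring

section

variable {X Y : Type*}
  [TopologicalSpace X] [ChartedSpace ℂ X] [IsManifold 𝓘(ℂ) ω X]
  [TopologicalSpace Y] [ChartedSpace ℂ Y] [IsManifold 𝓘(ℂ) ω Y]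
  {φ : X → Y} {d : ℕ} {e : OpenPartialHomeomorph X ℂ} {e' : OpenPartialHomeomorph Y ℂ}

lemma contDiffOn_comp_chartMap (hφ : MDifferentiable 𝓘(ℂ) 𝓘(ℂ) φ) (he : e ∈ atlas ℂ X)
    (he' : e' ∈ atlas ℂ Y) {f : Y → ℂ} (hf : f ∈ SmoothFun Y) :
    ContDiffOn ℝ ∞ (fun z => f (φ (e.symm z))) (chartDomain φ e e') := by
  have h1 : ContDiffOn ℝ ∞ (chartMap φ e e') (chartDomain φ e e') :=
    ((differentiableOn_chartMap hφ he he').contDiffOn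
      (isOpen_chartDomain hφ.continuous)).restrict_scalars ℝ
  refine ((smooth_chart hf he').comp h1 fun z hz => chartMap_mem_target hz).congr fun z hz => ?_
  rw [comp_apply, symm_chartMap hz]

lemma comp_mem_smoothFun (hφ : MDifferentiable 𝓘(ℂ) 𝓘(ℂ) φ) {f : Y → ℂ} (hf : f ∈ SmoothFun Y) :
    f ∘ φ ∈ SmoothFun X := by
  have := isManifold_real (X := X)
  intro x
  have hs := mem_chart_source ℂ x
  have h1 := (contDiffOn_comp_chartMap hφ (chart_mem_atlas ℂ x) (chart_mem_atlas ℂ (φ x))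
    hf).contDiffAt ((isOpen_chartDomain hφ.continuous).mem_nhds
      (mem_chartDomain hs (mem_chart_source ℂ (φ x))))
  have h2 : ContMDiffAt 𝓘(ℝ, ℂ) 𝓘(ℝ, ℂ) ∞ (fun x' => f (φ ((chartAt ℂ x).symm (chartAt ℂ x x')))) x :=
    h1.contMDiffAt.comp x (contMDiffAt_of_mem_maximalAtlas
      (IsManifold.subset_maximalAtlas (chart_mem_atlas ℂ x)) hs)
  refine h2.congr_of_eventuallyEq ?_
  filter_upwards [(chartAt ℂ x).open_source.mem_nhds hs] with y hy
  rw [(chartAt ℂ x).left_inv hy, comp_apply]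

variable [T2Space Y] [CompactSpace Y] [MeasurableSpace Y] [BorelSpace Y]

lemma lintegral_dz_smooth_le (ν : VolumeForm Y) (he' : e' ∈ atlas ℂ Y) (f : SmoothFun Y) :
    ∫⁻ y in e'.target, ‖dz (fun y => (f : Y → ℂ) (e'.symm y)) y‖ₑ ^ 2 ≤
      ‖smoothToL21 ν f‖ₑ ^ 2 := by
  refine le_trans (le_of_eq (lintegral_congr_ae ?_)) ((smoothToL21 ν f).lintegral_weakDz_le he')
  have := (isWeakDeriv_dz e'.open_target (smooth_chart f.2 he')).unique e'.open_target
    ((smoothToL21 ν f).weakDz_spec he').1 (ν.ae_chart (smoothToL21_ae ν f).symm he')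
  filter_upwards [this] with y hy
  rw [hy]

/-- Conformal invariance up to multiplicity: the chain rule yields the factor `|F'|²` of the area
formula, so critical points in `A` are harmless. -/
lemma BranchedMap.lintegral_dz_comp_le (h : BranchedMap φ d) (ν : VolumeForm Y)
    (he : e ∈ atlas ℂ X) (he' : e' ∈ atlas ℂ Y) {A : Set ℂ} (hA : MeasurableSet A)
    (hAW : A ⊆ chartDomain φ e e') (f : SmoothFun Y) :
    ∫⁻ z in A, ‖dz (fun z => (f : Y → ℂ) (φ (e.symm z))) z‖ₑ ^ 2 ≤
      d * ‖smoothToL21 ν f‖ₑ ^ 2 := by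
  have hu := smooth_chart f.2 he'
  have hW : IsOpen (chartDomain φ e e') := isOpen_chartDomain h.mdifferentiable.continuous
  calc _ = ∫⁻ z in A, ‖deriv (chartMap φ e e') z‖ₑ ^ 2 *
        ‖dz (fun y => (f : Y → ℂ) (e'.symm y)) (chartMap φ e e' z)‖ₑ ^ 2 := by
        refine setLIntegral_congr_fun hA fun z hz => ?_
        have h1 : (fun z => (f : Y → ℂ) (φ (e.symm z))) =ᶠ[𝓝 z]
            fun z => (f : Y → ℂ) (e'.symm (chartMap φ e e' z)) := by
          filter_upwards [hW.mem_nhds (hAW hz)] with w hw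
          rw [symm_chartMap hw]
        change ‖dz (fun z => (f : Y → ℂ) (φ (e.symm z))) z‖ₑ ^ 2 = _
        rw [dz_congr h1, dz_comp (f := fun y => (f : Y → ℂ) (e'.symm y)) ((hu.contDiffAt
          (e'.open_target.mem_nhds (chartMap_mem_target (hAW hz)))).differentiableAt (by simp))
          (hasDerivAt_chartMap h.mdifferentiable he he' (hAW hz)), enorm_mul, mul_pow, mul_comm]
    _ ≤ d * ∫⁻ y in e'.target, ‖dz (fun y => (f : Y → ℂ) (e'.symm y)) y‖ₑ ^ 2 := by
        refine (h.finiteBranched he he').lintegral_comp_le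
          (h := fun y => ‖dz (fun y => (f : Y → ℂ) (e'.symm y)) y‖ₑ ^ 2) hA hAW
          e'.open_target.measurableSet (fun z hz => chartMap_mem_target (hAW hz)) ?_
        exact ((continuousOn_dz e'.open_target hu).aestronglyMeasurable
          e'.open_target.measurableSet).enorm.pow_const 2
    _ ≤ _ := by
        gcongr
        exact lintegral_dz_smooth_le ν he' f

/-- Here the Jacobian is not supplied by a derivative of `f`. Away from critical points it may be
inserted at the cost of the constant `M²`, where `M` bounds `1 / |F'|` on `A`. -/
lemma BranchedMap.exists_lintegral_comp_le (h : BranchedMap φ d) (ν : VolumeForm Y)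
    (he : e ∈ atlas ℂ X) (he' : e' ∈ atlas ℂ Y) {A : Set ℂ} (hA : IsCompact A)
    (hAW : A ⊆ chartDomain φ e e') (hA0 : ∀ z ∈ A, deriv (chartMap φ e e') z ≠ 0) :
    ∃ C : NNReal, ∀ f : SmoothFun Y, ∫⁻ z in A, ‖(f : Y → ℂ) (φ (e.symm z))‖ₑ ^ 2 ≤
      C * ‖smoothToL21 ν f‖ₑ ^ 2 := by
  have hF := h.finiteBranched he he'
  set F := chartMap φ e e' with hFd
  have hB : IsCompact (F '' A) := hA.image_of_continuousOn (hF.differentiableOn.continuousOn.mono hAW)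
  have hBt : F '' A ⊆ e'.target := by
    rintro _ ⟨z, hz, rfl⟩
    exact chartMap_mem_target (hAW hz)
  obtain ⟨C, hC⟩ := L21.exists_lintegral_chart_le ν he' hB hBt
  obtain ⟨M, hM⟩ := hA.exists_bound_of_continuousOn (f := fun z => (deriv F z)⁻¹)
    ((hF.differentiableOn_deriv.continuousOn.mono hAW).inv₀ hA0)
  refine ⟨M.toNNReal ^ 2 * (d * C), fun f => ?_⟩
  have hae := ae_restrict_of_ae_restrict_of_subset hBt (ν.ae_chart (smoothToL21_ae ν f) he')
  calc ∫⁻ z in A, ‖(f : Y → ℂ) (φ (e.symm z))‖ₑ ^ 2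
      ≤ ∫⁻ z in A, (M.toNNReal : ENNReal) ^ 2 *
          (‖deriv F z‖ₑ ^ 2 * ‖(f : Y → ℂ) (e'.symm (F z))‖ₑ ^ 2) := by
        refine setLIntegral_mono' hA.measurableSet fun z hz => ?_
        rw [symm_chartMap (hAW hz), ← mul_assoc, ← mul_pow]
        refine le_mul_of_one_le_left zero_le (one_le_pow₀ ?_)
        have h1 : ‖(deriv F z)⁻¹‖ₑ ≤ M.toNNReal := by
          rw [← ofReal_norm]
          exact ENNReal.ofReal_le_ofReal (hM z hz)
        calc (1 : ENNReal) = ‖(deriv F z)⁻¹ * deriv F z‖ₑ := by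
              rw [inv_mul_cancel₀ (hA0 z hz), enorm_one]
          _ ≤ _ := by
              rw [enorm_mul]
              gcongr
    _ = (M.toNNReal : ENNReal) ^ 2 *
          ∫⁻ z in A, ‖deriv F z‖ₑ ^ 2 * ‖(f : Y → ℂ) (e'.symm (F z))‖ₑ ^ 2 :=
        lintegral_const_mul' _ _ (by simp)
    _ ≤ (M.toNNReal : ENNReal) ^ 2 *
          (d * ∫⁻ y in F '' A, ‖(f : Y → ℂ) (e'.symm y)‖ₑ ^ 2) := by
        gcongr
        refine hF.lintegral_comp_le (h := fun y => ‖(f : Y → ℂ) (e'.symm y)‖ₑ ^ 2) hA.measurableSet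
          hAW hB.measurableSet (fun z hz => mem_image_of_mem F hz) ?_
        exact (((smooth_chart f.2 he').continuousOn.mono hBt).aestronglyMeasurable
          hB.measurableSet).enorm.pow_const 2
    _ ≤ (M.toNNReal : ENNReal) ^ 2 * (d * (C * ‖smoothToL21 ν f‖ₑ ^ 2)) := by
        gcongr
        refine le_trans (le_of_eq (lintegral_congr_ae ?_)) (hC (smoothToL21 ν f))
        filter_upwards [hae] with y hy
        rw [hy]
    _ = _ := by
        push_cast
        ring

/-- At a critical point the previous `L²` bound is lost. It still holds on an annulus around the
point, and with the derivative bound on the disc it propagates inwards by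
`exists_eLpNorm_le_annulus`. -/
lemma BranchedMap.exists_lintegral_nhds_le (h : BranchedMap φ d)
    (hne : ∀ x, ¬ ∀ᶠ x' in 𝓝 x, φ x' = φ x) (ν : VolumeForm Y) (he : e ∈ atlas ℂ X) {z₀ : ℂ}
    (hz₀ : z₀ ∈ e.target) : ∃ V ∈ 𝓝 z₀, ∃ C : NNReal, ∀ f : SmoothFun Y,
      ∫⁻ z in V, ‖(f : Y → ℂ) (φ (e.symm z))‖ₑ ^ 2 ≤ C * ‖smoothToL21 ν f‖ₑ ^ 2 ∧
      ∫⁻ z in V, ‖dz (fun z => (f : Y → ℂ) (φ (e.symm z))) z‖ₑ ^ 2 ≤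
        C * ‖smoothToL21 ν f‖ₑ ^ 2 := by
  set e' := chartAt ℂ (φ (e.symm z₀)) with he'd
  have he' : e' ∈ atlas ℂ Y := chart_mem_atlas ℂ _
  have hz₀W : z₀ ∈ chartDomain φ e e' := ⟨hz₀, mem_chart_source ℂ _⟩
  have hW : IsOpen (chartDomain φ e e') := isOpen_chartDomain h.mdifferentiable.continuous
  have hd := (eventually_eq_or_eventually_deriv_ne_zero h.mdifferentiable he he'
    (e.map_target hz₀) hz₀W.2).resolve_left (hne _)
  rw [e.right_inv hz₀, eventually_nhdsWithin_iff] at hd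
  -- The closed disc is inside the chart domain and contains no critical point other than possibly
  -- its centre.
  obtain ⟨R, hR, hRs⟩ := Metric.nhds_basis_closedBall.mem_iff.1
    (Filter.inter_mem hd (hW.mem_nhds hz₀W))
  have hRW : Metric.closedBall z₀ R ⊆ chartDomain φ e e' := fun z hz => (hRs hz).2
  obtain ⟨C₁, hC₁⟩ := exists_eLpNorm_le_annulus z₀ hR hW hRW
  obtain ⟨C₂, hC₂⟩ := h.exists_lintegral_comp_le ν he he'
    ((isCompact_closedBall z₀ R).diff (Metric.isOpen_ball (x := z₀) (ε := R / 2)))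
    (sdiff_subset.trans hRW) fun z hz => (hRs hz.1).1 fun h0 => hz.2 (by
      rw [mem_singleton_iff.1 h0]
      exact Metric.mem_ball_self (by linarith))
  refine ⟨_, Metric.closedBall_mem_nhds z₀ (half_pos hR), (C₁ * ((d + 1) + (C₂ + 1))) ^ 2 + d,
    fun f => ⟨?_, ?_⟩⟩
  · rw [← eLpNorm_two_sq]
    calc _ ≤ (C₁ * ((d + 1) * ‖smoothToL21 ν f‖ₑ + (C₂ + 1) * ‖smoothToL21 ν f‖ₑ)) ^ 2 := by
          gcongr
          refine (hC₁ _ (contDiffOn_comp_chartMap h.mdifferentiable he he' f.2)).trans ?_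
          gcongr
          · exact eLpNorm_two_le_of_lintegral_le (C := d) (h.lintegral_dz_comp_le ν he he'
              Metric.isClosed_closedBall.measurableSet hRW f)
          · exact eLpNorm_two_le_of_lintegral_le (hC₂ f)
      _ = (C₁ * ((d + 1) + (C₂ + 1))) ^ 2 * ‖smoothToL21 ν f‖ₑ ^ 2 := by ring
      _ ≤ _ := by
          gcongr
          push_cast
          exact le_self_add
  · refine (h.lintegral_dz_comp_le ν he he' Metric.isClosed_closedBall.measurableSet
      ((Metric.closedBall_subset_closedBall (by linarith)).trans hRW) f).trans ?_
    gcongr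
    push_cast
    exact le_add_self

lemma BranchedMap.exists_lintegral_compact_le (h : BranchedMap φ d)
    (hne : ∀ x, ¬ ∀ᶠ x' in 𝓝 x, φ x' = φ x) (ν : VolumeForm Y) (he : e ∈ atlas ℂ X) {K : Set ℂ}
    (hK : IsCompact K) (hKe : K ⊆ e.target) : ∃ C : NNReal, ∀ f : SmoothFun Y,
      ∫⁻ z in K, ‖(f : Y → ℂ) (φ (e.symm z))‖ₑ ^ 2 ≤ C * ‖smoothToL21 ν f‖ₑ ^ 2 ∧
      ∫⁻ z in K, ‖dz (fun z => (f : Y → ℂ) (φ (e.symm z))) z‖ₑ ^ 2 ≤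
        C * ‖smoothToL21 ν f‖ₑ ^ 2 := by
  refine hK.induction_on (p := fun S => ∃ C : NNReal, ∀ f : SmoothFun Y,
      ∫⁻ z in S, ‖(f : Y → ℂ) (φ (e.symm z))‖ₑ ^ 2 ≤ C * ‖smoothToL21 ν f‖ₑ ^ 2 ∧
      ∫⁻ z in S, ‖dz (fun z => (f : Y → ℂ) (φ (e.symm z))) z‖ₑ ^ 2 ≤
        C * ‖smoothToL21 ν f‖ₑ ^ 2) ⟨0, by simp⟩ ?_ ?_ ?_
  · rintro s t hst ⟨C, hC⟩
    exact ⟨C, fun f => ⟨(lintegral_mono_set hst).trans (hC f).1,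
      (lintegral_mono_set hst).trans (hC f).2⟩⟩
  · rintro s t ⟨C, hC⟩ ⟨C', hC'⟩
    refine ⟨C + C', fun f => ⟨(lintegral_union_le _ _ _).trans ?_,
      (lintegral_union_le _ _ _).trans ?_⟩⟩
    · push_cast
      rw [add_mul]
      exact add_le_add (hC f).1 (hC' f).1
    · push_cast
      rw [add_mul]
      exact add_le_add (hC f).2 (hC' f).2
  · intro z hz
    obtain ⟨V, hV, hC⟩ := h.exists_lintegral_nhds_le hne ν he (hKe hz)
    exact ⟨V, mem_nhdsWithin_of_mem_nhds hV, hC⟩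

variable [T2Space X] [CompactSpace X] [MeasurableSpace X] [BorelSpace X]

/-- The pull-back of smooth functions is bounded for the `L²₁` norms. -/
theorem BranchedMap.exists_pull_le (h : BranchedMap φ d)
    (hne : ∀ x, ¬ ∀ᶠ x' in 𝓝 x, φ x' = φ x) (νX : VolumeForm X) (νY : VolumeForm Y) :
    ∃ C : NNReal, ∀ (f : SmoothFun Y) (g : SmoothFun X), (∀ x, (g : X → ℂ) x = (f : Y → ℂ) (φ x)) →
      ‖smoothToL21 νX g‖ₑ ≤ C * ‖smoothToL21 νY f‖ₑ := by
  obtain ⟨t, θ, hθ, h1⟩ := exists_chartUnity X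
  have hat : ∀ a : X, chartAt ℂ a ∈ atlas ℂ X := fun a => chart_mem_atlas ℂ a
  have hK : ∀ a, IsCompact (tsupport (θ a)) := fun a => (hθ a).hasCompactSupport
  choose C hC using fun a => exists_ofChart νX (hat a) (hK a) (hθ a).tsupport_subset
  choose D hD using fun a => h.exists_lintegral_compact_le hne νY (hat a) (hK a)
    (hθ a).tsupport_subset
  choose B hB using fun a => exists_memLp_mul_bound (hK a) (hθ a).contDiff.continuous
    fun z hz => image_eq_zero_of_notMem_tsupport hz
  choose B' hB' using fun a => exists_memLp_mul_bound (hK a) (hθ a).dz_props.1 (hθ a).dz_props.2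
  refine ⟨∑ a ∈ t, C a * (B a * (D a + 1) + (B a * (D a + 1) + B' a * (D a + 1))), fun f g hg => ?_⟩
  have hgs := fun a => smooth_chart g.2 (hat a)
  have hv : ∀ a, IsTestFunction (chartAt ℂ a).target
      (fun z => θ a z * (g : X → ℂ) ((chartAt ℂ a).symm z)) := fun a =>
    (hθ a).mul (chartAt ℂ a).open_target (hgs a)
  have hvS := fun a => (hv a).supportedSobolev.mono (K' := tsupport (θ a)) tsupport_mul_subset_left
  choose P hP hPle using fun a => hC a _ _ _ (hvS a)
  have key : smoothToL21 νX g = ∑ a ∈ t, P a := by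
    refine L21.ext_ae ?_
    have hall : ∀ᵐ x ∂νX.measure, ∀ a ∈ t, L21.toLp (P a) x = chartExtend (chartAt ℂ a)
        (fun z => θ a z * (g : X → ℂ) ((chartAt ℂ a).symm z)) x :=
      (ae_ball_iff t.countable_toSet).2 fun a _ => hP a
    filter_upwards [L21.toLp_sum_ae t P, smoothToL21_ae νX g, hall] with x hx1 hx2 hx3
    rw [hx1, hx2, Finset.sum_congr rfl fun a ha => hx3 a ha]
    simp only [chartExtend_mul]
    rw [← Finset.sum_mul, h1, one_mul]
  rw [key]
  refine (enorm_sum_le _ _).trans ?_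
  push_cast
  rw [Finset.sum_mul]
  refine Finset.sum_le_sum fun a _ => (hPle a).trans ?_
  rw [mul_assoc]
  gcongr
  have m1 := isL2Loc_of_continuousOn (hgs a).continuousOn _ (hθ a).tsupport_subset (hK a)
  have m2 := isL2Loc_of_continuousOn (continuousOn_dz (chartAt ℂ a).open_target (hgs a)) _
    (hθ a).tsupport_subset (hK a)
  have hgf : (fun z => (g : X → ℂ) ((chartAt ℂ a).symm z)) =
      fun z => (f : Y → ℂ) (φ ((chartAt ℂ a).symm z)) := funext fun z => hg _
  have n1 : eLpNorm (fun z => (g : X → ℂ) ((chartAt ℂ a).symm z)) 2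
      (volume.restrict (tsupport (θ a))) ≤ (D a + 1) * ‖smoothToL21 νY f‖ₑ := by
    rw [hgf]
    exact eLpNorm_two_le_of_lintegral_le (hD a f).1
  have n2 : eLpNorm (dz fun z => (g : X → ℂ) ((chartAt ℂ a).symm z)) 2
      (volume.restrict (tsupport (θ a))) ≤ (D a + 1) * ‖smoothToL21 νY f‖ₑ := by
    rw [hgf]
    exact eLpNorm_two_le_of_lintegral_le (hD a f).2
  have hdz : dz (fun z => θ a z * (g : X → ℂ) ((chartAt ℂ a).symm z)) = fun z =>
      θ a z * dz (fun z => (g : X → ℂ) ((chartAt ℂ a).symm z)) z +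
        dz (θ a) z * (g : X → ℂ) ((chartAt ℂ a).symm z) := by
    ext z
    by_cases hz : z ∈ (chartAt ℂ a).target
    · exact dz_mul ((hθ a).differentiableAt z) (((hgs a).contDiffAt
        ((chartAt ℂ a).open_target.mem_nhds hz)).differentiableAt (by simp))
    · rw [(hv a).dz_eq_zero hz, (hθ a).dz_eq_zero hz, (hθ a).eq_zero hz]
      ring
  rw [add_mul, add_mul]
  refine add_le_add ?_ ?_
  · refine (hB a _ m1).2.trans ?_
    rw [mul_assoc]
    gcongr
  · rw [hdz]
    refine (eLpNorm_add_le (hB a _ m2).1.1 (hB' a _ m1).1.1 (by norm_num)).trans ?_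
    refine add_le_add ((hB a _ m2).2.trans ?_) ((hB' a _ m1).2.trans ?_)
    · rw [mul_assoc]
      gcongr
    · rw [mul_assoc]
      gcongr

/-- The push-forward of smooth functions is bounded for the `L²₁` norms. -/
theorem BranchedMap.exists_push_smooth (h : BranchedMap φ d) (νX : VolumeForm X)
    (νY : VolumeForm Y) : ∃ C : NNReal, ∀ g : SmoothFun X, ∃ P : L21 νY,
      L21.toLp P =ᵐ[νY.measure] pushforward φ (g : X → ℂ) ∧ ‖P‖ₑ ≤ C * ‖smoothToL21 νX g‖ₑ := by
  obtain ⟨t, θ, hθ, h1⟩ := exists_chartUnity X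
  have hat : ∀ a : X, chartAt ℂ a ∈ atlas ℂ X := fun a => chart_mem_atlas ℂ a
  have hfin : ∀ y, (φ ⁻¹' {y}).Finite := fun y =>
    finite_of_encard_le_coe (h.encard_fibre_le y)
  choose C hC using fun a => h.exists_push νY (hat a) (hθ a).hasCompactSupport
    (hθ a).tsupport_subset
  choose A hA using fun a => L21.exists_eLpNorm_localization_le νX (hat a) (hθ a)
  refine ⟨∑ a ∈ t, C a * A a, fun g => ?_⟩
  have hv : ∀ a, IsTestFunction (chartAt ℂ a).target
      (fun z => θ a z * (g : X → ℂ) ((chartAt ℂ a).symm z)) := fun a =>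
    (hθ a).mul (chartAt ℂ a).open_target (smooth_chart g.2 (hat a))
  have hvS := fun a => (hv a).supportedSobolev.mono (K' := tsupport (θ a)) tsupport_mul_subset_left
  choose P hP hPle using fun a => hC a _ _ _ (hvS a)
  refine ⟨∑ a ∈ t, P a, ?_, ?_⟩
  · have hall : ∀ᵐ y ∂νY.measure, ∀ a ∈ t, L21.toLp (P a) y = pushforward φ
        (chartExtend (chartAt ℂ a) (fun z => θ a z * (g : X → ℂ) ((chartAt ℂ a).symm z))) y :=
      (ae_ball_iff t.countable_toSet).2 fun a _ => hP a
    filter_upwards [L21.toLp_sum_ae t P, hall] with y hy1 hy2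
    rw [hy1, Finset.sum_congr rfl fun a ha => hy2 a ha]
    simp only [pushforward, finsum_mem_eq_finite_toFinset_sum _ (hfin y)]
    rw [Finset.sum_comm]
    refine Finset.sum_congr rfl fun x _ => ?_
    simp only [chartExtend_mul]
    rw [← Finset.mul_sum, ← Finset.sum_mul, h1, one_mul]
  · refine (enorm_sum_le _ _).trans ?_
    push_cast
    rw [Finset.sum_mul]
    refine Finset.sum_le_sum fun a _ => (hPle a).trans ?_
    rw [mul_assoc]
    gcongr
    exact hA a _ _ (smoothToL21_ae νX g) _ _ _ _ (hvS a) (Filter.Eventually.of_forall fun z => rfl)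

end

/-! ### Extension to `L²₁` -/

/-- The bound makes `g` factor continuously through the image of `i`, with no injectivity required;
density gives uniqueness and completeness gives existence. -/
lemma existsUnique_extension {E F G : Type*} [AddCommGroup E] [Module ℂ E] [NormedAddCommGroup F]
    [NormedSpace ℂ F] [NormedAddCommGroup G] [NormedSpace ℂ G] [CompleteSpace G]
    (i : E →ₗ[ℂ] F) (hi : DenseRange i) (g : E →ₗ[ℂ] G) {C : NNReal}
    (h : ∀ x, ‖g x‖ₑ ≤ C * ‖i x‖ₑ) : ∃! T : F →L[ℂ] G, ∀ x, T (i x) = g x := by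
  have h' : ∃ C : ℝ, ∀ x, ‖g x‖ ≤ C * ‖i x‖ := ⟨C, fun x => by
    have := h x
    simp only [enorm_eq_nnnorm] at this
    exact_mod_cast this⟩
  refine ⟨g.extendOfNorm i, fun x => LinearMap.extendOfNorm_eq hi h' x, fun T hT => ?_⟩
  refine ContinuousLinearMap.coeFn_injective (hi.equalizer T.continuous
    (g.extendOfNorm i).continuous (funext fun x => ?_))
  simp only [comp_apply]
  rw [hT, LinearMap.extendOfNorm_eq hi h']

end RiemannSurfaceL21

theorem proposition2p3 {X Y : Type*}
    [TopologicalSpace X] [T2Space X] [CompactSpace X] [ChartedSpace ℂ X] [IsManifold 𝓘(ℂ) ω X]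
    [MeasurableSpace X] [BorelSpace X]
    [TopologicalSpace Y] [T2Space Y] [CompactSpace Y] [ChartedSpace ℂ Y] [IsManifold 𝓘(ℂ) ω Y]
    [MeasurableSpace Y] [BorelSpace Y]
    (φ : X → Y) (hφ : MDifferentiable 𝓘(ℂ) 𝓘(ℂ) φ)
    (hnc : ∀ x, ∃ x' ∈ connectedComponent x, φ x' ≠ φ x)
    (νX : VolumeForm X) (νY : VolumeForm Y) :
    (∃ pull : SmoothFun Y →ₗ[ℂ] SmoothFun X,
      (∀ f x, (pull f : X → ℂ) x = (f : Y → ℂ) (φ x)) ∧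
      Continuous[smoothTopology νY, smoothTopology νX] pull ∧
      ∃! T : L21 νY →L[ℂ] L21 νX, ∀ f, T (smoothToL21 νY f) = smoothToL21 νX (pull f)) ∧
    (∀ y, (φ ⁻¹' {y}).Finite) ∧
    (∃ push : SmoothFun X →ₗ[ℂ] L21 νY,
      (∀ g : SmoothFun X, L21.toLp (push g) =ᵐ[νY.measure] pushforward φ (g : X → ℂ)) ∧
      Continuous[smoothTopology νX, inferInstance] push ∧
      ∃! T : L21 νX →L[ℂ] L21 νY, ∀ g, T (smoothToL21 νX g) = push g) := by
  have := completeSpace_L21 νX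
  have := completeSpace_L21 νY
  obtain ⟨d, h⟩ := exists_branchedMap hφ hnc
  have hfin : ∀ y, (φ ⁻¹' {y}).Finite := fun y => finite_of_encard_le_coe (h.encard_fibre_le y)
  refine ⟨?_, hfin, ?_⟩
  · obtain ⟨C, hC⟩ := h.exists_pull_le (not_eventually_eq hφ hnc) νX νY
    let pull : SmoothFun Y →ₗ[ℂ] SmoothFun X :=
      { toFun := fun f => ⟨f ∘ φ, comp_mem_smoothFun hφ f.2⟩
        map_add' := fun _ _ => rfl
        map_smul' := fun _ _ => rfl }
    have hT := existsUnique_extension (smoothToL21 νY) (denseRange_smoothToL21 νY)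
      (smoothToL21 νX ∘ₗ pull) fun f => hC f (pull f) fun _ => rfl
    refine ⟨pull, fun _ _ => rfl, ?_, hT⟩
    obtain ⟨T, hT, -⟩ := hT
    let := smoothTopology νY
    -- Both topologies are induced from `L21`, so continuity of `pull` is that of the extension `T`
    -- composed with the inclusion.
    refine continuous_induced_rng.2 ?_
    exact (T.continuous.comp continuous_induced_dom).congr hT
  · obtain ⟨C, hC⟩ := h.exists_push_smooth νX νY
    -- The classes are chosen one function at a time; they are determined almost everywhere by the
    -- fibre sums, whose linearity they inherit.
    choose P hP hPC using hC
    let push : SmoothFun X →ₗ[ℂ] L21 νY :=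
      { toFun := P
        map_add' := fun f g => by
          refine L21.ext_ae ?_
          rw [map_add]
          filter_upwards [hP (f + g), hP f, hP g, Lp.coeFn_add (L21.toLp (P f)) (L21.toLp (P g))]
            with y h1 h2 h3 h4
          rw [h1, h4, Pi.add_apply, h2, h3]
          simp only [pushforward]
          rw [← finsum_mem_add_distrib (hfin y)]
          simp [mul_add]
        map_smul' := fun c f => by
          refine L21.ext_ae ?_
          rw [map_smul]
          filter_upwards [hP (c • f), hP f, Lp.coeFn_smul c (L21.toLp (P f))] with y h1 h2 h3
          rw [h1, RingHom.id_apply, h3, Pi.smul_apply, h2, smul_eq_mul]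
          simp only [pushforward]
          simp only [finsum_mem_eq_finite_toFinset_sum _ (hfin y), Finset.mul_sum]
          simp [mul_left_comm] }
    have hT := existsUnique_extension (smoothToL21 νX) (denseRange_smoothToL21 νX) push hPC
    refine ⟨push, hP, ?_, hT⟩
    obtain ⟨T, hT, -⟩ := hT
    let := smoothTopology νX
    exact (T.continuous.comp continuous_induced_dom).congr hT
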